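/- Let $\mathcal H$ be a Hopf algebra with invertible antipode $S$ over a field $\Bbbk$ of characteristic zero, and let $\mathcal M$ be a stable anti-Yetter–Drinfeld (SAYD) module over $\mathcal H$: a right $\mathcal H$-module and left $\mathcal H$-comodule, $m\mapsto m^{(-1)}\otimes m^{(0)}$, with $$(mh)^{(-1)}\otimes (mh)^{(0)}=S(h^{(3)})m^{(-1)}h^{(1)}\otimes m^{(0)}h^{(2)},\qquad m^{(0)}m^{(-1)}=m .$$ Let $V$ be a left $\mathcal H$-module, let $F=T(V)$ be its tensor algebra with the diagonal action (a unital left $\mathcal H$-module algebra), and let $\bar F=\bigoplus_{n\ge 1}V^{\otimes n}$. For a left $\mathcal H$-module algebra $A$ let $C^{\mathcal H}_*(A,\mathcal M)$, $C^{\mathcal H}_n(A,\mathcal M)=\mathcal M\otimes_{\mathcal H}A^{\otimes n+1}$, be the cyclic module with inner faces $\partial_i(m\otimes a_0\otimes\dots\otimes a_n)=m\otimes a_0\otimes\dots\otimes a_ia_{i+1}\otimes\dots\otimes a_n$ for $0\le i<n$, last face $\partial_n(m\otimes a_0\otimes\dots\otimes a_n)=m^{(0)}\otimes S^{-1}(m^{(-1)})(a_n)a_0\otimes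 a_1\otimes\dots\otimes a_{n-1}$, degeneracies inserting $1$, and cyclic operator $\tau_n(m\otimes a_0\otimes\dots\otimes a_n)=m^{(0)}\otimes S^{-1}(m^{(-1)})(a_n)\otimes a_0\otimes\dots\otimes a_{n-1}$. Its Hochschild and cyclic homology, computed by the associated mixed complex $(C^{\mathcal H}_*(A,\mathcal M),b,B)$, are the Hopf-type Hochschild and cyclic homology of $A$ with coefficients in $\mathcal M$; the reduced cyclic homology $\overline{HC}{}^{\mathcal H}_*(A,\mathcal M)$ is that of the quotient mixed complex of $C^{\mathcal H}_*(A,\mathcal M)$ by the image of $C^{\mathcal H}_*(\Bbbk,\mathcal M)$. Let $\Omega^n(A)=A\otimes(A/\Bbbk)^{\otimes n}$ be the noncommutative differential forms on $A$, and $\Omega^n_{\mathcal H}(A,\mathcal M)=\mathcal M\otimes_{\mathcal H}\Omega^n(A)$. These form the mixed complex $(\Omega_{\mathcal H}(A,\mathcal M),b,B)$ with, for $\omega\in\Omega^n(A)$ and $a\in A$, $$b(m\otimes\omega\,da)=(-1)^{n}\bigl(m\otimes\omega a-m^{(0)}\otimes S^{-1}(m^{(-1)})(a)\,\omega\bigr),\qquad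 \kappa(m\otimes \omega\,da)=(-1)^{n}m^{(0)}\otimes d\bigl(S^{-1}(m^{(-1)})(a)\bigr)\omega,$$ $b=0$ and $\kappa=\mathrm{id}$ in degree $0$, and $B=\sum_{j=0}^{n}\kappa^jd$ on $\Omega^n_{\mathcal H}(A,\mathcal M)$. The subscript $\natural$ denotes the quotient by all elements $m\otimes_{\mathcal H}\omega f-m^{(0)}\otimes_{\mathcal H}S^{-1}(m^{(-1)})(f)\,\omega$, with $m\in\mathcal M$, $f$ in the algebra, and $\omega$ in the bimodule in question. The equivariant $X$-complex is the super ($\mathbb Z/2\mathbb Z$-graded) complex $$X_{\mathcal H}(F,\mathcal M):\quad \mathcal M\otimes_{\mathcal H}F\ \underset{b_{\mathcal M}}{\overset{\natural d_{\mathcal M}}{\rightleftarrows}}\ \Omega^1_{\mathcal H}(F,\mathcal M)_\natural ,$$ $$\natural d_{\mathcal M}(m\otimes_{\mathcal H} f)=\natural(m\otimes_{\mathcal H} df),\qquad b_{\mathcal M}(\natural(m\otimes_{\mathcal H}a\,db))=m\otimes_{\mathcal H}ab-m^{(0)}\otimes_{\mathcal H}S^{-1}(m^{(-1)})(b)\,a,$$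 equivalently a mixed complex concentrated in degrees $0$ and $1$. Then: 1. The Hopf-type Hochschild homology of $F$ with coefficients in $\mathcal M$ vanishes in all degrees greater than $1$. 2. The mixed complex of $F$ is quasi-isomorphic to $X_{\mathcal H}(F,\mathcal M)$. Precisely, the canonical projection $\Omega_{\mathcal H}(F,\mathcal M)\to X_{\mathcal H}(F,\mathcal M)$ (the identity in degree $0$, $\natural$ in degree $1$, zero in higher degrees) and the canonical map $C^{\mathcal H}_*(F,\mathcal M)\to X_{\mathcal H}(F,\mathcal M)$ (the identity in degree $0$, $m\otimes a\otimes b\mapsto\natural(m\otimes a\,db)$ in degree $1$, zero in higher degrees) are morphisms of mixed complexes which induce isomorphisms on the homology of $b$, and also on the homology of the associated $\mathbb Z/2\mathbb Z$-graded complexes $\bigl(\prod_n(-)_n,\,b+B\bigr)$. 3. The inclusion $\bar F\subset F$ induces an isomorphism $(\mathcal M\otimes_{\mathcal H}\bar F)_\natural\cong\overline{HC}{}^{\mathcal H}_0(F,\mathcal M)$, and $\overline{HC}{}^{\mathcal H}_n(F,\mathcal M)=0$ for all $n\ge1$. -/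

import Mathlib

open scoped TensorProduct

universe u v w x

noncomputable section

namespace HopfCyc

/-- The antipode of the Hopf algebra `H` is invertible. -/
class InvertibleAntipode (k : Type u) (H : Type v) [Field k] [Ring H] [HopfAlgebra k H] : Prop where
  bijective : Function.Bijective (HopfAlgebra.antipode k : H →ₗ[k] H)

section Antipode

variable (k : Type u) {H : Type v} [Field k] [Ring H] [HopfAlgebra k H]

/-- The inverse `S⁻¹` of the antipode. -/
def antipodeInv [hS : InvertibleAntipode k H] : H →ₗ[k] H :=
  (LinearEquiv.ofBijective (HopfAlgebra.antipode k : H →ₗ[k] H) hS.bijective).symm.toLinearMap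

variable [hS : InvertibleAntipode k H]

theorem antipode_antipodeInv (a : H) : HopfAlgebra.antipode k (antipodeInv k a) = a :=
  LinearEquiv.apply_symm_apply
    (LinearEquiv.ofBijective (HopfAlgebra.antipode k : H →ₗ[k] H) hS.bijective) a

theorem antipodeInv_antipode (a : H) : antipodeInv k (HopfAlgebra.antipode k a) = a :=
  LinearEquiv.symm_apply_apply
    (LinearEquiv.ofBijective (HopfAlgebra.antipode k : H →ₗ[k] H) hS.bijective) a

theorem antipodeInv_mul (a b : H) :
    antipodeInv k (a * b) = antipodeInv k b * antipodeInv k a := by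
  apply hS.bijective.1
  rw [antipode_antipodeInv, HopfAlgebra.antipode_mul_antidistrib, antipode_antipodeInv,
    antipode_antipodeInv]

theorem antipodeInv_one : antipodeInv k (1 : H) = 1 := by
  apply hS.bijective.1
  rw [antipode_antipodeInv, HopfAlgebra.antipode_one]

theorem counit_antipodeInv (a : H) :
    Coalgebra.counit (R := k) (antipodeInv k a) = Coalgebra.counit (R := k) a := by
  conv_rhs => rw [← antipode_antipodeInv k a, HopfAlgebra.counit_antipode]

/-- `h⁽²⁾ S⁻¹(h⁽¹⁾) = ε(h)`. -/
theorem mul_antipodeInv_comul (a : H) :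
    LinearMap.mul' k H (TensorProduct.comm k H H
      ((antipodeInv k).rTensor H (Coalgebra.comul (R := k) a)))
      = algebraMap k H (Coalgebra.counit (R := k) a) := by
  apply hS.bijective.1
  have key : ∀ z : H ⊗[k] H, HopfAlgebra.antipode k (LinearMap.mul' k H
      (TensorProduct.comm k H H ((antipodeInv k).rTensor H z)))
      = LinearMap.mul' k H ((HopfAlgebra.antipode k).lTensor H z) := by
    intro z
    induction z with
    | zero => simp
    | add y z hy hz => simp only [map_add, hy, hz]
    | tmul b c =>
      simp [HopfAlgebra.antipode_mul_antidistrib, antipode_antipodeInv]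
  rw [key, HopfAlgebra.mul_antipode_lTensor_comul_apply, Algebra.algebraMap_eq_smul_one, map_smul,
    HopfAlgebra.antipode_one]

end Antipode

section Comul4

variable (k : Type u) {H : Type v} [Field k] [Ring H] [HopfAlgebra k H]

/-- `h⁽¹⁾ ⊗ (h⁽²⁾ ⊗ h⁽³⁾)`. -/
def comul3 : H →ₗ[k] H ⊗[k] (H ⊗[k] H) :=
  (Coalgebra.comul (R := k) (A := H)).lTensor H ∘ₗ Coalgebra.comul

/-- Coassociativity for the fourfold comultiplication. -/
theorem comul4 (h : H) :
    TensorProduct.map (Coalgebra.comul (R := k)) (Coalgebra.comul (R := k))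
        (Coalgebra.comul (R := k) h)
      = (TensorProduct.assoc k H H (H ⊗[k] H)).symm
          ((TensorProduct.assoc k H H H).toLinearMap.lTensor H
            (((Coalgebra.comul (R := k)).rTensor H).lTensor H (comul3 k h))) := by
  have h1 : ((TensorProduct.assoc k H H H).toLinearMap.lTensor H
      (((Coalgebra.comul (R := k)).rTensor H).lTensor H (comul3 k h)))
      = ((Coalgebra.comul (R := k)).lTensor H).lTensor H (comul3 k h) := by
    simp only [comul3, LinearMap.comp_apply, ← LinearMap.lTensor_comp_apply]
    congr 1
    congr 1
    ext x
    simp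
  rw [h1]
  have h2 : comul3 k h = TensorProduct.assoc k H H H
      ((Coalgebra.comul (R := k)).rTensor H (Coalgebra.comul h)) := by
    simp [comul3]
  rw [h2]
  have h3 : ∀ y : (H ⊗[k] H) ⊗[k] H, (Coalgebra.comul (R := k)).lTensor (H ⊗[k] H) y
      = (TensorProduct.assoc k H H (H ⊗[k] H)).symm
        (((Coalgebra.comul (R := k)).lTensor H).lTensor H (TensorProduct.assoc k H H H y)) := by
    intro y
    induction y with
    | zero => simp
    | add y z hy hz => simp only [map_add, hy, hz]
    | tmul y c =>
      induction y with
      | zero => simp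
      | add y z hy hz => simp only [TensorProduct.add_tmul, map_add, hy, hz]
      | tmul a b =>
        simp only [LinearMap.lTensor_tmul, TensorProduct.assoc_tmul]
        induction Coalgebra.comul (R := k) c with
        | zero => simp
        | add y z hy hz => simp only [TensorProduct.tmul_add, map_add, hy, hz]
        | tmul d e => simp
  rw [← h3]
  exact (LinearMap.congr_fun (LinearMap.lTensor_comp_rTensor _ _ _) _).symm

theorem counit_mid (h : H) :
    ((Coalgebra.counit (R := k)).rTensor H).lTensor H (comul3 k h)
      = (TensorProduct.mk k k H 1).lTensor H (Coalgebra.comul (R := k) h) := by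
  simp only [comul3, LinearMap.comp_apply, ← LinearMap.lTensor_comp_apply]
  congr 2
  exact Coalgebra.rTensor_counit_comp_comul

/-- The antipode reverses the comultiplication. -/
theorem comul_antipode (h : H) :
    Coalgebra.comul (R := k) (HopfAlgebra.antipode k h)
      = TensorProduct.comm k H H (TensorProduct.map (HopfAlgebra.antipode k)
          (HopfAlgebra.antipode k) (Coalgebra.comul (R := k) h)) := by
  let G : H →ₗ[k] H ⊗[k] H := (TensorProduct.comm k H H).toLinearMap ∘ₗ
    TensorProduct.map (HopfAlgebra.antipode k) (HopfAlgebra.antipode k) ∘ₗ Coalgebra.comul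
  have hl : WithConv.toConv G * WithConv.toConv (Coalgebra.comul (R := k) (A := H)) = 1 := by
    ext x
    rw [LinearMap.convMul_apply, LinearMap.convOne_apply]
    let L : (H ⊗[k] H) ⊗[k] (H ⊗[k] H) →ₗ[k] H ⊗[k] H :=
      LinearMap.mul' k (H ⊗[k] H) ∘ₗ
        ((TensorProduct.comm k H H).toLinearMap ∘ₗ
          TensorProduct.map (HopfAlgebra.antipode k) (HopfAlgebra.antipode k)).rTensor (H ⊗[k] H)
    have e1 : LinearMap.mul' k (H ⊗[k] H) (TensorProduct.map G (Coalgebra.comul (R := k))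
        (Coalgebra.comul (R := k) x)) = L (TensorProduct.map (Coalgebra.comul (R := k))
        (Coalgebra.comul (R := k)) (Coalgebra.comul (R := k) x)) := by
      simp only [L, G, LinearMap.comp_apply]
      congr 1
      rw [← LinearMap.comp_apply (LinearMap.rTensor _ _), LinearMap.rTensor_comp_map]
      rfl
    refine e1.trans ?_
    rw [comul4]
    have e2 : ∀ y : H ⊗[k] (H ⊗[k] H),
        L ((TensorProduct.assoc k H H (H ⊗[k] H)).symm
          ((TensorProduct.assoc k H H H).toLinearMap.lTensor H
            (((Coalgebra.comul (R := k)).rTensor H).lTensor H y)))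
        = (TensorProduct.mk k H H 1) (LinearMap.mul' k H ((HopfAlgebra.antipode k).rTensor H
            ((TensorProduct.lid k H).toLinearMap.lTensor H
              (((Coalgebra.counit (R := k)).rTensor H).lTensor H y)))) := by
      intro y
      induction y with
      | zero => simp
      | add y z hy hz => simp only [map_add, hy, hz]
      | tmul a y =>
        induction y with
        | zero => simp
        | add y z hy hz => simp only [TensorProduct.tmul_add, map_add, hy, hz]
        | tmul b c =>
          have e3 : ∀ z : H ⊗[k] H, L ((TensorProduct.assoc k H H (H ⊗[k] H)).symm
              ((TensorProduct.assoc k H H H).toLinearMap.lTensor H (a ⊗ₜ (z ⊗ₜ c))))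
              = (LinearMap.mul' k H ((HopfAlgebra.antipode k).rTensor H z))
                ⊗ₜ (HopfAlgebra.antipode k a * c) := by
            intro z
            induction z with
            | zero => simp
            | add y z hy hz =>
              simp only [TensorProduct.tmul_add, TensorProduct.add_tmul, map_add, hy, hz]
            | tmul p q => simp [L]
          simp only [LinearMap.lTensor_tmul, LinearMap.rTensor_tmul] at e3 ⊢
          rw [e3, HopfAlgebra.mul_antipode_rTensor_comul_apply]
          simp [Algebra.algebraMap_eq_smul_one, TensorProduct.smul_tmul]
    rw [e2, counit_mid]
    have e4 : (TensorProduct.lid k H).toLinearMap.lTensor H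
        ((TensorProduct.mk k k H 1).lTensor H (Coalgebra.comul (R := k) x))
        = Coalgebra.comul (R := k) x := by
      rw [← LinearMap.lTensor_comp_apply]
      have : (TensorProduct.lid k H).toLinearMap ∘ₗ TensorProduct.mk k k H 1 = LinearMap.id := by
        ext; simp
      rw [this]; simp
    rw [e4, HopfAlgebra.mul_antipode_rTensor_comul_apply]
    simp [Algebra.algebraMap_eq_smul_one, Algebra.TensorProduct.one_def]
  have hr := LinearMap.comul_right_inv (R := k) (C := H)
  have := left_inv_eq_right_inv hl hr
  exact (LinearMap.congr_fun (congrArg WithConv.ofConv this) h).symm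

theorem comul_antipodeInv [hS : InvertibleAntipode k H] (h : H) :
    Coalgebra.comul (R := k) (antipodeInv k h)
      = TensorProduct.comm k H H (TensorProduct.map (antipodeInv k)
          (antipodeInv k) (Coalgebra.comul (R := k) h)) := by
  have h1 := comul_antipode k (antipodeInv k h)
  rw [antipode_antipodeInv] at h1
  rw [h1]
  have key : ∀ z : H ⊗[k] H, z = TensorProduct.comm k H H
      (TensorProduct.map (antipodeInv k) (antipodeInv k) (TensorProduct.comm k H H
        (TensorProduct.map (HopfAlgebra.antipode k) (HopfAlgebra.antipode k) z))) := by
    intro z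
    induction z with
    | zero => simp
    | add y z hy hz => rw [map_add, map_add, map_add, map_add, ← hy, ← hz]
    | tmul b c => simp [antipodeInv_antipode]
  exact key _

end Comul4

/-- A left module over the Hopf algebra `H`, as a representation `H → End_k`. -/
structure HRep (k : Type u) (H : Type v) [Field k] [Ring H] [HopfAlgebra k H] where
  carrier : Type w
  [grp : AddCommGroup carrier]
  [mod : Module k carrier]
  act : H →ₐ[k] Module.End k carrier

attribute [instance] HRep.grp HRep.mod

namespace HRep

variable {k : Type u} {H : Type v} [Field k] [Ring H] [HopfAlgebra k H]

instance : CoeSort (HRep.{u, v, w} k H) (Type w) := ⟨HRep.carrier⟩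

/-- A left `H`-module in Mathlib's sense as an `HRep`. -/
abbrev of (k : Type u) (H : Type v) [Field k] [Ring H] [HopfAlgebra k H] (V : Type w)
    [AddCommGroup V] [Module k V] [Module H V] [IsScalarTower k H V] : HRep.{u, v, w} k H where
  carrier := V
  act := Algebra.lsmul k k V

/-- The tensor product over `k` with the diagonal action `h(x ⊗ y) = h⁽¹⁾x ⊗ h⁽²⁾y`. -/
abbrev tens (X : HRep.{u, v, w} k H) (Y : HRep.{u, v, w} k H) : HRep.{u, v, w} k H where
  carrier := X ⊗[k] Y
  act := Module.endTensorEndAlgHom.comp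
    ((Algebra.TensorProduct.map X.act Y.act).comp (Bialgebra.comulAlgHom k H))

theorem tens_act (X Y : HRep.{u, v, w} k H) (h : H) (x : X) (y : Y) :
    (tens X Y).act h (x ⊗ₜ[k] y)
      = TensorProduct.map (X.act.toLinearMap.flip x) (Y.act.toLinearMap.flip y)
          (Coalgebra.comul (R := k) h) := by
  change Module.endTensorEndAlgHom
    (Algebra.TensorProduct.map X.act Y.act (Coalgebra.comul (R := k) h)) (x ⊗ₜ[k] y) = _
  induction Coalgebra.comul (R := k) h with
  | zero => simp
  | add a b ha hb => simp only [map_add, LinearMap.add_apply, ha, hb]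
  | tmul a b => simp [Module.endTensorEndAlgHom_apply]

/-- An `H`-linear map. -/
structure Hom (X Y : HRep.{u, v, w} k H) where
  lin : X →ₗ[k] Y
  comm : ∀ h x, lin (X.act h x) = Y.act h (lin x)

namespace Hom

variable {X Y Z W : HRep.{u, v, w} k H}

/-- The identity. -/
def id (X : HRep.{u, v, w} k H) : Hom X X := ⟨LinearMap.id, fun _ _ => rfl⟩

/-- Composition `g ∘ f`. -/
def comp (g : Hom Y Z) (f : Hom X Y) : Hom X Z :=
  ⟨g.lin ∘ₗ f.lin, fun h x => by simp [f.comm, g.comm]⟩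

/-- Difference `f - g`. -/
def sub (f g : Hom X Y) : Hom X Y :=
  ⟨f.lin - g.lin, fun h x => by simp [f.comm, g.comm]⟩

/-- Tensor product `f ⊗ g`. -/
def tmap (f : Hom X Y) (g : Hom Z W) : Hom (tens X Z) (tens Y W) where
  lin := TensorProduct.map f.lin g.lin
  comm h t := by
    induction t using TensorProduct.induction_on with
    | zero => simp
    | add a b ha hb => simp only [map_add, ha, hb]
    | tmul a b =>
      rw [tens_act, TensorProduct.map_tmul, tens_act, ← LinearMap.comp_apply,
        ← TensorProduct.map_comp]
      congr 2
      · ext h; exact f.comm h a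
      · ext h; exact g.comm h b

end Hom

theorem assoc_comm (X Y Z : HRep.{u, v, w} k H) (h : H) (t : (X ⊗[k] Y) ⊗[k] Z) :
    TensorProduct.assoc k X Y Z ((tens (tens X Y) Z).act h t)
      = (tens X (tens Y Z)).act h (TensorProduct.assoc k X Y Z t) := by
  induction t using TensorProduct.induction_on with
  | zero => simp
  | add a b ha hb => simp only [map_add, ha, hb]
  | tmul t z =>
    induction t using TensorProduct.induction_on with
    | zero => simp
    | add a b ha hb => simp only [TensorProduct.add_tmul, map_add, ha, hb]
    | tmul x y =>
      rw [TensorProduct.assoc_tmul, tens_act, tens_act]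
      have e1 : ∀ w : H ⊗[k] H, TensorProduct.assoc k X Y Z
          (TensorProduct.map ((tens X Y).act.toLinearMap.flip (x ⊗ₜ y))
            (Z.act.toLinearMap.flip z) w)
          = TensorProduct.map (X.act.toLinearMap.flip x)
              (TensorProduct.map (Y.act.toLinearMap.flip y) (Z.act.toLinearMap.flip z))
              (TensorProduct.assoc k H H H ((Coalgebra.comul (R := k)).rTensor H w)) := by
        intro w
        induction w with
        | zero => simp
        | add a b ha hb => simp only [map_add, ha, hb]
        | tmul a b =>
          simp only [TensorProduct.map_tmul, LinearMap.rTensor_tmul, LinearMap.flip_apply]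
          have : ∀ a : H, ((tens X Y).act.toLinearMap a) (x ⊗ₜ[k] y)
              = TensorProduct.map (X.act.toLinearMap.flip x) (Y.act.toLinearMap.flip y)
                (Coalgebra.comul (R := k) a) := fun a => tens_act X Y a x y
          rw [this]
          induction Coalgebra.comul (R := k) a with
          | zero => simp
          | add p q hp hq => simp only [TensorProduct.add_tmul, map_add, hp, hq]
          | tmul p q => simp
      have e2 : ∀ w : H ⊗[k] H, TensorProduct.map (X.act.toLinearMap.flip x)
            ((tens Y Z).act.toLinearMap.flip (y ⊗ₜ z)) w
          = TensorProduct.map (X.act.toLinearMap.flip x)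
              (TensorProduct.map (Y.act.toLinearMap.flip y) (Z.act.toLinearMap.flip z))
              ((Coalgebra.comul (R := k)).lTensor H w) := by
        intro w
        induction w with
        | zero => simp
        | add a b ha hb => simp only [map_add, ha, hb]
        | tmul a b =>
          simp only [TensorProduct.map_tmul, LinearMap.lTensor_tmul, LinearMap.flip_apply]
          congr 1
          exact tens_act Y Z b y z
      rw [e1, e2, Coalgebra.coassoc_apply]

/-- The associativity isomorphism. -/
def assoc (X Y Z : HRep.{u, v, w} k H) : Hom (tens (tens X Y) Z) (tens X (tens Y Z)) :=
  ⟨(TensorProduct.assoc k X Y Z).toLinearMap, assoc_comm X Y Z⟩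

/-- The inverse of the associativity isomorphism. -/
def assocInv (X Y Z : HRep.{u, v, w} k H) : Hom (tens X (tens Y Z)) (tens (tens X Y) Z) :=
  ⟨(TensorProduct.assoc k X Y Z).symm.toLinearMap, fun h t => by
    apply (TensorProduct.assoc k X Y Z).injective
    have := assoc_comm X Y Z h ((TensorProduct.assoc k X Y Z).symm t)
    simp only [LinearEquiv.coe_coe, LinearEquiv.apply_symm_apply] at this ⊢
    exact this.symm⟩

/-- An `H`-stable subspace. -/
abbrev subMod (X : HRep.{u, v, w} k H) (S : Submodule k X) (hS : ∀ h, ∀ x ∈ S, X.act h x ∈ S) :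
    HRep.{u, v, w} k H where
  carrier := S
  act := AlgHom.ofLinearMap
    { toFun := fun h => (X.act h).restrict (hS h)
      map_add' := fun a b => by ext; simp
      map_smul' := fun c a => by ext; simp }
    (by ext; simp) (fun a b => by ext; simp)

/-- The quotient by an `H`-stable subspace. -/
abbrev quot (X : HRep.{u, v, w} k H) (S : Submodule k X) (hS : ∀ h, ∀ x ∈ S, X.act h x ∈ S) :
    HRep.{u, v, w} k H where
  carrier := X ⧸ S
  act := AlgHom.ofLinearMap
    { toFun := fun h => S.mapQ S (X.act h) (hS h)
      map_add' := fun a b => by ext; simp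
      map_smul' := fun c a => by ext; simp }
    (by ext; simp) (fun a b => by ext; simp)

end HRep

/-- A (unital) left `H`-module algebra: `h(ab) = h⁽¹⁾(a) h⁽²⁾(b)` and `h(1) = ε(h)1`. -/
structure HAlg (k : Type u) (H : Type v) [Field k] [Ring H] [HopfAlgebra k H] where
  carrier : Type w
  [ring : Ring carrier]
  [alg : Algebra k carrier]
  act : H →ₐ[k] Module.End k carrier
  act_one : ∀ h, act h 1 = Coalgebra.counit (R := k) h • (1 : carrier)
  act_mul : ∀ h a b, act h (a * b) = LinearMap.mul' k carrier
    (TensorProduct.map (act.toLinearMap.flip a) (act.toLinearMap.flip b)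
      (Coalgebra.comul (R := k) h))

attribute [instance] HAlg.ring HAlg.alg

namespace HAlg

variable {k : Type u} {H : Type v} [Field k] [Ring H] [HopfAlgebra k H]

instance : CoeSort (HAlg.{u, v, w} k H) (Type w) := ⟨HAlg.carrier⟩

/-- The underlying `H`-module. -/
abbrev toHRep (A : HAlg.{u, v, w} k H) : HRep.{u, v, w} k H where
  carrier := A
  act := A.act

open HRep

/-- The multiplication `A ⊗ A → A`. -/
def mul (A : HAlg.{u, v, w} k H) : Hom (tens A.toHRep A.toHRep) A.toHRep where
  lin := LinearMap.mul' k A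
  comm h t := by
    induction t using TensorProduct.induction_on with
    | zero => simp
    | add a b ha hb => simp only [map_add, ha, hb]
    | tmul a b =>
      rw [tens_act, LinearMap.mul'_apply]
      exact (A.act_mul h a b).symm

theorem tens_act_one_right (A : HAlg.{u, v, w} k H) (X : HRep.{u, v, w} k H) (h : H) (x : X) :
    (tens X A.toHRep).act h (x ⊗ₜ 1) = X.act h x ⊗ₜ 1 := by
  rw [tens_act]
  have : (A.toHRep.act.toLinearMap.flip (1 : A)) =
      (LinearMap.toSpanSingleton k A 1) ∘ₗ Coalgebra.counit (R := k) (A := H) := by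
    ext h; exact A.act_one h
  rw [this, ← LinearMap.comp_id (X.act.toLinearMap.flip x), TensorProduct.map_comp,
    LinearMap.comp_apply]
  have h2 : TensorProduct.map (LinearMap.id) (Coalgebra.counit (R := k))
      (Coalgebra.comul (R := k) h) = h ⊗ₜ 1 := Coalgebra.lTensor_counit_comul h
  rw [h2]
  simp

theorem tens_act_one_left (A : HAlg.{u, v, w} k H) (X : HRep.{u, v, w} k H) (h : H) (x : X) :
    (tens A.toHRep X).act h (1 ⊗ₜ x) = 1 ⊗ₜ X.act h x := by
  rw [tens_act]
  have : (A.toHRep.act.toLinearMap.flip (1 : A)) =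
      (LinearMap.toSpanSingleton k A 1) ∘ₗ Coalgebra.counit (R := k) (A := H) := by
    ext h; exact A.act_one h
  rw [this, ← LinearMap.comp_id (X.act.toLinearMap.flip x), TensorProduct.map_comp,
    LinearMap.comp_apply]
  have h2 : TensorProduct.map (Coalgebra.counit (R := k)) (LinearMap.id)
      (Coalgebra.comul (R := k) h) = 1 ⊗ₜ h := Coalgebra.rTensor_counit_comul h
  rw [h2]
  simp

/-- `x ↦ x ⊗ 1`. -/
def insOne (A : HAlg.{u, v, w} k H) (X : HRep.{u, v, w} k H) : Hom X (tens X A.toHRep) where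
  lin := (TensorProduct.mk k X A).flip 1
  comm h x := (tens_act_one_right A X h x).symm

/-- `x ↦ 1 ⊗ x`. -/
def oneIns (A : HAlg.{u, v, w} k H) (X : HRep.{u, v, w} k H) : Hom X (tens A.toHRep X) where
  lin := TensorProduct.mk k A X 1
  comm h x := (tens_act_one_left A X h x).symm

theorem act_mem_span_one (A : HAlg.{u, v, w} k H) (h : H) (a : A)
    (ha : a ∈ Submodule.span k {(1 : A)}) : A.act h a ∈ Submodule.span k {(1 : A)} := by
  obtain ⟨c, rfl⟩ := Submodule.mem_span_singleton.1 ha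
  rw [map_smul, A.act_one]
  exact Submodule.smul_mem _ _ (Submodule.smul_mem _ _ (Submodule.mem_span_singleton_self _))

/-- `A / k1`. -/
abbrev bar (A : HAlg.{u, v, w} k H) : HRep.{u, v, w} k H :=
  A.toHRep.quot (Submodule.span k {(1 : A)}) A.act_mem_span_one

/-- The projection `A → A / k1`. -/
def mkBar (A : HAlg.{u, v, w} k H) : Hom A.toHRep A.bar where
  lin := (Submodule.span k {(1 : A)}).mkQ
  comm _ _ := rfl

theorem mkBar_surjective (A : HAlg.{u, v, w} k H) : Function.Surjective A.mkBar.lin :=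
  Submodule.mkQ_surjective _

theorem mkBar_one (A : HAlg.{u, v, w} k H) : A.mkBar.lin (1 : A) = 0 :=
  (Submodule.Quotient.mk_eq_zero _).2 (Submodule.mem_span_singleton_self _)

end HAlg

/-- A left `H`-comodule structure `m ↦ m⁽⁻¹⁾ ⊗ m⁽⁰⁾` on `M`. -/
class LeftComodule (k : Type u) (H : Type v) (M : Type x) [Field k] [Ring H] [HopfAlgebra k H]
    [AddCommGroup M] [Module k M] where
  coact : M →ₗ[k] H ⊗[k] M
  coassoc : ∀ m, TensorProduct.assoc k H H M ((Coalgebra.comul (R := k)).rTensor M (coact m))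
    = coact.lTensor H (coact m)
  counit_coact : ∀ m, TensorProduct.lid k M ((Coalgebra.counit (R := k)).rTensor M (coact m)) = m

section Coefficients

set_option linter.unusedSectionVars false

variable (k : Type u) (H : Type v) (M : Type x) [Field k] [Ring H] [HopfAlgebra k H]
  [AddCommGroup M] [Module k M] [Module Hᵐᵒᵖ M] [IsScalarTower k Hᵐᵒᵖ M]

/-- The right action `h ↦ (m ↦ mh)`. -/
def ract : H →ₗ[k] Module.End k M :=
  (Algebra.lsmul k k M : Hᵐᵒᵖ →ₐ[k] Module.End k M).toLinearMap ∘ₗ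
    (MulOpposite.opLinearEquiv k).toLinearMap

@[simp] theorem ract_apply (h : H) (m : M) : ract k H M h m = MulOpposite.op h • m := rfl

/-- `a ⊗ c ↦ (g ↦ S(c) g a)`. -/
def sandwich : H →ₗ[k] H →ₗ[k] Module.End k H :=
  LinearMap.mk₂ k (fun a c => LinearMap.mulRight k a ∘ₗ
      LinearMap.mulLeft k (HopfAlgebra.antipode k c))
    (fun _ _ _ => by ext; simp [mul_add]) (fun _ _ _ => by ext; simp)
    (fun _ _ _ => by ext; simp [add_mul]) (fun _ _ _ => by ext; simp)

/-- `a ⊗ (b ⊗ c) ↦ (g ⊗ m ↦ S(c) g a ⊗ mb)`. -/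
def aydTwist : H ⊗[k] (H ⊗[k] H) →ₗ[k] Module.End k (H ⊗[k] M) :=
  TensorProduct.homTensorHomMap (.id k) H M H M ∘ₗ
    TensorProduct.map (TensorProduct.lift (sandwich k H)) (ract k H M) ∘ₗ
    (TensorProduct.assoc k H H H).symm.toLinearMap ∘ₗ
    (TensorProduct.comm k H H).toLinearMap.lTensor H

theorem aydTwist_tmul (a b c g : H) (m : M) :
    aydTwist k H M (a ⊗ₜ (b ⊗ₜ c)) (g ⊗ₜ m)
      = (HopfAlgebra.antipode k c * g * a) ⊗ₜ[k] (MulOpposite.op b • m) := rfl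

/-- Stable anti-Yetter–Drinfeld modules (right modules, left comodules):
`(mh)⁽⁻¹⁾ ⊗ (mh)⁽⁰⁾ = S(h⁽³⁾) m⁽⁻¹⁾ h⁽¹⁾ ⊗ m⁽⁰⁾ h⁽²⁾` and `m⁽⁰⁾ m⁽⁻¹⁾ = m`. -/
class IsSAYD [LeftComodule k H M] : Prop where
  antiYetterDrinfeld : ∀ (m : M) (h : H),
    LeftComodule.coact (k := k) (H := H) (MulOpposite.op h • m)
      = aydTwist k H M (comul3 k h) (LeftComodule.coact m)
  stable : ∀ m : M, TensorProduct.lift (ract k H M) (LeftComodule.coact m) = m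

variable {k H}

/-- The relations `mh ⊗ x = m ⊗ hx`. -/
def balRel (X : HRep.{u, v, w} k H) : Submodule k (M ⊗[k] X) :=
  Submodule.span k {t | ∃ (m : M) (h : H) (x : X),
    t = (MulOpposite.op h • m) ⊗ₜ[k] x - m ⊗ₜ[k] X.act h x}

/-- `M ⊗_H X`. -/
abbrev HTens (X : HRep.{u, v, w} k H) : Type (max x w) := (M ⊗[k] X) ⧸ balRel M X

namespace HTens

variable {M}

/-- The class `m ⊗_H x`. -/
def mk (X : HRep.{u, v, w} k H) : M →ₗ[k] X →ₗ[k] HTens M X :=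
  (TensorProduct.mk k M X).compr₂ (balRel M X).mkQ

theorem mk_smul (X : HRep.{u, v, w} k H) (m : M) (h : H) (x : X) :
    mk X (MulOpposite.op h • m) x = mk X m (X.act h x) :=
  (Submodule.Quotient.eq _).2 (Submodule.subset_span ⟨m, h, x, rfl⟩)

/-- A balanced bilinear map `M × X → T` factors through `M ⊗_H X`. -/
def lift {X : HRep.{u, v, w} k H} {T : Type*} [AddCommGroup T] [Module k T]
    (f : M →ₗ[k] X →ₗ[k] T)
    (hf : ∀ m (h : H) x, f (MulOpposite.op h • m) x = f m (X.act h x)) : HTens M X →ₗ[k] T :=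
  (balRel M X).liftQ (TensorProduct.lift f) (by
    refine Submodule.span_le.2 ?_
    rintro _ ⟨m, h, x, rfl⟩
    simp [hf])

@[simp] theorem lift_mk {X : HRep.{u, v, w} k H} {T : Type*} [AddCommGroup T] [Module k T]
    (f : M →ₗ[k] X →ₗ[k] T)
    (hf : ∀ m (h : H) x, f (MulOpposite.op h • m) x = f m (X.act h x)) (m : M) (x : X) :
    lift f hf (mk X m x) = f m x := by
  exact (Submodule.liftQ_apply _ _ _).trans (TensorProduct.lift.tmul _ _)

theorem hom_ext {X : HRep.{u, v, w} k H} {T : Type*} [AddCommGroup T] [Module k T]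
    {f g : HTens M X →ₗ[k] T} (hfg : ∀ m x, f (mk X m x) = g (mk X m x)) : f = g := by
  apply Submodule.linearMap_qext
  ext m x
  exact hfg m x

/-- `id_M ⊗_H f`. -/
def map {X Y : HRep.{u, v, w} k H} (f : HRep.Hom X Y) : HTens M X →ₗ[k] HTens M Y :=
  lift ((mk Y).compl₂ f.lin) (fun m h x => by simp [f.comm, mk_smul])

@[simp] theorem map_mk {X Y : HRep.{u, v, w} k H} (f : HRep.Hom X Y) (m : M) (x : X) :
    map f (mk X m x) = mk Y m (f.lin x) := by simp [map]

/-- The map `g ⊗ m ↦ (x ⊗ y ↦ m ⊗_H (S⁻¹(g)y ⊗ x))`. -/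
def swapAux [InvertibleAntipode k H] (X Y : HRep.{u, v, w} k H) :
    H ⊗[k] M →ₗ[k] HRep.tens X Y →ₗ[k] HTens M (HRep.tens Y X) :=
  TensorProduct.lift <| LinearMap.mk₂ k
    (fun g m => mk (HRep.tens Y X) m ∘ₗ
      ((TensorProduct.comm k X Y).toLinearMap ∘ₗ (Y.act (antipodeInv k g)).lTensor X))
    (fun g g' m => by
      rw [map_add, map_add, LinearMap.lTensor_add, LinearMap.comp_add, LinearMap.comp_add])
    (fun c g m => by
      rw [map_smul, map_smul, LinearMap.lTensor_smul, LinearMap.comp_smul, LinearMap.comp_smul])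
    (fun g m m' => by rw [map_add, LinearMap.add_comp])
    (fun c g m => by rw [map_smul, LinearMap.smul_comp])

@[simp] theorem swapAux_tmul [InvertibleAntipode k H] (X Y : HRep.{u, v, w} k H) (x : X) (y : Y)
    (g : H) (m : M) : swapAux X Y (g ⊗ₜ m) (x ⊗ₜ y)
      = mk (HRep.tens Y X) m (Y.act (antipodeInv k g) y ⊗ₜ x) := rfl

/-- The compatibility of the twisted flip with the action, on pure tensors. -/
theorem swapAux_twist [InvertibleAntipode k H] (X Y : HRep.{u, v, w} k H) (x : X) (y : Y)
    (g h : H) (m : M) : swapAux X Y (aydTwist k H M (comul3 k h) (g ⊗ₜ m)) (x ⊗ₜ y)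
      = swapAux X Y (g ⊗ₜ m) ((HRep.tens X Y).act h (x ⊗ₜ y)) := by
  let A : H ⊗[k] H →ₗ[k] H :=
    LinearMap.mul' k H ∘ₗ (TensorProduct.comm k H H).toLinearMap ∘ₗ (antipodeInv k).rTensor H
  let B : H →ₗ[k] H ⊗[k] H →ₗ[k] HTens M (HRep.tens Y X) :=
    LinearMap.mk₂ k (fun p z => mk (HRep.tens Y X) m (TensorProduct.map
        (Y.act.toLinearMap.flip y ∘ₗ LinearMap.mulLeft k (p * antipodeInv k g))
        (X.act.toLinearMap.flip x) (TensorProduct.comm k H H z)))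
      (fun p q z => by
        rw [← map_add, ← LinearMap.add_apply, ← TensorProduct.map_add_left]
        congr 3
        ext d; simp [add_mul])
      (fun c p z => by
        rw [← map_smul, ← LinearMap.smul_apply, ← TensorProduct.map_smul_left]
        congr 3
        ext d; simp)
      (fun p z z' => by simp only [map_add])
      (fun c p z => by simp only [map_smul])
  have hB : ∀ p c d : H, B p (c ⊗ₜ d)
      = mk (HRep.tens Y X) m (Y.act (p * antipodeInv k g * d) y ⊗ₜ X.act c x) := by
    intros; rfl
  let Ψ : (H ⊗[k] H) ⊗[k] (H ⊗[k] H) →ₗ[k] HTens M (HRep.tens Y X) :=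
    TensorProduct.lift (B ∘ₗ A)
  have hΨ : ∀ a b c d : H, Ψ ((a ⊗ₜ b) ⊗ₜ (c ⊗ₜ d)) = mk (HRep.tens Y X) m
      (Y.act (b * antipodeInv k a * antipodeInv k g * d) y ⊗ₜ X.act c x) := by
    intros; rfl
  have s1 : ∀ w : H ⊗[k] (H ⊗[k] H),
      swapAux X Y (aydTwist k H M w (g ⊗ₜ m)) (x ⊗ₜ y)
      = Ψ ((TensorProduct.assoc k H H (H ⊗[k] H)).symm
        ((TensorProduct.assoc k H H H).toLinearMap.lTensor H
          (((Coalgebra.comul (R := k)).rTensor H).lTensor H w))) := by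
    intro w
    induction w with
    | zero => simp only [map_zero, LinearMap.zero_apply]
    | add a b ha hb => simp only [map_add, LinearMap.add_apply, ha, hb]
    | tmul a w =>
      induction w with
      | zero => simp only [TensorProduct.tmul_zero, map_zero, LinearMap.zero_apply]
      | add p q hp hq =>
        simp only [TensorProduct.tmul_add, map_add, LinearMap.add_apply, hp, hq]
      | tmul b c =>
        rw [aydTwist_tmul, swapAux_tmul, mk_smul, HRep.tens_act]
        rw [LinearMap.lTensor_tmul, LinearMap.rTensor_tmul]
        induction Coalgebra.comul (R := k) b with
        | zero => simp only [TensorProduct.tmul_zero, TensorProduct.zero_tmul, map_zero]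
        | add p q hp hq =>
          simp only [TensorProduct.tmul_add, TensorProduct.add_tmul, map_add, hp, hq]
        | tmul p q =>
          have e : (TensorProduct.assoc k H H (H ⊗[k] H)).symm
            ((TensorProduct.assoc k H H H).toLinearMap.lTensor H
              (a ⊗ₜ[k] ((p ⊗ₜ[k] q) ⊗ₜ[k] c))) = (a ⊗ₜ p) ⊗ₜ (q ⊗ₜ c) := rfl
          rw [e, hΨ, antipodeInv_mul, antipodeInv_mul, antipodeInv_antipode,
            TensorProduct.map_tmul]
          congr 2
          simp [mul_assoc]
  rw [s1, ← comul4]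
  have s2 : ∀ w : H ⊗[k] H,
      Ψ (TensorProduct.map (Coalgebra.comul (R := k)) (Coalgebra.comul (R := k)) w)
      = B 1 (Coalgebra.comul (R := k)
          (TensorProduct.lid k H ((Coalgebra.counit (R := k)).rTensor H w))) := by
    intro w
    induction w with
    | zero => simp only [map_zero]
    | add a b ha hb => simp only [map_add, ha, hb]
    | tmul a b =>
      have hA : A (Coalgebra.comul (R := k) a) = Coalgebra.counit (R := k) a • (1 : H) := by
        rw [← Algebra.algebraMap_eq_smul_one]; exact mul_antipodeInv_comul k a
      rw [TensorProduct.map_tmul, TensorProduct.lift.tmul, LinearMap.comp_apply, hA,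
        LinearMap.rTensor_tmul, TensorProduct.lid_tmul, map_smul, map_smul, map_smul,
        LinearMap.smul_apply]
  rw [s2, Coalgebra.rTensor_counit_comul, TensorProduct.lid_tmul, one_smul, HRep.tens_act]
  induction Coalgebra.comul (R := k) h with
  | zero => simp only [map_zero]
  | add p q hp hq => simp only [map_add, hp, hq]
  | tmul p q =>
    rw [hB, TensorProduct.map_tmul, swapAux_tmul, one_mul, map_mul]
    rfl

variable [LeftComodule k H M]

/-- The twisted flip `m ⊗_H (x ⊗ y) ↦ m⁽⁰⁾ ⊗_H (S⁻¹(m⁽⁻¹⁾)y ⊗ x)`. -/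
def swap [InvertibleAntipode k H] [IsSAYD k H M] (X Y : HRep.{u, v, w} k H) :
    HTens M (HRep.tens X Y) →ₗ[k] HTens M (HRep.tens Y X) :=
  lift (swapAux X Y ∘ₗ LeftComodule.coact) (fun m h t => by
    rw [LinearMap.comp_apply, LinearMap.comp_apply, IsSAYD.antiYetterDrinfeld (k := k) m h]
    induction LeftComodule.coact (k := k) (H := H) m with
    | zero => simp only [map_zero, LinearMap.zero_apply]
    | add a b ha hb => simp only [map_add, LinearMap.add_apply, ha, hb]
    | tmul g m =>
      induction t using TensorProduct.induction_on with
      | zero => simp only [map_zero]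
      | add a b ha hb => simp only [map_add, ha, hb]
      | tmul x y => exact swapAux_twist X Y x y g h m)

theorem swap_mk [InvertibleAntipode k H] [IsSAYD k H M] (X Y : HRep.{u, v, w} k H) (m : M)
    (t : HRep.tens X Y) : swap X Y (mk _ m t) = swapAux X Y (LeftComodule.coact m) t := lift_mk ..

/-- Naturality of the twisted flip. -/
theorem swap_map [InvertibleAntipode k H] [IsSAYD k H M] {X X' Y Y' : HRep.{u, v, w} k H}
    (f : HRep.Hom X X') (g : HRep.Hom Y Y') (t : HTens M (HRep.tens X Y)) :
    swap X' Y' (map (f.tmap g) t) = map (g.tmap f) (swap X Y t) := by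
  refine LinearMap.congr_fun (f := swap X' Y' ∘ₗ map (f.tmap g))
    (g := map (g.tmap f) ∘ₗ swap X Y) (hom_ext fun m t => ?_) t
  change swap X' Y' (map (f.tmap g) (mk _ m t)) = map (g.tmap f) (swap X Y (mk _ m t))
  rw [map_mk, swap_mk, swap_mk]
  induction t using TensorProduct.induction_on with
  | zero => simp only [map_zero]
  | add a b ha hb => simp only [map_add, ha, hb]
  | tmul x y =>
    induction LeftComodule.coact (k := k) (H := H) m with
    | zero => simp only [map_zero, LinearMap.zero_apply]
    | add a b ha hb => simp only [map_add, LinearMap.add_apply, ha, hb]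
    | tmul a m =>
      have e : (f.tmap g).lin (x ⊗ₜ y) = f.lin x ⊗ₜ g.lin y := rfl
      rw [e, swapAux_tmul, swapAux_tmul, map_mk, ← g.comm]
      rfl

/-- The twisted flip of a unit is the untwisted flip. -/
theorem swap_insOne [InvertibleAntipode k H] [IsSAYD k H M] (A : HAlg.{u, v, w} k H)
    (X : HRep.{u, v, w} k H) (t : HTens M X) :
    swap X A.toHRep (map (A.insOne X) t) = map (A.oneIns X) t := by
  refine LinearMap.congr_fun (f := swap X A.toHRep ∘ₗ map (A.insOne X))
    (g := map (A.oneIns X)) (hom_ext fun m x => ?_) t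
  change swap X A.toHRep (map (A.insOne X) (mk _ m x)) = map (A.oneIns X) (mk _ m x)
  rw [map_mk, swap_mk, map_mk]
  have key : ∀ z : H ⊗[k] M, swapAux X A.toHRep z ((A.insOne X).lin x)
      = mk _ (TensorProduct.lid k M ((Coalgebra.counit (R := k)).rTensor M z))
          ((A.oneIns X).lin x) := by
    intro z
    induction z with
    | zero => simp only [map_zero, LinearMap.zero_apply]
    | add a b ha hb => simp only [map_add, LinearMap.add_apply, ha, hb]
    | tmul a m =>
      have e1 : (A.insOne X).lin x = x ⊗ₜ 1 := rfl
      have e2 : (A.oneIns X).lin x = 1 ⊗ₜ x := rfl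
      rw [e1, e2, swapAux_tmul, A.act_one, counit_antipodeInv, LinearMap.rTensor_tmul,
        TensorProduct.lid_tmul, ← TensorProduct.smul_tmul', map_smul, map_smul,
        LinearMap.smul_apply]
  rw [key, LeftComodule.counit_coact]

/-- The twisted flip past `Y ⊗ Z` is the composition of the flips past `Z` and past `Y`. -/
theorem swap_swap [InvertibleAntipode k H] [IsSAYD k H M] (X Y Z : HRep.{u, v, w} k H)
    (t : HTens M (HRep.tens (HRep.tens X Y) Z)) :
    map (HRep.assoc Y Z X) (swap X (HRep.tens Y Z) (map (HRep.assoc X Y Z) t))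
      = swap (HRep.tens Z X) Y (map (HRep.assocInv Z X Y) (swap (HRep.tens X Y) Z t)) := by
  refine LinearMap.congr_fun (f := map (HRep.assoc Y Z X) ∘ₗ swap X (HRep.tens Y Z) ∘ₗ
      map (HRep.assoc X Y Z))
    (g := swap (HRep.tens Z X) Y ∘ₗ map (HRep.assocInv Z X Y) ∘ₗ swap (HRep.tens X Y) Z)
    (hom_ext fun m t => ?_) t
  change map (HRep.assoc Y Z X) (swap X (HRep.tens Y Z) (map (HRep.assoc X Y Z) (mk _ m t)))
      = swap (HRep.tens Z X) Y (map (HRep.assocInv Z X Y) (swap (HRep.tens X Y) Z (mk _ m t)))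
  rw [map_mk, swap_mk, swap_mk]
  induction t using TensorProduct.induction_on with
  | zero => simp only [map_zero]
  | add a b ha hb => simp only [map_add, ha, hb]
  | tmul t z =>
  induction t using TensorProduct.induction_on with
  | zero => simp only [TensorProduct.zero_tmul, map_zero]
  | add a b ha hb => simp only [TensorProduct.add_tmul, map_add, ha, hb]
  | tmul x y =>
  have e0 : (HRep.assoc X Y Z).lin ((x ⊗ₜ y) ⊗ₜ z) = x ⊗ₜ (y ⊗ₜ z) := rfl
  rw [e0]
  let Θ : H ⊗[k] (H ⊗[k] M) →ₗ[k] HTens M (HRep.tens Y (HRep.tens Z X)) :=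
    TensorProduct.lift ((swapAux (HRep.tens Z X) Y).flip ∘ₗ
      (TensorProduct.mk k (HRep.tens Z X) Y).flip y ∘ₗ (TensorProduct.mk k Z X).flip x ∘ₗ
        Z.act.toLinearMap.flip z ∘ₗ antipodeInv k)
  have hr : ∀ w : H ⊗[k] M, swap (HRep.tens Z X) Y (map (HRep.assocInv Z X Y)
      (swapAux (HRep.tens X Y) Z w ((x ⊗ₜ y) ⊗ₜ z)))
      = Θ ((LeftComodule.coact (k := k) (H := H)).lTensor H w) := by
    intro w
    induction w with
    | zero => simp only [map_zero, LinearMap.zero_apply]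
    | add a b ha hb => simp only [map_add, LinearMap.add_apply, ha, hb]
    | tmul g m =>
      rw [swapAux_tmul, map_mk, swap_mk]
      rfl
  have hl : ∀ w : H ⊗[k] M, map (HRep.assoc Y Z X)
      (swapAux X (HRep.tens Y Z) w (x ⊗ₜ (y ⊗ₜ z)))
      = Θ (TensorProduct.assoc k H H M ((Coalgebra.comul (R := k)).rTensor M w)) := by
    intro w
    induction w with
    | zero => simp only [map_zero, LinearMap.zero_apply]
    | add a b ha hb => simp only [map_add, LinearMap.add_apply, ha, hb]
    | tmul g m =>
      rw [swapAux_tmul, map_mk, HRep.tens_act, comul_antipodeInv, LinearMap.rTensor_tmul]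
      induction Coalgebra.comul (R := k) g with
      | zero => simp only [map_zero, TensorProduct.zero_tmul]
      | add a b ha hb => simp only [map_add, TensorProduct.add_tmul, ha, hb]
      | tmul a b => rfl
  rw [hr, hl, LeftComodule.coassoc]

end HTens

end Coefficients

section Free

variable {k : Type u} {H : Type v} [Field k] [Ring H] [HopfAlgebra k H]

/-- The map `f ↦ (h ↦ hf)` from `T(V)` to the convolution algebra `Hom(H, T(V))`, determined by
`v ↦ (h ↦ hv)`; its multiplicativity is the rule `h(ab) = h⁽¹⁾(a) h⁽²⁾(b)`. -/
def freeCoact (V : HRep.{u, v, w} k H) :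
    TensorAlgebra k V →ₐ[k] WithConv (H →ₗ[k] TensorAlgebra k V) :=
  TensorAlgebra.lift k ((WithConv.linearEquiv k (H →ₗ[k] TensorAlgebra k V)).symm.toLinearMap ∘ₗ
    (LinearMap.llcomp k H V (TensorAlgebra k V) (TensorAlgebra.ι k)) ∘ₗ V.act.toLinearMap.flip)

theorem freeCoact_ι (V : HRep.{u, v, w} k H) (h : H) (v : V) :
    freeCoact V (TensorAlgebra.ι k v) h = TensorAlgebra.ι k (V.act h v) := by
  simp only [freeCoact, TensorAlgebra.lift_ι_apply]
  rfl

theorem freeCoact_algebraMap (V : HRep.{u, v, w} k H) (h : H) (c : k) :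
    freeCoact V (algebraMap k _ c) h
      = Coalgebra.counit (R := k) h • algebraMap k (TensorAlgebra k V) c := by
  rw [AlgHom.commutes, LinearMap.convAlgebraMap_apply, Algebra.algebraMap_eq_smul_one,
    Algebra.algebraMap_eq_smul_one, smul_comm]

theorem freeCoact_mul (V : HRep.{u, v, w} k H) (h : H) (a b : TensorAlgebra k V) :
    freeCoact V (a * b) h = LinearMap.mul' k _ (TensorProduct.map (freeCoact V a).ofConv
      (freeCoact V b).ofConv (Coalgebra.comul (R := k) h)) := by
  rw [map_mul, LinearMap.convMul_apply]

/-- The linear map `h ↦ (f ↦ hf)` on `T(V)`. -/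
def freeActLin (V : HRep.{u, v, w} k H) : H →ₗ[k] Module.End k (TensorAlgebra k V) :=
  ((WithConv.linearEquiv k (H →ₗ[k] TensorAlgebra k V)).toLinearMap ∘ₗ
    (freeCoact V).toLinearMap).flip

theorem freeActLin_apply (V : HRep.{u, v, w} k H) (h : H) (f : TensorAlgebra k V) :
    freeActLin V h f = freeCoact V f h := rfl

theorem freeActLin_mul_apply (V : HRep.{u, v, w} k H) (h : H) (a b : TensorAlgebra k V) :
    freeActLin V h (a * b) = LinearMap.mul' k _ (TensorProduct.map ((freeActLin V).flip a)
      ((freeActLin V).flip b) (Coalgebra.comul (R := k) h)) := freeCoact_mul V h a b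

/-- The diagonal action of `H` on `T(V)`. -/
def freeAct (V : HRep.{u, v, w} k H) : H →ₐ[k] Module.End k (TensorAlgebra k V) :=
  AlgHom.ofLinearMap (freeActLin V)
    (by
      ext f
      induction f using TensorAlgebra.induction with
      | algebraMap r =>
        rw [freeActLin_apply, freeCoact_algebraMap, Bialgebra.counit_one, one_smul]
        rfl
      | ι x => simp [freeActLin_apply, freeCoact_ι]
      | mul a b ha hb =>
        rw [freeActLin_mul_apply, Bialgebra.comul_one, Algebra.TensorProduct.one_def,
          TensorProduct.map_tmul, LinearMap.mul'_apply, LinearMap.flip_apply,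
          LinearMap.flip_apply, ha, hb]
        rfl
      | add a b ha hb => simp only [map_add, ha, hb])
    (fun g h => by
      ext f
      induction f using TensorAlgebra.induction generalizing g h with
      | algebraMap r =>
        rw [Module.End.mul_apply, freeActLin_apply V h, freeActLin_apply V (g * h),
          freeCoact_algebraMap, freeCoact_algebraMap, map_smul, freeActLin_apply, freeCoact_algebraMap, smul_smul,
          Bialgebra.counit_mul, mul_comm]
      | ι x => simp [freeActLin_apply, freeCoact_ι]
      | add a b ha hb => simp only [map_add, ha, hb]
      | mul a b ha hb =>
        rw [Module.End.mul_apply, freeActLin_mul_apply, freeActLin_mul_apply, Bialgebra.comul_mul]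
        induction Coalgebra.comul (R := k) h with
        | zero => simp only [mul_zero, map_zero]
        | add p q hp hq => simp only [mul_add, map_add, hp, hq]
        | tmul p q =>
          rw [TensorProduct.map_tmul, LinearMap.mul'_apply, freeActLin_mul_apply]
          induction Coalgebra.comul (R := k) g with
          | zero => simp only [zero_mul, map_zero]
          | add p q hp hq => simp only [add_mul, map_add, hp, hq]
          | tmul c d =>
            rw [Algebra.TensorProduct.tmul_mul_tmul, TensorProduct.map_tmul,
              TensorProduct.map_tmul, LinearMap.mul'_apply, LinearMap.mul'_apply,
              LinearMap.flip_apply, LinearMap.flip_apply, LinearMap.flip_apply,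
              LinearMap.flip_apply, ha, hb]
            rfl)

/-- The free `H`-module algebra `T(V)`. -/
abbrev freeAlg (V : HRep.{u, v, w} k H) : HAlg.{u, v, max u w} k H where
  carrier := TensorAlgebra k V
  act := freeAct V
  act_one h := by
    have := freeCoact_algebraMap V h 1
    rwa [map_one] at this
  act_mul h a b := freeActLin_mul_apply V h a b

theorem freeAct_ι (V : HRep.{u, v, w} k H) (h : H) (v : V) :
    freeAct V h (TensorAlgebra.ι k v) = TensorAlgebra.ι k (V.act h v) := freeCoact_ι V h v

theorem algebraMapInv_freeAct (V : HRep.{u, v, w} k H) (h : H) (f : TensorAlgebra k V) :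
    TensorAlgebra.algebraMapInv (freeAct V h f)
      = Coalgebra.counit (R := k) h * TensorAlgebra.algebraMapInv f := by
  change TensorAlgebra.algebraMapInv (freeActLin V h f) = _
  induction f using TensorAlgebra.induction generalizing h with
  | algebraMap r =>
    rw [freeActLin_apply, freeCoact_algebraMap, map_smul, smul_eq_mul]
  | ι x => simp [freeActLin_apply, freeCoact_ι, TensorAlgebra.algebraMapInv]
  | add a b ha hb => simp only [map_add, ha, hb, mul_add]
  | mul a b ha hb =>
    rw [freeActLin_mul_apply]
    have key : ∀ z : H ⊗[k] H, TensorAlgebra.algebraMapInv (LinearMap.mul' k _ (TensorProduct.map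
        ((freeActLin V).flip a) ((freeActLin V).flip b) z))
        = Coalgebra.counit (R := k) (TensorProduct.lid k H
            ((Coalgebra.counit (R := k)).rTensor H z)) * TensorAlgebra.algebraMapInv (a * b) := by
      intro z
      induction z with
      | zero => simp
      | add p q hp hq => simp only [map_add, hp, hq, add_mul]
      | tmul p q =>
        simp [ha, hb]
        ring
    rw [key, Coalgebra.rTensor_counit_comul, TensorProduct.lid_tmul, one_smul]

end Free

section Mixed

variable (k : Type u) [Field k]

/-- Graded spaces `X₀, X₁, …` with operators `b` of degree `-1` and `B` of degree `+1`. -/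
structure MixedData where
  obj : ℕ → Type w
  [grp : ∀ n, AddCommGroup (obj n)]
  [mod : ∀ n, Module k (obj n)]
  b : ∀ n, obj (n + 1) →ₗ[k] obj n
  B : ∀ n, obj n →ₗ[k] obj (n + 1)

attribute [instance] MixedData.grp MixedData.mod

namespace MixedData

variable {k} (X : MixedData.{u, w} k)

/-- `X` is a mixed complex: `b² = 0`, `B² = 0` and `bB + Bb = 0`. -/
structure IsMixed : Prop where
  b_b : ∀ n x, X.b n (X.b (n + 1) x) = 0
  B_B : ∀ n x, X.B (n + 1) (X.B n x) = 0
  b_B_zero : ∀ x, X.b 0 (X.B 0 x) = 0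
  b_B_add : ∀ n x, X.b (n + 1) (X.B (n + 1) x) + X.B n (X.b n x) = 0

/-- The cycles of `(X, b)`. -/
def cycles : ∀ n, Submodule k (X.obj n)
  | 0 => ⊤
  | n + 1 => LinearMap.ker (X.b n)

/-- The Hochschild homology of `X`, that is, the homology of `(X, b)`. -/
abbrev HH (n : ℕ) : Type w :=
  X.cycles n ⧸ (LinearMap.range (X.b n)).submoduleOf (X.cycles n)

/-- The operator `b + B` on `∏ₙ Xₙ`. -/
def D : (∀ n, X.obj n) →ₗ[k] (∀ n, X.obj n) :=
  LinearMap.pi fun n => match n with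
    | 0 => X.b 0 ∘ₗ LinearMap.proj 1
    | n + 1 => X.b (n + 1) ∘ₗ LinearMap.proj (n + 2) + X.B n ∘ₗ LinearMap.proj n

/-- The part `X_ν × X_{ν+2} × ⋯` of `∏ₙ Xₙ` of parity `ν`. -/
def parity (ν : ℕ) : Submodule k (∀ n, X.obj n) where
  carrier := {x | ∀ i, i % 2 ≠ ν % 2 → x i = 0}
  add_mem' hx hy i hi := by simp [hx i hi, hy i hi]
  zero_mem' _ _ := rfl
  smul_mem' c x hx i hi := by simp [hx i hi]

/-- The degree `n` part `Xₙ ⊕ Xₙ₋₂ ⊕ Xₙ₋₄ ⊕ ⋯` of the total complex, inside `∏ₙ Xₙ`. -/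
def tot (n : ℕ) : Submodule k (∀ n, X.obj n) where
  carrier := {x | ∀ i, ¬ (i ≤ n ∧ i % 2 = n % 2) → x i = 0}
  add_mem' hx hy i hi := by simp [hx i hi, hy i hi]
  zero_mem' _ _ := rfl
  smul_mem' c x hx i hi := by simp [hx i hi]

/-- The differential `b + B` of the total complex on its degree `n` part: the component of
`(b + B)x` of degree `n + 1` is dropped. -/
def totD (n : ℕ) : (∀ n, X.obj n) →ₗ[k] (∀ n, X.obj n) :=
  (LinearMap.pi fun i => if i < n then LinearMap.proj i else 0) ∘ₗ X.D

/-- The cycles of degree `n` of the total complex. -/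
def totCycles (n : ℕ) : Submodule k (∀ n, X.obj n) := X.tot n ⊓ LinearMap.ker (X.totD n)

/-- The cyclic homology of `X`: the homology of the total complex. -/
abbrev HC (n : ℕ) : Type w :=
  X.totCycles n ⧸ ((X.tot (n + 1)).map (X.totD (n + 1))).submoduleOf (X.totCycles n)

/-- The map `X₀ → HC₀(X)`. -/
def zeroClass : X.obj 0 →ₗ[k] X.HC 0 :=
  Submodule.mkQ _ ∘ₗ (LinearMap.single k X.obj 0).codRestrict (X.totCycles 0) (fun x => by
    refine ⟨fun i hi => ?_, LinearMap.mem_ker.2 ?_⟩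
    · have : i ≠ 0 := fun h => hi (by simp [h])
      simp [this]
    · ext i
      simp [totD])

/-- The quotient of `X` by subspaces stable under `b` and `B`. -/
def quotient (K : ∀ n, Submodule k (X.obj n)) (hb : ∀ n, K (n + 1) ≤ (K n).comap (X.b n))
    (hB : ∀ n, K n ≤ (K (n + 1)).comap (X.B n)) : MixedData.{u, w} k where
  obj n := X.obj n ⧸ K n
  b n := (K (n + 1)).mapQ (K n) (X.b n) (hb n)
  B n := (K n).mapQ (K (n + 1)) (X.B n) (hB n)

variable {X} {Y : MixedData.{u, w} k}

/-- `f : X → Y` is a quasi-isomorphism of mixed complexes: it commutes with `b` and `B` and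
induces a bijection on the homology of `b`. -/
structure IsQuasiIso (f : ∀ n, X.obj n →ₗ[k] Y.obj n) : Prop where
  source : X.IsMixed
  target : Y.IsMixed
  comm_b : ∀ n x, f n (X.b n x) = Y.b n (f (n + 1) x)
  comm_B : ∀ n x, f (n + 1) (X.B n x) = Y.B n (f n x)
  injective : ∀ n, ∀ x ∈ X.cycles n, f n x ∈ LinearMap.range (Y.b n) → x ∈ LinearMap.range (X.b n)
  surjective : ∀ n, ∀ y ∈ Y.cycles n, ∃ x ∈ X.cycles n, y - f n x ∈ LinearMap.range (Y.b n)

/-- `f : X → Y` induces a bijection on the homology of the `ℤ/2`-graded complexes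
`(∏ₙ Xₙ, b + B)` and `(∏ₙ Yₙ, b + B)`. -/
structure IsSuperQuasiIso (f : ∀ n, X.obj n →ₗ[k] Y.obj n) : Prop where
  injective : ∀ ν, ∀ x ∈ X.parity ν, X.D x = 0 →
    (∃ y ∈ Y.parity (ν + 1), Y.D y = fun n => f n (x n)) → ∃ z ∈ X.parity (ν + 1), X.D z = x
  surjective : ∀ ν, ∀ y ∈ Y.parity ν, Y.D y = 0 →
    ∃ x ∈ X.parity ν, X.D x = 0 ∧ ∃ z ∈ Y.parity (ν + 1), Y.D z = y - fun n => f n (x n)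

end MixedData

end Mixed

section Cyclic

set_option linter.unusedSectionVars false

variable {k : Type u} {H : Type v} [Field k] [Ring H] [HopfAlgebra k H]

open HRep

/-- `A^{⊗(n+1)}` with the diagonal action. -/
abbrev tpow (A : HAlg.{u, v, w} k H) : ℕ → HRep.{u, v, w} k H
  | 0 => A.toHRep
  | n + 1 => tens (tpow A n) A.toHRep

/-- The inner face `a₀ ⊗ ⋯ ⊗ aₙ₊₁ ↦ a₀ ⊗ ⋯ ⊗ aᵢaᵢ₊₁ ⊗ ⋯ ⊗ aₙ₊₁`, for `i ≤ n`. -/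
def face (A : HAlg.{u, v, w} k H) : ∀ n : ℕ, ℕ → Hom (tpow A (n + 1)) (tpow A n)
  | 0, _ => A.mul
  | n + 1, i => if i = n + 1
      then ((Hom.id (tpow A n)).tmap A.mul).comp (assoc (tpow A n) A.toHRep A.toHRep)
      else (face A n i).tmap (Hom.id A.toHRep)

/-- The rebracketing `a ⊗ (a₀ ⊗ ⋯ ⊗ aₙ) ↦ a ⊗ a₀ ⊗ ⋯ ⊗ aₙ`. -/
def cons (A : HAlg.{u, v, w} k H) : ∀ n : ℕ, Hom (tens A.toHRep (tpow A n)) (tpow A (n + 1))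
  | 0 => Hom.id _
  | n + 1 => ((cons A n).tmap (Hom.id A.toHRep)).comp (assocInv A.toHRep (tpow A n) A.toHRep)

/-- `1 ⊗ ⋯ ⊗ 1` in `A^{⊗(n+1)}`. -/
def ones (A : HAlg.{u, v, w} k H) : ∀ n : ℕ, tpow A n
  | 0 => (1 : A)
  | n + 1 => ones A n ⊗ₜ[k] (1 : A)

theorem face_ones (A : HAlg.{u, v, w} k H) (n i : ℕ) :
    (face A n i).lin (ones A (n + 1)) = ones A n := by
  induction n with
  | zero =>
    change (1 : A) * 1 = 1
    rw [one_mul]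
  | succ n ih =>
    rw [face]
    split_ifs
    · change ones A n ⊗ₜ[k] ((1 : A) * 1) = ones A n ⊗ₜ[k] (1 : A)
      rw [one_mul]
    · change (face A n i).lin (ones A (n + 1)) ⊗ₜ[k] (1 : A) = ones A n ⊗ₜ[k] (1 : A)
      rw [ih]

theorem cons_ones (A : HAlg.{u, v, w} k H) (n : ℕ) :
    (cons A n).lin ((1 : A) ⊗ₜ[k] ones A n) = ones A (n + 1) := by
  induction n with
  | zero => rfl
  | succ n ih =>
    change (cons A n).lin ((1 : A) ⊗ₜ[k] ones A n) ⊗ₜ[k] (1 : A) = ones A (n + 1) ⊗ₜ[k] (1 : A)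
    rw [ih]

variable (A : HAlg.{u, v, w} k H) (M : Type x) [AddCommGroup M] [Module k M] [Module Hᵐᵒᵖ M]
  [IsScalarTower k Hᵐᵒᵖ M] [LeftComodule k H M] [InvertibleAntipode k H] [IsSAYD k H M]

/-- The cyclic operator `τ` on `M ⊗_H A^{⊗(n+2)}`:
`m ⊗ a₀ ⊗ ⋯ ⊗ aₙ₊₁ ↦ m⁽⁰⁾ ⊗ S⁻¹(m⁽⁻¹⁾)(aₙ₊₁) ⊗ a₀ ⊗ ⋯ ⊗ aₙ`. (On `M ⊗_H A` it is the identity,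
by stability.) -/
def tau (n : ℕ) : HTens M (tpow A (n + 1)) →ₗ[k] HTens M (tpow A (n + 1)) :=
  HTens.map (cons A n) ∘ₗ HTens.swap (tpow A n) A.toHRep

/-- The Hochschild differential `b = ∑ᵢ (-1)ⁱ ∂ᵢ`, where the last face is
`m ⊗ a₀ ⊗ ⋯ ⊗ aₙ₊₁ ↦ m⁽⁰⁾ ⊗ S⁻¹(m⁽⁻¹⁾)(aₙ₊₁)a₀ ⊗ a₁ ⊗ ⋯ ⊗ aₙ`. -/
def cycb (n : ℕ) : HTens M (tpow A (n + 1)) →ₗ[k] HTens M (tpow A n) :=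
  ∑ i ∈ Finset.range (n + 1), (-1 : k) ^ i • HTens.map (face A n i)
    + (-1 : k) ^ (n + 1) • (HTens.map (face A n 0) ∘ₗ tau A M n)

/-- The signed cyclic operator `t = (-1)ⁿ⁺¹ τ` on `M ⊗_H A^{⊗(n+2)}`. -/
def cyct (n : ℕ) : Module.End k (HTens M (tpow A (n + 1))) := (-1 : k) ^ (n + 1) • tau A M n

/-- The norm `N = 1 + t + ⋯ + tⁿ` on `M ⊗_H A^{⊗(n+1)}`. -/
def cycN : ∀ n : ℕ, Module.End k (HTens M (tpow A n))
  | 0 => 1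
  | n + 1 => ∑ i ∈ Finset.range (n + 2), cyct A M n ^ i

/-- The extra degeneracy `m ⊗ a₀ ⊗ ⋯ ⊗ aₙ ↦ m ⊗ 1 ⊗ a₀ ⊗ ⋯ ⊗ aₙ`, that is, `τ` after insertion of
`1` in the last place. -/
def cycs (n : ℕ) : HTens M (tpow A n) →ₗ[k] HTens M (tpow A (n + 1)) :=
  tau A M n ∘ₗ HTens.map (A.insOne (tpow A n))

/-- Connes' operator `B = (1 - t) s N`. -/
def cycB (n : ℕ) : HTens M (tpow A n) →ₗ[k] HTens M (tpow A (n + 1)) :=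
  (1 - cyct A M n) ∘ₗ cycs A M n ∘ₗ cycN A M n

/-- The mixed complex of the cyclic module `C_*^H(A, M)`, `C_n^H(A, M) = M ⊗_H A^{⊗(n+1)}`. -/
abbrev cycMixed : MixedData.{u, max x w} k where
  obj n := HTens M (tpow A n)
  b := cycb A M
  B := cycB A M

/-- The image of `C_n^H(k, M)` in `C_n^H(A, M)`: the classes `m ⊗ 1 ⊗ ⋯ ⊗ 1`. -/
def scalarPart (n : ℕ) : Submodule k (HTens M (tpow A n)) :=
  LinearMap.range ((HTens.mk (M := M) (tpow A n)).flip (ones A n))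

variable {M}

theorem mk_ones_mem (n : ℕ) (m : M) :
    HTens.mk (tpow A n) m (ones A n) ∈ scalarPart A M n := ⟨m, rfl⟩

theorem tau_ones (n : ℕ) (m : M) :
    tau A M n (HTens.mk (tpow A (n + 1)) m (ones A (n + 1)))
      = HTens.mk (tpow A (n + 1)) m (ones A (n + 1)) := by
  have h := HTens.swap_insOne A (tpow A n) (HTens.mk _ m (ones A n))
  rw [HTens.map_mk, HTens.map_mk] at h
  rw [tau, LinearMap.comp_apply]
  refine (congrArg _ h).trans ?_
  rw [HTens.map_mk]
  exact congrArg _ (cons_ones A n)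

theorem cyct_mem (n : ℕ) (t) (ht : t ∈ scalarPart A M (n + 1)) :
    cyct A M n t ∈ scalarPart A M (n + 1) := by
  obtain ⟨m, rfl⟩ := ht
  rw [cyct, LinearMap.smul_apply]
  refine Submodule.smul_mem _ _ ?_
  rw [LinearMap.flip_apply, tau_ones]
  exact mk_ones_mem A _ m

theorem scalarPart_b (n : ℕ) : scalarPart A M (n + 1) ≤ (scalarPart A M n).comap (cycb A M n) := by
  rintro _ ⟨m, rfl⟩
  rw [Submodule.mem_comap, cycb, LinearMap.flip_apply, LinearMap.add_apply, LinearMap.sum_apply]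
  refine Submodule.add_mem _ (Submodule.sum_mem _ fun i _ => ?_) ?_
  · rw [LinearMap.smul_apply, HTens.map_mk, face_ones]
    exact Submodule.smul_mem _ _ (mk_ones_mem A _ m)
  · rw [LinearMap.smul_apply, LinearMap.comp_apply, tau_ones, HTens.map_mk, face_ones]
    exact Submodule.smul_mem _ _ (mk_ones_mem A _ m)

theorem scalarPart_B (n : ℕ) : scalarPart A M n ≤ (scalarPart A M (n + 1)).comap (cycB A M n) := by
  have hN : ∀ t ∈ scalarPart A M n, cycN A M n t ∈ scalarPart A M n := by
    cases n with
    | zero => exact fun t ht => ht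
    | succ n =>
      intro t ht
      rw [cycN, LinearMap.sum_apply]
      refine Submodule.sum_mem _ fun i hi => ?_
      clear hi
      induction i with
      | zero => exact ht
      | succ i ih =>
        rw [pow_succ', Module.End.mul_apply]
        exact cyct_mem A n _ ih
  intro t ht
  obtain ⟨m, hm⟩ := hN t ht
  have hs : cycs A M n (cycN A M n t) ∈ scalarPart A M (n + 1) := by
    rw [← hm, LinearMap.flip_apply, cycs, LinearMap.comp_apply, HTens.map_mk]
    have e := tau_ones A n m
    exact ⟨m, e.symm⟩
  rw [Submodule.mem_comap, cycB, LinearMap.comp_apply, LinearMap.comp_apply, LinearMap.sub_apply]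
  exact Submodule.sub_mem _ hs (cyct_mem A n _ hs)

variable (M)

/-- The reduced mixed complex `C_*^H(A, M) / C_*^H(k, M)`. -/
abbrev redCycMixed : MixedData.{u, max x w} k :=
  (cycMixed A M).quotient (scalarPart A M) (scalarPart_b A) (scalarPart_B A)

end Cyclic

section Forms

set_option linter.unusedSectionVars false

variable {k : Type u} {H : Type v} [Field k] [Ring H] [HopfAlgebra k H]

open HRep

/-- A bilinear map on `P × A` vanishing on `p ⊗ 1` as a bilinear map on `P × A/k1`. -/
def barLift (A : HAlg.{u, v, w} k H) {P T : Type*} [AddCommGroup P] [Module k P]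
    [AddCommGroup T] [Module k T] (f : P ⊗[k] A →ₗ[k] T) (hf : ∀ p, f (p ⊗ₜ 1) = 0) :
    P ⊗[k] A.bar →ₗ[k] T :=
  TensorProduct.lift ((Submodule.span k {(1 : A)}).liftQ (TensorProduct.curry f).flip (by
    rw [Submodule.span_singleton_le_iff_mem, LinearMap.mem_ker]
    ext p
    exact hf p)).flip

theorem barLift_tmul (A : HAlg.{u, v, w} k H) {P T : Type*} [AddCommGroup P] [Module k P]
    [AddCommGroup T] [Module k T] (f : P ⊗[k] A →ₗ[k] T) (hf : ∀ p, f (p ⊗ₜ 1) = 0) (p : P)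
    (a : A) : barLift A f hf (p ⊗ₜ A.mkBar.lin a) = f (p ⊗ₜ a) := rfl

/-- An `H`-linear map on `X ⊗ A` vanishing on `X ⊗ 1` as a map on `X ⊗ A/k1`. -/
def barLiftHom (A : HAlg.{u, v, w} k H) {X Y : HRep.{u, v, w} k H}
    (f : Hom (tens X A.toHRep) Y) (hf : ∀ x, f.lin (x ⊗ₜ 1) = 0) : Hom (tens X A.bar) Y where
  lin := barLift A f.lin hf
  comm h t := by
    induction t using TensorProduct.induction_on with
    | zero => simp only [map_zero]
    | add a b ha hb => simp only [map_add, ha, hb]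
    | tmul x a =>
      obtain ⟨a, rfl⟩ := A.mkBar_surjective a
      rw [barLift_tmul, ← f.comm]
      have := ((Hom.id X).tmap A.mkBar).comm h (x ⊗ₜ a)
      have e : ∀ t, barLift A f.lin hf (((Hom.id X).tmap A.mkBar).lin t) = f.lin t := by
        intro t
        induction t using TensorProduct.induction_on with
        | zero => simp only [map_zero]
        | add a b ha hb => simp only [map_add, ha, hb]
        | tmul x a => rfl
      rw [← e, this]
      rfl

/-- The symmetric rebracketing `(x ⊗ a) ⊗ y ↦ (x ⊗ y) ⊗ a`, as a linear map. -/
abbrev rightComm (X A Y : Type*) [AddCommGroup X] [Module k X] [AddCommGroup A] [Module k A]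
    [AddCommGroup Y] [Module k Y] : (X ⊗[k] A) ⊗[k] Y →ₗ[k] (X ⊗[k] Y) ⊗[k] A :=
  (TensorProduct.rightComm k X A Y).toLinearMap

/-- An `H`-linear map on `(X ⊗ A) ⊗ Y` vanishing on `(X ⊗ 1) ⊗ Y` as a map on
`(X ⊗ A/k1) ⊗ Y`. -/
def barLiftHom₂ (A : HAlg.{u, v, w} k H) {X Y Z : HRep.{u, v, w} k H}
    (f : Hom (tens (tens X A.toHRep) Y) Z) (hf : ∀ x y, f.lin ((x ⊗ₜ 1) ⊗ₜ y) = 0) :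
    Hom (tens (tens X A.bar) Y) Z where
  lin := barLift A (f.lin ∘ₗ rightComm X Y A) (fun t => by
    induction t using TensorProduct.induction_on with
    | zero => simp only [TensorProduct.zero_tmul, map_zero]
    | add a b ha hb => simp only [TensorProduct.add_tmul, map_add, ha, hb, add_zero]
    | tmul x y => exact hf x y) ∘ₗ rightComm X A.bar Y
  comm h t := by
    have e : ∀ t, (barLift A (f.lin ∘ₗ rightComm X Y A) (fun t => by
        induction t using TensorProduct.induction_on with
        | zero => simp only [TensorProduct.zero_tmul, map_zero]
        | add a b ha hb => simp only [TensorProduct.add_tmul, map_add, ha, hb, add_zero]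
        | tmul x y => exact hf x y) ∘ₗ rightComm X A.bar Y)
        ((((Hom.id X).tmap A.mkBar).tmap (Hom.id Y)).lin t) = f.lin t := by
      intro t
      induction t using TensorProduct.induction_on with
      | zero => simp only [map_zero]
      | add a b ha hb => simp only [map_add, ha, hb]
      | tmul t y =>
        induction t using TensorProduct.induction_on with
        | zero => simp only [TensorProduct.zero_tmul, map_zero]
        | add a b ha hb => simp only [TensorProduct.add_tmul, map_add, ha, hb]
        | tmul x a => rfl
    induction t using TensorProduct.induction_on with
    | zero => simp only [map_zero]
    | add a b ha hb => simp only [map_add, ha, hb]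
    | tmul t y =>
      induction t using TensorProduct.induction_on with
      | zero => simp only [TensorProduct.zero_tmul, map_zero]
      | add a b ha hb => simp only [TensorProduct.add_tmul, map_add, ha, hb]
      | tmul x a =>
        obtain ⟨a, rfl⟩ := A.mkBar_surjective a
        have h1 := (((Hom.id X).tmap A.mkBar).tmap (Hom.id Y)).comm h ((x ⊗ₜ a) ⊗ₜ y)
        have h2 := e ((tens (tens X A.toHRep) Y).act h ((x ⊗ₜ a) ⊗ₜ y))
        rw [f.comm, ← e, h1] at h2
        exact h2

/-- The noncommutative differential forms `Ωⁿ(A) = A ⊗ (A/k1)^{⊗n}`, where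
`a₀ ⊗ ā₁ ⊗ ⋯ ⊗ āₙ` stands for `a₀ da₁ ⋯ daₙ`. Thus `Ωⁿ⁺¹(A) = Ωⁿ(A) ⊗ A/k1`, and `ω ⊗ ā` is
`ω da`. -/
abbrev forms (A : HAlg.{u, v, w} k H) : ℕ → HRep.{u, v, w} k H
  | 0 => A.toHRep
  | n + 1 => tens (forms A n) A.bar

/-- The left multiplication `a ⊗ ω ↦ aω`. -/
def formsL (A : HAlg.{u, v, w} k H) : ∀ n, Hom (tens A.toHRep (forms A n)) (forms A n)
  | 0 => A.mul
  | n + 1 => ((formsL A n).tmap (Hom.id A.bar)).comp (assocInv A.toHRep (forms A n) A.bar)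

/-- The right multiplication `ω ⊗ a ↦ ωa`, determined by `(ω da)a' = ω d(aa') - (ωa) da'`,
together with the fact `ω1 = ω`. -/
def formsRAux (A : HAlg.{u, v, w} k H) : ∀ n,
    {r : Hom (tens (forms A n) A.toHRep) (forms A n) // ∀ ω, r.lin (ω ⊗ₜ (1 : A)) = ω}
  | 0 => ⟨A.mul, fun ω => mul_one (ω : A)⟩
  | n + 1 => ⟨barLiftHom₂ A
      ((((Hom.id (forms A n)).tmap (A.mkBar.comp A.mul)).comp
          (assoc (forms A n) A.toHRep A.toHRep)).sub
        ((formsRAux A n).1.tmap A.mkBar))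
      (fun ω a => by
        change ω ⊗ₜ[k] A.mkBar.lin ((1 : A) * a)
          - (formsRAux A n).1.lin (ω ⊗ₜ (1 : A)) ⊗ₜ[k] A.mkBar.lin a = 0
        rw [(formsRAux A n).2, one_mul, sub_self]),
      fun t => by
        induction t using TensorProduct.induction_on with
        | zero => simp only [TensorProduct.zero_tmul, map_zero]
        | add a b ha hb => simp only [TensorProduct.add_tmul, map_add, ha, hb]
        | tmul ω a =>
          obtain ⟨a, rfl⟩ := A.mkBar_surjective a
          change ω ⊗ₜ[k] A.mkBar.lin ((a : A) * 1)
            - (formsRAux A n).1.lin (ω ⊗ₜ (a : A)) ⊗ₜ[k] A.mkBar.lin (1 : A)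
              = ω ⊗ₜ[k] A.mkBar.lin a
          rw [A.mkBar_one, TensorProduct.tmul_zero, sub_zero, mul_one]⟩

/-- The right multiplication `ω ⊗ a ↦ ωa`. -/
def formsR (A : HAlg.{u, v, w} k H) (n : ℕ) : Hom (tens (forms A n) A.toHRep) (forms A n) :=
  (formsRAux A n).1

theorem formsR_one (A : HAlg.{u, v, w} k H) (n : ℕ) (ω : forms A n) :
    (formsR A n).lin (ω ⊗ₜ (1 : A)) = ω := (formsRAux A n).2 ω

theorem formsR_zero (A : HAlg.{u, v, w} k H) (a b : A) :
    (formsR A 0).lin (a ⊗ₜ b) = a * b := rfl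

theorem formsR_succ (A : HAlg.{u, v, w} k H) (n : ℕ) (ω : forms A n) (a b : A) :
    (formsR A (n + 1)).lin ((ω ⊗ₜ A.mkBar.lin a) ⊗ₜ b)
      = ω ⊗ₜ[k] A.mkBar.lin (a * b) - (formsR A n).lin (ω ⊗ₜ a) ⊗ₜ[k] A.mkBar.lin b := rfl

theorem formsL_one (A : HAlg.{u, v, w} k H) (n : ℕ) (ω : forms A n) :
    (formsL A n).lin ((1 : A) ⊗ₜ ω) = ω := by
  induction n with
  | zero => exact one_mul (ω : A)
  | succ n ih =>
    induction ω using TensorProduct.induction_on with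
    | zero => simp only [TensorProduct.tmul_zero, map_zero]
    | add a b ha hb => simp only [TensorProduct.tmul_add, map_add, ha, hb]
    | tmul ω a =>
      change (formsL A n).lin ((1 : A) ⊗ₜ ω) ⊗ₜ[k] a = ω ⊗ₜ[k] a
      rw [ih]

/-- The universal differential `d(a₀ da₁ ⋯ daₙ) = da₀ da₁ ⋯ daₙ`. -/
def formsD (A : HAlg.{u, v, w} k H) : ∀ n, Hom (forms A n) (forms A (n + 1))
  | 0 => (A.oneIns A.bar).comp A.mkBar
  | n + 1 => (formsD A n).tmap (Hom.id A.bar)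

/-- The left multiplication by exact one-forms `a ⊗ ω ↦ (da)ω = d(aω) - a dω`. -/
def formsDL (A : HAlg.{u, v, w} k H) (n : ℕ) :
    Hom (tens A.toHRep (forms A n)) (forms A (n + 1)) :=
  ((formsD A n).comp (formsL A n)).sub
    ((formsL A (n + 1)).comp ((Hom.id A.toHRep).tmap (formsD A n)))

variable (A : HAlg.{u, v, w} k H) (M : Type x) [AddCommGroup M] [Module k M] [Module Hᵐᵒᵖ M]
  [IsScalarTower k Hᵐᵒᵖ M]

variable {M}

/-- A linear map on `M ⊗_H (X ⊗ A)` vanishing on the classes `m ⊗_H (x ⊗ 1)` as a map on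
`M ⊗_H (X ⊗ A/k1)`. -/
def barDesc {X : HRep.{u, v, w} k H} {T : Type*} [AddCommGroup T] [Module k T]
    (f : HTens M (tens X A.toHRep) →ₗ[k] T)
    (hf : ∀ m x, f (HTens.mk _ m ((A.insOne X).lin x)) = 0) :
    HTens M (tens X A.bar) →ₗ[k] T :=
  HTens.lift (barLift A (T := M →ₗ[k] T) ((HTens.mk (tens X A.toHRep)).compr₂ f).flip
      (fun x => by ext m; exact hf m x)).flip
    (fun m h t => by
      have e : ∀ m t, (barLift A (T := M →ₗ[k] T) ((HTens.mk (tens X A.toHRep)).compr₂ f).flip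
          (fun x => by ext m; exact hf m x)).flip m (((Hom.id X).tmap A.mkBar).lin t)
          = f (HTens.mk _ m t) := by
        intro m t
        induction t using TensorProduct.induction_on with
        | zero => simp only [map_zero]
        | add a b ha hb => simp only [map_add, ha, hb]
        | tmul x a => rfl
      obtain ⟨t, rfl⟩ : ∃ s, ((Hom.id X).tmap A.mkBar).lin s = t :=
        TensorProduct.map_surjective Function.surjective_id A.mkBar_surjective t
      rw [← ((Hom.id X).tmap A.mkBar).comm, e, e, HTens.mk_smul])

theorem barDesc_mk {X : HRep.{u, v, w} k H} {T : Type*} [AddCommGroup T] [Module k T]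
    (f : HTens M (tens X A.toHRep) →ₗ[k] T)
    (hf : ∀ m x, f (HTens.mk _ m ((A.insOne X).lin x)) = 0) (m : M) (x : X) (a : A) :
    barDesc A f hf (HTens.mk (tens X A.bar) m (x ⊗ₜ A.mkBar.lin a))
      = f (HTens.mk (tens X A.toHRep) m (x ⊗ₜ a)) := rfl

variable (M) [LeftComodule k H M] [InvertibleAntipode k H] [IsSAYD k H M]

/-- The twisted commutator `m ⊗_H (n ⊗ a) ↦ m ⊗_H na - m⁽⁰⁾ ⊗_H S⁻¹(m⁽⁻¹⁾)(a)n`, for an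
`H`-module `N` with a left and a right multiplication by `A`. -/
def commutator {N : HRep.{u, v, w} k H} (l : Hom (tens A.toHRep N) N) (r : Hom (tens N A.toHRep) N) :
    HTens M (tens N A.toHRep) →ₗ[k] HTens M N :=
  HTens.map r - HTens.map l ∘ₗ HTens.swap N A.toHRep

/-- `(M ⊗_H N)_♮`: the quotient of `M ⊗_H N` by the twisted commutators. -/
abbrev Natural {N : HRep.{u, v, w} k H} (l : Hom (tens A.toHRep N) N)
    (r : Hom (tens N A.toHRep) N) : Type (max x w) :=
  HTens M N ⧸ LinearMap.range (commutator A M l r)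

/-- The Hochschild differential
`b(m ⊗_H ω da) = (-1)ⁿ(m ⊗_H ωa - m⁽⁰⁾ ⊗_H S⁻¹(m⁽⁻¹⁾)(a)ω)`, `ω ∈ Ωⁿ(A)`. -/
def formsb (n : ℕ) : HTens M (forms A (n + 1)) →ₗ[k] HTens M (forms A n) :=
  (-1 : k) ^ n • barDesc A (commutator A M (formsL A n) (formsR A n)) (fun m ω => by
    have h := HTens.swap_insOne A (forms A n) (HTens.mk _ m ω)
    rw [HTens.map_mk, HTens.map_mk] at h
    have h2 := congrArg (HTens.map (formsL A n)) h
    rw [commutator, LinearMap.sub_apply, LinearMap.comp_apply]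
    refine sub_eq_zero.2 (Eq.trans ?_ h2.symm)
    rw [HTens.map_mk, HTens.map_mk]
    exact congrArg _ ((formsR_one A n ω).trans (formsL_one A n ω).symm))

/-- The Karoubi operator
`κ(m ⊗_H ω da) = (-1)ⁿ m⁽⁰⁾ ⊗_H d(S⁻¹(m⁽⁻¹⁾)(a)) ω`, `ω ∈ Ωⁿ(A)`; it is the identity in degree `0`,
by stability. -/
def karoubi : ∀ n, Module.End k (HTens M (forms A n))
  | 0 => 1
  | n + 1 => (-1 : k) ^ n •
      barDesc A (HTens.map (formsDL A n) ∘ₗ HTens.swap (forms A n) A.toHRep) (fun m ω => by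
        have h := HTens.swap_insOne A (forms A n) (HTens.mk _ m ω)
        rw [HTens.map_mk, HTens.map_mk] at h
        have h2 := congrArg (HTens.map (formsDL A n)) h
        rw [LinearMap.comp_apply]
        refine h2.trans ?_
        rw [HTens.map_mk]
        have e : (formsDL A n).lin ((A.oneIns (forms A n)).lin ω) = 0 := by
          change (formsD A n).lin ((formsL A n).lin ((1 : A) ⊗ₜ ω))
            - (formsL A (n + 1)).lin ((1 : A) ⊗ₜ (formsD A n).lin ω) = 0
          rw [formsL_one, formsL_one, sub_self]
        rw [e, map_zero])

/-- Connes' operator `B = (1 + κ + ⋯ + κⁿ) d` on `n`-forms. -/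
def formsB (n : ℕ) : HTens M (forms A n) →ₗ[k] HTens M (forms A (n + 1)) :=
  (∑ j ∈ Finset.range (n + 1), karoubi A M (n + 1) ^ j) ∘ₗ HTens.map (formsD A n)

/-- The mixed complex `(Ω_H(A, M), b, B)`, `Ω_H^n(A, M) = M ⊗_H Ωⁿ(A)`. -/
abbrev formsMixed : MixedData.{u, max x w} k where
  obj n := HTens M (forms A n)
  b := formsb A M
  B := formsB A M

/-- `Ω_H^1(A, M)_♮`. -/
abbrev OneFormsNatural : Type (max x w) := Natural A M (formsL A 1) (formsR A 1)

end Forms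

section XComplex

set_option linter.unusedSectionVars false

variable {k : Type u} {H : Type v} [Field k] [Ring H] [HopfAlgebra k H]

open HRep

variable (A : HAlg.{u, v, w} k H) (M : Type x) [AddCommGroup M] [Module k M] [Module Hᵐᵒᵖ M]
  [IsScalarTower k Hᵐᵒᵖ M]

variable {M}

theorem HTens.map_comp {X Y Z : HRep.{u, v, w} k H} (g : Hom Y Z) (f : Hom X Y) (t : HTens M X) :
    HTens.map (g.comp f) t = HTens.map g (HTens.map f t) :=
  LinearMap.congr_fun (f := HTens.map (g.comp f)) (g := HTens.map g ∘ₗ HTens.map f)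
    (HTens.hom_ext fun m x => by rw [LinearMap.comp_apply, map_mk, map_mk, map_mk]; rfl) t

variable (M) [LeftComodule k H M] [InvertibleAntipode k H] [IsSAYD k H M]

theorem formsb_commutator (t : HTens M (tens (forms A 1) A.toHRep)) :
    formsb A M 0 (commutator A M (formsL A 1) (formsR A 1) t) = 0 := by
  -- lift to `M ⊗_H ((A ⊗ A) ⊗ A)`
  let q : Hom (tens A.toHRep A.toHRep) (forms A 1) := (Hom.id A.toHRep).tmap A.mkBar
  have hq : Function.Surjective (HTens.map (M := M) (q.tmap (Hom.id A.toHRep))) := by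
    intro t
    obtain ⟨t, rfl⟩ := Submodule.mkQ_surjective _ t
    induction t using TensorProduct.induction_on with
    | zero => exact ⟨0, by simp only [map_zero]⟩
    | add a b ha hb =>
      obtain ⟨a', ha⟩ := ha
      obtain ⟨b', hb⟩ := hb
      exact ⟨a' + b', by rw [map_add, map_add, ha, hb]⟩
    | tmul m y =>
      obtain ⟨s, rfl⟩ : ∃ s, (q.tmap (Hom.id A.toHRep)).lin s = y :=
        TensorProduct.map_surjective
          (TensorProduct.map_surjective Function.surjective_id A.mkBar_surjective)
          Function.surjective_id y
      exact ⟨HTens.mk _ m s, HTens.map_mk _ _ _⟩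
  obtain ⟨t, rfl⟩ := hq t
  let c := commutator A M A.mul A.mul
  have hb : ∀ s, formsb A M 0 (HTens.map q s) = c s := by
    intro s
    refine LinearMap.congr_fun (f := formsb A M 0 ∘ₗ HTens.map q) (g := c)
      (HTens.hom_ext fun m y => ?_) s
    induction y using TensorProduct.induction_on with
    | zero => simp only [map_zero]
    | add a b ha hb => simp only [map_add, ha, hb]
    | tmul a b =>
      rw [LinearMap.comp_apply, HTens.map_mk, formsb, pow_zero, one_smul]
      rfl
  -- the two products on `M ⊗_H ((A ⊗ A) ⊗ A)`
  let μ₁ : Hom (tens (tens A.toHRep A.toHRep) A.toHRep) (tens A.toHRep A.toHRep) :=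
    A.mul.tmap (Hom.id A.toHRep)
  let μ₂ : Hom (tens A.toHRep (tens A.toHRep A.toHRep)) (tens A.toHRep A.toHRep) :=
    (Hom.id A.toHRep).tmap A.mul
  let as := assoc A.toHRep A.toHRep A.toHRep
  let as' := assocInv A.toHRep A.toHRep A.toHRep
  have hassoc : ∀ s : HTens M (tens (tens A.toHRep A.toHRep) A.toHRep),
      HTens.map A.mul (HTens.map μ₁ s) = HTens.map A.mul (HTens.map μ₂ (HTens.map as s)) := by
    intro s
    rw [← HTens.map_comp, ← HTens.map_comp, ← HTens.map_comp]
    congr 2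
    have : (A.mul.comp μ₁).lin = ((A.mul.comp μ₂).comp as).lin := by
      ext a b d
      exact mul_assoc (a : A) b d
    generalize A.mul.comp μ₁ = F at this ⊢
    generalize (A.mul.comp μ₂).comp as = G at this ⊢
    cases F; cases G; cases this; rfl
  have hassoc' : ∀ s : HTens M (tens A.toHRep (tens A.toHRep A.toHRep)),
      HTens.map A.mul (HTens.map μ₁ (HTens.map as' s)) = HTens.map A.mul (HTens.map μ₂ s) := by
    intro s
    rw [hassoc, ← HTens.map_comp as as']
    congr 2
    refine (LinearMap.congr_fun (f := HTens.map (as.comp as')) (g := LinearMap.id)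
      (HTens.hom_ext fun m y => ?_) s)
    rw [HTens.map_mk]
    exact congrArg _ ((TensorProduct.assoc k A A A).apply_symm_apply y)
  have hR : HTens.map (formsR A 1) (HTens.map (q.tmap (Hom.id A.toHRep)) t)
      = HTens.map q (HTens.map μ₂ (HTens.map as t) - HTens.map μ₁ t) := by
    rw [map_sub, ← HTens.map_comp, ← HTens.map_comp μ₂, ← HTens.map_comp q, ← HTens.map_comp q]
    refine LinearMap.congr_fun (f := HTens.map _) (g := HTens.map _ - HTens.map _)
      (HTens.hom_ext fun m y => ?_) t
    rw [LinearMap.sub_apply, HTens.map_mk, HTens.map_mk, HTens.map_mk, ← map_sub]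
    congr 1
    induction y using TensorProduct.induction_on with
    | zero => simp only [map_zero, sub_zero]
    | add a b ha hb => rw [map_add, map_add, map_add, ha, hb]; abel
    | tmul y d =>
      induction y using TensorProduct.induction_on with
      | zero => simp only [TensorProduct.zero_tmul, map_zero, sub_zero]
      | add a b ha hb => rw [TensorProduct.add_tmul, map_add, map_add, map_add, ha, hb]; abel
      | tmul a b => rfl
  have hL : HTens.map (formsL A 1) (HTens.swap (forms A 1) A.toHRep
        (HTens.map (q.tmap (Hom.id A.toHRep)) t))
      = HTens.map q (HTens.map μ₁ (HTens.map as' (HTens.swap _ A.toHRep t))) := by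
    rw [HTens.swap_map, ← HTens.map_comp, ← HTens.map_comp μ₁, ← HTens.map_comp q]
    generalize HTens.swap _ A.toHRep t = s
    refine LinearMap.congr_fun (f := HTens.map _) (g := HTens.map _)
      (HTens.hom_ext fun m y => ?_) s
    rw [HTens.map_mk, HTens.map_mk]
    congr 1
    induction y using TensorProduct.induction_on with
    | zero => simp only [map_zero]
    | add a b ha hb => rw [map_add, map_add, ha, hb]
    | tmul d y =>
      induction y using TensorProduct.induction_on with
      | zero => simp only [TensorProduct.tmul_zero, map_zero]
      | add a b ha hb => rw [TensorProduct.tmul_add, map_add, map_add, ha, hb]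
      | tmul a b => rfl
  have hc : ∀ s, c s = HTens.map A.mul s - HTens.map A.mul (HTens.swap _ A.toHRep s) :=
    fun _ => rfl
  rw [commutator, LinearMap.sub_apply, LinearMap.comp_apply, hR, hL, ← map_sub, hb, hc]
  simp only [map_sub]
  have n1 : HTens.swap A.toHRep A.toHRep (HTens.map μ₂ (HTens.map as t))
      = HTens.map μ₁ (HTens.swap _ _ (HTens.map as t)) := HTens.swap_map _ _ _
  have n2 : ∀ t, HTens.swap A.toHRep A.toHRep (HTens.map μ₁ t)
      = HTens.map μ₂ (HTens.swap (M := M) _ _ t) := fun t => HTens.swap_map _ _ _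
  have n3 := HTens.swap_swap A.toHRep A.toHRep A.toHRep t
  rw [n1, n2, n2, hassoc t, hassoc', hassoc (HTens.swap _ _ (HTens.map as t)), n3]
  abel

/-- The differential `b_M(♮(m ⊗_H a db)) = m ⊗_H ab - m⁽⁰⁾ ⊗_H S⁻¹(m⁽⁻¹⁾)(b)a`. -/
def xb : OneFormsNatural A M →ₗ[k] HTens M A.toHRep :=
  (LinearMap.range (commutator A M (formsL A 1) (formsR A 1))).liftQ (formsb A M 0) (by
    rintro _ ⟨t, rfl⟩
    exact formsb_commutator A M t)

/-- The differential `♮d_M(m ⊗_H a) = ♮(m ⊗_H da)`. -/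
def xd : HTens M A.toHRep →ₗ[k] OneFormsNatural A M :=
  Submodule.mkQ _ ∘ₗ HTens.map (formsD A 0)

/-- The spaces of the equivariant `X`-complex: `M ⊗_H A` in degree `0`, `Ω_H^1(A, M)_♮` in
degree `1`, and `0` in the other degrees. -/
abbrev xObj : ℕ → ModuleCat.{max x w} k
  | 0 => ModuleCat.of k (HTens M A.toHRep)
  | 1 => ModuleCat.of k (OneFormsNatural A M)
  | _ + 2 => ModuleCat.of k PUnit

/-- The equivariant `X`-complex `X_H(A, M)`. A super complex with two components is the same as a
mixed complex concentrated in degrees `0` and `1`. -/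
abbrev xMixed : MixedData.{u, max x w} k where
  obj n := xObj A M n
  b
    | 0 => xb A M
    | _ + 1 => 0
  B
    | 0 => xd A M
    | _ + 1 => 0

/-- The canonical projection of `(Ω_H(A, M), b, B)` onto `X_H(A, M)`: the identity in degree `0`
and `♮` in degree `1`. -/
def formsToX : ∀ n, (formsMixed A M).obj n →ₗ[k] (xMixed A M).obj n
  | 0 => LinearMap.id
  | 1 => Submodule.mkQ (LinearMap.range (commutator A M (formsL A 1) (formsR A 1)))
  | _ + 2 => 0

/-- The canonical map from the mixed complex of the cyclic module to `X_H(A, M)`: the identity in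
degree `0` and `m ⊗_H (a ⊗ b) ↦ ♮(m ⊗_H a db)` in degree `1`. -/
def cycToX : ∀ n, (cycMixed A M).obj n →ₗ[k] (xMixed A M).obj n
  | 0 => LinearMap.id
  | 1 => Submodule.mkQ (LinearMap.range (commutator A M (formsL A 1) (formsR A 1))) ∘ₗ
      HTens.map ((Hom.id A.toHRep).tmap A.mkBar)
  | _ + 2 => 0

end XComplex

section FreeBar

variable {k : Type u} {H : Type v} [Field k] [Ring H] [HopfAlgebra k H]

open HRep

/-- The augmentation ideal `F̄ = ⨁_{n ≥ 1} V^{⊗n}` of `F = T(V)`. -/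
abbrev freeBar (V : HRep.{u, v, w} k H) : HRep.{u, v, max u w} k H :=
  (freeAlg V).toHRep.subMod (LinearMap.ker (TensorAlgebra.algebraMapInv (R := k) (M := V)).toLinearMap)
    (fun h f hf => by
      have e : TensorAlgebra.algebraMapInv f = 0 := hf
      change TensorAlgebra.algebraMapInv (freeAct V h f) = 0
      rw [algebraMapInv_freeAct, e, mul_zero])

/-- The inclusion `F̄ → F`. -/
def freeBarIncl (V : HRep.{u, v, w} k H) : Hom (freeBar V) (freeAlg V).toHRep where
  lin := Submodule.subtype _
  comm _ _ := rfl

/-- The left multiplication `F ⊗ F̄ → F̄`. -/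
def freeBarL (V : HRep.{u, v, w} k H) :
    Hom (tens (freeAlg V).toHRep (freeBar V)) (freeBar V) where
  lin := ((freeAlg V).mul.comp ((Hom.id _).tmap (freeBarIncl V))).lin.codRestrict _ (fun t => by
    induction t using TensorProduct.induction_on with
    | zero => rw [map_zero]; exact Submodule.zero_mem _
    | add a b ha hb => rw [map_add]; exact Submodule.add_mem _ ha hb
    | tmul a b =>
      have e : TensorAlgebra.algebraMapInv b.1 = 0 := b.2
      change TensorAlgebra.algebraMapInv (a * b.1) = 0
      rw [map_mul, e, mul_zero])
  comm h t := Subtype.ext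
    (((freeAlg V).mul.comp ((Hom.id _).tmap (freeBarIncl V))).comm h t)

/-- The right multiplication `F̄ ⊗ F → F̄`. -/
def freeBarR (V : HRep.{u, v, w} k H) :
    Hom (tens (freeBar V) (freeAlg V).toHRep) (freeBar V) where
  lin := ((freeAlg V).mul.comp ((freeBarIncl V).tmap (Hom.id _))).lin.codRestrict _ (fun t => by
    induction t using TensorProduct.induction_on with
    | zero => rw [map_zero]; exact Submodule.zero_mem _
    | add a b ha hb => rw [map_add]; exact Submodule.add_mem _ ha hb
    | tmul a b =>
      have e : TensorAlgebra.algebraMapInv a.1 = 0 := a.2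
      change TensorAlgebra.algebraMapInv (a.1 * b) = 0
      rw [map_mul, e, zero_mul])
  comm h t := Subtype.ext
    (((freeAlg V).mul.comp ((freeBarIncl V).tmap (Hom.id _))).comm h t)

end FreeBar

end HopfCyc

end

open HopfCyc

/-! The argument is the Cuntz–Quillen theory of quasi-free algebras, carried out inside `M ⊗_H -`.

All the Hopf-algebraic difficulty sits in the twisted flip `HTens.swap`. It is natural, compatible
with tensor products (`HTens.swap_swap`), and, by stability, its two instances are mutually inverse
(`HTens.swap_swap_self`). With these three facts the flip acts as a cyclic trace. Identities on `M
⊗_H A^{⊗n}` then reduce to identities between `H`-linear maps of tensor powers, checked on pure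
tensors without Sweedler notation. Up to sign, both Hochschild differentials are the twisted
commutator of a left multiplication and a signed right multiplication. This gives `b² = 0`
(`IsBimod.commutator_commutator`); the cyclic relations give the rest of the mixed structure, and
the forms inherit it as a quotient of the cyclic module.

Vanishing above degree `1`: the free algebra `F` is quasi-free, since there is an `H`-linear `φ : F
→ F^{⊗3}` with `φ(ab) = aφ(b) + φ(a)b + 1 ⊗ a ⊗ b` (`freeCochain`). It is built by recursion on
words from `φ(v) = 1 ⊗ v ⊗ 1`. The map `x ⊗ b ↦ xφ(b)` is a connection `∇`. Extended to all higher
degrees it satisfies `b∇ + ∇b = -1` in degrees at least `2` (`cycConn_homotopy`,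
`formsConn_homotopy`). The degree `1` term of the `X`-complex is the cokernel of `b`, so the
projections onto it are quasi-isomorphisms. They are surjective with `b`-acyclic kernel. In that
kernel `(b + B)z = x` can be solved degree by degree, which gives the statement on products
(`MixedData.IsQuasiIso.isSuperQuasiIso`).

Reduced cyclic homology: cutting words, `v₁⋯vₙ ↦ ∑ v₁⋯vᵢ ⊗ vᵢ₊₁⋯vₙ`, is a double derivation `δ`
whose contraction `D` multiplies a word by its length. A Cartan formula `L_D ≡ d ι_D + δ b` modulo
boundaries (`lieTwo_homotopy`) and the invertibility of positive integers in characteristic zero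
show that `B` maps reduced Hochschild homology of degree `0` bijectively onto that of degree `1`.
Together with the vanishing above degree `1` this kills the reduced cyclic homology in positive
degrees (`MixedData.HC_subsingleton`). In degree `0` it is the quotient of `M ⊗_H F` by commutators
and scalars. Splitting `F = k ⊕ F̄` identifies this with `(M ⊗_H F̄)_♮`, because commutators with
scalars vanish. -/

noncomputable section

namespace HopfCyc

open HRep

set_option linter.unusedSectionVars false

/-! ### `H`-linear maps and the functor `M ⊗_H -`. -/

section HomBasics

variable {k : Type u} {H : Type v} [Field k] [Ring H] [HopfAlgebra k H]

namespace HRep.Hom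

variable {X Y Z : HRep.{u, v, w} k H}

theorem ext_lin {f g : Hom X Y} (h : f.lin = g.lin) : f = g := by
  cases f; cases g; cases h; rfl

/-- Sum `f + g`. -/
def add (f g : Hom X Y) : Hom X Y :=
  ⟨f.lin + g.lin, fun h x => by simp [f.comm, g.comm]⟩

end HRep.Hom

end HomBasics

namespace HTens

section

variable {k : Type u} {H : Type v} {M : Type x} [Field k] [Ring H] [HopfAlgebra k H]
  [AddCommGroup M] [Module k M] [Module Hᵐᵒᵖ M] [IsScalarTower k Hᵐᵒᵖ M]
  {X Y Z W : HRep.{u, v, w} k H}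

theorem ind {p : HTens M X → Prop} (h0 : p 0) (ha : ∀ s t, p s → p t → p (s + t))
    (hm : ∀ m x, p (mk X m x)) (t : HTens M X) : p t := by
  obtain ⟨t, rfl⟩ := Submodule.mkQ_surjective _ t
  induction t using TensorProduct.induction_on with
  | zero => rwa [map_zero]
  | add a b hha hb => rw [map_add]; exact ha _ _ hha hb
  | tmul m y => exact hm m y

theorem map_congr {f g : Hom X Y} (h : f.lin = g.lin) (t : HTens M X) : map f t = map g t := by
  rw [Hom.ext_lin h]

theorem map_id (t : HTens M X) : map (Hom.id X) t = t :=
  LinearMap.congr_fun (f := map (Hom.id X)) (g := LinearMap.id)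
    (hom_ext fun m y => by rw [map_mk]; rfl) t

theorem map_sub_hom (f g : Hom X Y) (t : HTens M X) : map (f.sub g) t = map f t - map g t :=
  LinearMap.congr_fun (f := map (f.sub g)) (g := map f - map g)
    (hom_ext fun m y => by
      rw [LinearMap.sub_apply, map_mk, map_mk, map_mk, ← map_sub]; rfl) t

theorem map_add_hom (f g : Hom X Y) (t : HTens M X) : map (f.add g) t = map f t + map g t :=
  LinearMap.congr_fun (f := map (f.add g)) (g := map f + map g)
    (hom_ext fun m y => by
      rw [LinearMap.add_apply, map_mk, map_mk, map_mk, ← map_add]; rfl) t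

/-- The linear relation `f = g + c h` between `H`-linear maps passes to `M ⊗_H -`. -/
theorem map_eq_add_smul {f g h : Hom X Y} (c : k) (e : f.lin = g.lin + c • h.lin)
    (t : HTens M X) : map f t = map g t + c • map h t :=
  LinearMap.congr_fun (f := map f) (g := map g + c • map h)
    (hom_ext fun m y => by
      rw [LinearMap.add_apply, LinearMap.smul_apply, map_mk, map_mk, map_mk, e, ← map_smul,
        ← map_add]; rfl) t

theorem map_surjective {f : Hom X Y} (hf : Function.Surjective f.lin) :
    Function.Surjective (map (M := M) f) := by
  intro t
  induction t using ind with
  | h0 => exact ⟨0, map_zero _⟩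
  | ha s t hs ht =>
    obtain ⟨s, rfl⟩ := hs
    obtain ⟨t, rfl⟩ := ht
    exact ⟨s + t, map_add _ _ _⟩
  | hm m x =>
    obtain ⟨x, rfl⟩ := hf x
    exact ⟨mk _ m x, map_mk _ _ _⟩

end

end HTens

/-! ### Stability and the involutivity of the twisted flip. -/

section Stability

variable (k : Type u) {H : Type v} {M : Type x} [Field k] [Ring H] [HopfAlgebra k H]
  [AddCommGroup M] [Module k M] [Module Hᵐᵒᵖ M] [IsScalarTower k Hᵐᵒᵖ M]
  [LeftComodule k H M] [InvertibleAntipode k H] [IsSAYD k H M]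

/-- `m⁽⁰⁾ S⁻¹(m⁽⁻¹⁾) = m`. -/
theorem stable_antipodeInv (m : M) :
    TensorProduct.lift (ract k H M ∘ₗ antipodeInv k) (LeftComodule.coact m) = m := by
  let Θ : H ⊗[k] (H ⊗[k] M) →ₗ[k] M :=
    TensorProduct.lift ((LinearMap.lcomp k M (TensorProduct.lift (ract k H M))) ∘ₗ
      ract k H M ∘ₗ antipodeInv k)
  -- Stability is applied to `m⁽⁰⁾`, so that the left side becomes `m⁽⁰⁾ m⁽⁻¹⁾ S⁻¹(m⁽⁻²⁾)`.
  have h1 : ∀ w : H ⊗[k] M, TensorProduct.lift (ract k H M ∘ₗ antipodeInv k) w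
      = Θ ((LeftComodule.coact (k := k) (H := H)).lTensor H w) := by
    intro w
    induction w with
    | zero => simp only [map_zero]
    | add a b ha hb => simp only [map_add, ha, hb]
    | tmul g m =>
      rw [LinearMap.lTensor_tmul]
      change ract k H M (antipodeInv k g) m = ract k H M (antipodeInv k g)
        (TensorProduct.lift (ract k H M) (LeftComodule.coact m))
      rw [IsSAYD.stable]
  -- After coassociativity the two group-like factors belong to one comultiplied element, and `h⁽²⁾
  -- S⁻¹(h⁽¹⁾) = ε(h)` removes them.
  have h2 : ∀ w : H ⊗[k] M,
      Θ (TensorProduct.assoc k H H M ((Coalgebra.comul (R := k)).rTensor M w))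
      = TensorProduct.lid k M ((Coalgebra.counit (R := k)).rTensor M w) := by
    intro w
    induction w with
    | zero => simp only [map_zero]
    | add a b ha hb => simp only [map_add, ha, hb]
    | tmul g m =>
      rw [LinearMap.rTensor_tmul, LinearMap.rTensor_tmul, TensorProduct.lid_tmul]
      have h3 : ∀ z : H ⊗[k] H, Θ (TensorProduct.assoc k H H M (z ⊗ₜ m))
          = ract k H M (LinearMap.mul' k H (TensorProduct.comm k H H
              ((antipodeInv k).rTensor H z))) m := by
        intro z
        induction z with
        | zero => simp only [map_zero, TensorProduct.zero_tmul, LinearMap.zero_apply]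
        | add a b ha hb =>
          simp only [map_add, TensorProduct.add_tmul, LinearMap.add_apply, ha, hb]
        | tmul a b =>
          change MulOpposite.op (antipodeInv k a) • MulOpposite.op b • m
            = MulOpposite.op (b * antipodeInv k a) • m
          rw [smul_smul, MulOpposite.op_mul]
      rw [h3, mul_antipodeInv_comul, ract_apply, ← MulOpposite.algebraMap_apply,
        algebraMap_smul]
  rw [h1, ← LeftComodule.coassoc, h2, LeftComodule.counit_coact]

end Stability

namespace HTens

variable {k : Type u} {H : Type v} {M : Type x} [Field k] [Ring H] [HopfAlgebra k H]
  [AddCommGroup M] [Module k M] [Module Hᵐᵒᵖ M] [IsScalarTower k Hᵐᵒᵖ M]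
  [LeftComodule k H M] [InvertibleAntipode k H] [IsSAYD k H M]

/-- The twisted flips are inverse to each other. -/
theorem swap_swap_self (X Y : HRep.{u, v, w} k H) (t : HTens M (tens X Y)) :
    swap Y X (swap X Y t) = t := by
  refine LinearMap.congr_fun (f := swap Y X ∘ₗ swap X Y) (g := LinearMap.id)
    (hom_ext fun m t => ?_) t
  change swap Y X (swap X Y (mk _ m t)) = mk _ m t
  rw [swap_mk]
  induction t using TensorProduct.induction_on with
  | zero => simp only [map_zero]
  | add a b ha hb => simp only [map_add, ha, hb]
  | tmul x y =>
  let Θ : H ⊗[k] (H ⊗[k] M) →ₗ[k] HTens M (tens X Y) :=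
    TensorProduct.lift ((swapAux Y X).flip ∘ₗ
      (TensorProduct.mk k Y X).flip x ∘ₗ Y.act.toLinearMap.flip y ∘ₗ antipodeInv k)
  have h1 : ∀ w : H ⊗[k] M, swap Y X (swapAux X Y w (x ⊗ₜ y))
      = Θ ((LeftComodule.coact (k := k) (H := H)).lTensor H w) := by
    intro w
    induction w with
    | zero => simp only [map_zero, LinearMap.zero_apply]
    | add a b ha hb => simp only [map_add, LinearMap.add_apply, ha, hb]
    | tmul g m =>
      rw [swapAux_tmul, swap_mk]
      rfl
  -- Since `S⁻¹` reverses the comultiplication, the two twists combine into the diagonal action of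
  -- `S⁻¹(m⁽⁻¹⁾)` on `x ⊗ y`. This moves across `⊗_H` onto `m⁽⁰⁾`, where stability absorbs it.
  have h2 : ∀ w : H ⊗[k] M,
      Θ (TensorProduct.assoc k H H M ((Coalgebra.comul (R := k)).rTensor M w))
      = mk (tens X Y) (TensorProduct.lift (ract k H M ∘ₗ antipodeInv k) w) (x ⊗ₜ y) := by
    intro w
    induction w with
    | zero => simp only [map_zero, LinearMap.zero_apply]
    | add a b ha hb => simp only [map_add, LinearMap.add_apply, ha, hb]
    | tmul g m =>
      have e : TensorProduct.lift (ract k H M ∘ₗ antipodeInv k) (g ⊗ₜ[k] m)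
        = MulOpposite.op (antipodeInv k g) • m := rfl
      rw [e, mk_smul, tens_act, comul_antipodeInv, LinearMap.rTensor_tmul]
      induction Coalgebra.comul (R := k) g with
      | zero => simp only [map_zero, TensorProduct.zero_tmul]
      | add a b ha hb => simp only [map_add, TensorProduct.add_tmul, ha, hb]
      | tmul a b => rfl
  rw [h1, ← LeftComodule.coassoc, h2, stable_antipodeInv]

end HTens

/-! ### Bimodules, twisted commutators and the source of `b² = 0`. -/

section Bimodules

variable {k : Type u} {H : Type v} [Field k] [Ring H] [HopfAlgebra k H]

theorem tensor_ext_right {X Y Z T : Type*} [AddCommGroup X] [Module k X] [AddCommGroup Y]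
    [Module k Y] [AddCommGroup Z] [Module k Z] [AddCommGroup T] [Module k T]
    {f g : X ⊗[k] (Y ⊗[k] Z) →ₗ[k] T} (h : ∀ x y z, f (x ⊗ₜ (y ⊗ₜ z)) = g (x ⊗ₜ (y ⊗ₜ z))) :
    f = g := by
  ext x y z
  exact h x y z

/-- Associativity of a left and a (possibly non-unital) right multiplication. -/
structure IsBimod (A : HAlg.{u, v, w} k H) {X : HRep.{u, v, w} k H}
    (l : Hom (tens A.toHRep X) X) (r : Hom (tens X A.toHRep) X) : Prop where
  left (a b : A) (x : X) : l.lin (a ⊗ₜ l.lin (b ⊗ₜ x)) = l.lin ((a * b) ⊗ₜ x)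
  mid (a b : A) (x : X) : r.lin (l.lin (a ⊗ₜ x) ⊗ₜ b) = l.lin (a ⊗ₜ r.lin (x ⊗ₜ b))
  right (a b : A) (x : X) : r.lin (r.lin (x ⊗ₜ a) ⊗ₜ b) = r.lin (x ⊗ₜ (a * b))

variable (A : HAlg.{u, v, w} k H)

/-- The left multiplication `a ⊗ (x ⊗ y) ↦ ax ⊗ y` on `X ⊗ Y`. -/
def tensL {X : HRep.{u, v, w} k H} (l : Hom (tens A.toHRep X) X) (Y : HRep.{u, v, w} k H) :
    Hom (tens A.toHRep (tens X Y)) (tens X Y) :=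
  (l.tmap (Hom.id Y)).comp (assocInv A.toHRep X Y)

/-- The right multiplication `(x ⊗ a) ⊗ b ↦ x ⊗ ab - xa ⊗ b` on `X ⊗ A`. -/
def tensR {X : HRep.{u, v, w} k H} (r : Hom (tens X A.toHRep) X) :
    Hom (tens (tens X A.toHRep) A.toHRep) (tens X A.toHRep) :=
  (((Hom.id X).tmap A.mul).comp (assoc X A.toHRep A.toHRep)).sub (r.tmap (Hom.id A.toHRep))

variable {A}

theorem tensL_tmul {X Y : HRep.{u, v, w} k H} (l : Hom (tens A.toHRep X) X) (a : A) (x : X)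
    (y : Y) : (tensL A l Y).lin (a ⊗ₜ (x ⊗ₜ y)) = l.lin (a ⊗ₜ x) ⊗ₜ y := rfl

theorem tensR_tmul {X : HRep.{u, v, w} k H} (r : Hom (tens X A.toHRep) X) (x : X) (a b : A) :
    (tensR A r).lin ((x ⊗ₜ a) ⊗ₜ b) = x ⊗ₜ (a * b) - r.lin (x ⊗ₜ a) ⊗ₜ b := rfl

/-- The right multiplication imitates `(x da)b = x d(ab) - xa db`. The structure is not unital,
since `(x ⊗ a)1 = x ⊗ a - xa ⊗ 1`, which is why no unit axiom is part of `IsBimod`. -/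
theorem IsBimod.tens {X : HRep.{u, v, w} k H} {l : Hom (tens A.toHRep X) X}
    {r : Hom (tens X A.toHRep) X} (hX : IsBimod A l r) :
    IsBimod A (tensL A l A.toHRep) (tensR A r) where
  left a b x := by
    induction x using TensorProduct.induction_on with
    | zero => simp only [TensorProduct.tmul_zero, map_zero]
    | add y z hy hz => simp only [TensorProduct.tmul_add, map_add, hy, hz]
    | tmul y c => rw [tensL_tmul, tensL_tmul, tensL_tmul, hX.left]
  mid a b x := by
    induction x using TensorProduct.induction_on with
    | zero => simp only [TensorProduct.tmul_zero, TensorProduct.zero_tmul, map_zero]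
    | add y z hy hz =>
      simp only [TensorProduct.tmul_add, TensorProduct.add_tmul, map_add, hy, hz]
    | tmul y c =>
      rw [tensL_tmul, tensR_tmul, tensR_tmul, TensorProduct.tmul_sub, map_sub, tensL_tmul,
        tensL_tmul, hX.mid]
  right a b x := by
    induction x using TensorProduct.induction_on with
    | zero => simp only [TensorProduct.zero_tmul, map_zero]
    | add y z hy hz => simp only [TensorProduct.add_tmul, map_add, hy, hz]
    | tmul y c =>
      rw [tensR_tmul, tensR_tmul, TensorProduct.sub_tmul, map_sub, tensR_tmul, tensR_tmul,
        hX.right, mul_assoc]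
      abel

variable {M : Type x} [AddCommGroup M] [Module k M] [Module Hᵐᵒᵖ M] [IsScalarTower k Hᵐᵒᵖ M]
  [LeftComodule k H M] [InvertibleAntipode k H] [IsSAYD k H M]

theorem commutator_apply {X : HRep.{u, v, w} k H} (l : Hom (tens A.toHRep X) X)
    (r : Hom (tens X A.toHRep) X) (t : HTens M (tens X A.toHRep)) :
    commutator A M l r t = HTens.map r t - HTens.map l (HTens.swap X A.toHRep t) := rfl

/-- A map of bimodules commutes with the twisted commutators. -/
theorem map_commutator {X Y : HRep.{u, v, w} k H} {l : Hom (tens A.toHRep X) X}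
    {r : Hom (tens X A.toHRep) X} {l' : Hom (tens A.toHRep Y) Y} {r' : Hom (tens Y A.toHRep) Y}
    (f : Hom X Y) (hl : ∀ a x, f.lin (l.lin (a ⊗ₜ x)) = l'.lin (a ⊗ₜ f.lin x))
    (hr : ∀ x a, f.lin (r.lin (x ⊗ₜ a)) = r'.lin (f.lin x ⊗ₜ a))
    (t : HTens M (tens X A.toHRep)) : HTens.map f (commutator A M l r t)
      = commutator A M l' r' (HTens.map (f.tmap (Hom.id A.toHRep)) t) := by
  rw [commutator_apply, commutator_apply, HTens.swap_map, map_sub, ← HTens.map_comp,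
    ← HTens.map_comp, ← HTens.map_comp, ← HTens.map_comp]
  congr 1
  · exact HTens.map_congr (TensorProduct.ext' fun x a => hr x a) _
  · exact HTens.map_congr (TensorProduct.ext' fun a x => hl a x) _

/-- This is `b² = 0` for every complex used below. Of the four terms, right-right vanishes by
associativity of the right action, right-left is rewritten by the middle associativity, and
left-left by combining two flips. The last two cancel the two halves of the mixed term coming from
`tensR`. -/
theorem IsBimod.commutator_commutator {X : HRep.{u, v, w} k H} {l : Hom (HRep.tens A.toHRep X) X}
    {r : Hom (HRep.tens X A.toHRep) X} (hX : IsBimod A l r)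
    (t : HTens M (HRep.tens (HRep.tens X A.toHRep) A.toHRep)) :
    commutator A M l r (commutator A M (tensL A l A.toHRep) (tensR A r) t) = 0 := by
  have e1 : HTens.map r (HTens.map (tensR A r) t) = 0 := by
    rw [tensR, HTens.map_sub_hom, map_sub, ← HTens.map_comp, ← HTens.map_comp, sub_eq_zero]
    exact HTens.map_congr (TensorProduct.ext_threefold fun x a b => (hX.right a b x).symm) _
  have e2 : HTens.map r (HTens.map (tensL A l A.toHRep) (HTens.swap _ A.toHRep t))
      = HTens.map l (HTens.swap X A.toHRep (HTens.map (r.tmap (Hom.id A.toHRep)) t)) := by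
    rw [HTens.swap_map, ← HTens.map_comp, ← HTens.map_comp]
    exact HTens.map_congr (tensor_ext_right fun b x a => hX.mid b a x) _
  -- Flipping two letters to the front one after the other equals flipping their tensor product at
  -- once, by `HTens.swap_swap`; here the two letters are then multiplied.
  have e3 : HTens.map l (HTens.swap X A.toHRep (HTens.map (tensL A l A.toHRep)
        (HTens.swap _ A.toHRep t)))
      = HTens.map l (HTens.swap X A.toHRep (HTens.map (((Hom.id X).tmap A.mul).comp
          (assoc X A.toHRep A.toHRep)) t)) := by
    rw [tensL, HTens.map_comp, HTens.swap_map, ← HTens.swap_swap, HTens.map_comp, HTens.swap_map,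
      ← HTens.map_comp, ← HTens.map_comp, ← HTens.map_comp]
    exact HTens.map_congr (TensorProduct.ext_threefold fun b a x => hX.left b a x) _
  rw [commutator_apply, commutator_apply, map_sub, map_sub, map_sub, e1, e2, e3, tensR,
    HTens.map_sub_hom, map_sub, map_sub]
  abel

end Bimodules

/-! ### The Hochschild differential of the cyclic module as a twisted commutator. -/

section CyclicBimodule

variable {k : Type u} {H : Type v} [Field k] [Ring H] [HopfAlgebra k H]
  (A : HAlg.{u, v, w} k H)

/-- The left multiplication `a ⊗ (a₀ ⊗ ⋯ ⊗ aₙ) ↦ aa₀ ⊗ ⋯ ⊗ aₙ`. -/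
def cycL : ∀ n, Hom (tens A.toHRep (tpow A n)) (tpow A n)
  | 0 => A.mul
  | n + 1 => tensL A (cycL n) A.toHRep

/-- The right multiplication `(a₀ ⊗ ⋯ ⊗ aₙ) ⊗ a ↦ ∑ᵢ (-1)ⁿ⁻ⁱ a₀ ⊗ ⋯ ⊗ aᵢaᵢ₊₁ ⊗ ⋯ ⊗ a`. -/
def cycR : ∀ n, Hom (tens (tpow A n) A.toHRep) (tpow A n)
  | 0 => A.mul
  | n + 1 => tensR A (cycR n)

theorem mul_isBimod : IsBimod A A.mul A.mul where
  left a b x := (mul_assoc (a : A) b x).symm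
  mid a b x := mul_assoc (a : A) x b
  right a b x := mul_assoc (x : A) a b

theorem cyc_isBimod (n : ℕ) : IsBimod A (cycL A n) (cycR A n) := by
  induction n with
  | zero => exact mul_isBimod A
  | succ n ih => exact ih.tens

theorem cycL_one (n : ℕ) (x : tpow A n) : (cycL A n).lin ((1 : A) ⊗ₜ x) = x := by
  induction n with
  | zero => exact one_mul (x : A)
  | succ n ih =>
    induction x using TensorProduct.induction_on with
    | zero => rw [TensorProduct.tmul_zero, map_zero]
    | add a b ha hb => rw [TensorProduct.tmul_add, map_add, ha, hb]
    | tmul x a => exact congrArg (· ⊗ₜ[k] a) (ih x)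

theorem face_last (n : ℕ) : face A (n + 1) (n + 1)
    = ((Hom.id (tpow A n)).tmap A.mul).comp (assoc (tpow A n) A.toHRep A.toHRep) := if_pos rfl

theorem face_of_ne {n i : ℕ} (h : i ≠ n + 1) :
    face A (n + 1) i = (face A n i).tmap (Hom.id A.toHRep) := if_neg h

theorem face_zero_cons (n : ℕ) (a : A) (x : tpow A n) :
    (face A n 0).lin ((cons A n).lin (a ⊗ₜ x)) = (cycL A n).lin (a ⊗ₜ x) := by
  induction n with
  | zero => rfl
  | succ n ih =>
    rw [face_of_ne A (Nat.succ_ne_zero n).symm]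
    induction x using TensorProduct.induction_on with
    | zero => simp only [TensorProduct.tmul_zero, map_zero]
    | add y z hy hz => simp only [TensorProduct.tmul_add, map_add, hy, hz]
    | tmul x b => exact congrArg (· ⊗ₜ[k] b) (ih x)

/-- Faces not touching the first letter do not see it. Both the commutation of faces with `τ` and
the contraction by the extra degeneracy rest on this. -/
theorem face_succ_cons (n : ℕ) : ∀ j ≤ n, ∀ (a : A) (x : tpow A (n + 1)),
    (face A (n + 1) (j + 1)).lin ((cons A (n + 1)).lin (a ⊗ₜ x))
      = (cons A n).lin (a ⊗ₜ (face A n j).lin x) := by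
  induction n with
  | zero =>
    intro j hj a x
    obtain rfl : j = 0 := by omega
    induction x using TensorProduct.induction_on with
    | zero => simp only [TensorProduct.tmul_zero, map_zero]
    | add y z hy hz => simp only [TensorProduct.tmul_add, map_add, hy, hz]
    | tmul x b => rfl
  | succ n ih =>
    intro j hj a x
    induction x using TensorProduct.induction_on with
    | zero => simp only [TensorProduct.tmul_zero, map_zero]
    | add y z hy hz => simp only [TensorProduct.tmul_add, map_add, hy, hz]
    | tmul x b =>
      rcases Nat.lt_or_ge n j with h | h
      · obtain rfl : j = n + 1 := by omega
        rw [face_last, face_last]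
        induction x using TensorProduct.induction_on with
        | zero => simp only [TensorProduct.zero_tmul, TensorProduct.tmul_zero, map_zero]
        | add y z hy hz =>
          simp only [TensorProduct.add_tmul, TensorProduct.tmul_add, map_add, hy, hz]
        | tmul x c => rfl
      · rw [face_of_ne A (i := j + 1) (by omega), face_of_ne A (i := j) (by omega)]
        exact congrArg (· ⊗ₜ[k] b) (ih j h a x)

variable {A}
variable {M : Type x} [AddCommGroup M] [Module k M] [Module Hᵐᵒᵖ M] [IsScalarTower k Hᵐᵒᵖ M]

/-- The recursion `xa ⊗ b` versus `x ⊗ ab` defining `cycR` is the recursion that splits off the last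
inner face; the sign `(-1)ⁿ` comes from normalising the last face to sign `+1`. -/
theorem sum_face_lin (n : ℕ) (x : tpow A (n + 1)) :
    ∑ i ∈ Finset.range (n + 1), (-1 : k) ^ i • (face A n i).lin x
      = (-1 : k) ^ n • (cycR A n).lin x := by
  induction n with
  | zero =>
    rw [Finset.sum_range_one]
    rfl
  | succ n ih =>
    rw [Finset.sum_range_succ, face_last]
    have e : ∀ i ∈ Finset.range (n + 1), (-1 : k) ^ i • (face A (n + 1) i).lin x
        = (-1 : k) ^ i • ((face A n i).tmap (Hom.id A.toHRep)).lin x := fun i hi => by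
      rw [face_of_ne A (Finset.mem_range.1 hi).ne]
    rw [Finset.sum_congr rfl e]
    induction x using TensorProduct.induction_on with
    | zero => simp only [map_zero, smul_zero, Finset.sum_const_zero, add_zero]
    | add y z hy hz =>
      have hy := hy fun i hi => by rw [face_of_ne A (Finset.mem_range.1 hi).ne]
      have hz := hz fun i hi => by rw [face_of_ne A (Finset.mem_range.1 hi).ne]
      simp only [map_add, smul_add, Finset.sum_add_distrib] at hy hz ⊢
      rw [← hy, ← hz]
      abel
    | tmul x b =>
      have e2 : ∀ i, (-1 : k) ^ i • ((face A n i).tmap (Hom.id A.toHRep)).lin (x ⊗ₜ b)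
          = ((-1 : k) ^ i • (face A n i).lin x) ⊗ₜ[k] b := fun i => TensorProduct.smul_tmul' _ _ _
      simp only [e2]
      rw [← TensorProduct.sum_tmul, ih, ← TensorProduct.smul_tmul']
      have e3 : (cycR A (n + 1)).lin (x ⊗ₜ b) = (((Hom.id (tpow A n)).tmap A.mul).comp
          (assoc (tpow A n) A.toHRep A.toHRep)).lin (x ⊗ₜ b) - (cycR A n).lin x ⊗ₜ[k] b := rfl
      rw [e3, pow_succ]
      module

theorem sum_face (n : ℕ) (t : HTens M (tpow A (n + 1))) :
    ∑ i ∈ Finset.range (n + 1), (-1 : k) ^ i • HTens.map (face A n i) t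
      = (-1 : k) ^ n • HTens.map (cycR A n) t := by
  induction t using HTens.ind with
  | h0 => simp only [map_zero, smul_zero, Finset.sum_const_zero]
  | ha s t hs ht => simp only [map_add, smul_add, Finset.sum_add_distrib, hs, ht]
  | hm m y =>
    have e : ∀ i ∈ Finset.range (n + 1),
        (-1 : k) ^ i • HTens.map (face A n i) (HTens.mk (tpow A (n + 1)) m y)
        = HTens.mk (tpow A n) m ((-1 : k) ^ i • (face A n i).lin y) := fun i _ => by
      rw [HTens.map_mk, map_smul]
    rw [Finset.sum_congr rfl e, ← map_sum, sum_face_lin, HTens.map_mk, map_smul]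

variable [LeftComodule k H M] [InvertibleAntipode k H] [IsSAYD k H M]

/-- The inner faces assemble to the right multiplication, and the last face is the left
multiplication after a flip, since the first product taken after `cons` is `cycL`. -/
theorem cycb_apply (n : ℕ) (t : HTens M (tpow A (n + 1))) :
    cycb A M n t = (-1 : k) ^ n • commutator A M (cycL A n) (cycR A n) t := by
  rw [cycb, LinearMap.add_apply, LinearMap.sum_apply]
  simp only [LinearMap.smul_apply]
  rw [sum_face, commutator_apply, LinearMap.comp_apply, tau, LinearMap.comp_apply,
    ← HTens.map_comp, HTens.map_congr (f := (face A n 0).comp (cons A n)) (g := cycL A n)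
      (TensorProduct.ext' fun a x => face_zero_cons A n a x), pow_succ]
  module

theorem cycb_cycb (n : ℕ) (t : HTens M (tpow A (n + 1 + 1))) :
    cycb A M n (cycb A M (n + 1) t) = 0 := by
  rw [cycb_apply, cycb_apply, map_smul]
  have := (cyc_isBimod A n).commutator_commutator (M := M) t
  rw [show commutator A M (cycL A n) (cycR A n)
    (commutator A M (cycL A (n + 1)) (cycR A (n + 1)) t) = 0 from this, smul_zero, smul_zero]

end CyclicBimodule

/-! ### The cyclic operator as a rotation: its order and its commutation with faces. -/

section Rotation

variable {k : Type u} {H : Type v} [Field k] [Ring H] [HopfAlgebra k H]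
  (A : HAlg.{u, v, w} k H)

/-- The concatenation `A^{⊗(n+1)} ⊗ A^{⊗(j+1)} → A^{⊗(N+2)}`, `N = n + j`. -/
def append (n : ℕ) : ∀ j N, n + j = N → Hom (tens (tpow A n) (tpow A j)) (tpow A (N + 1))
  | 0, N, h => by
      have e : n = N := h
      subst e
      exact Hom.id _
  | j + 1, 0, h => absurd h (Nat.succ_ne_zero (n + j))
  | j + 1, N + 1, h => ((append n j N (Nat.succ.inj h)).tmap (Hom.id A.toHRep)).comp
      (assocInv (tpow A n) (tpow A j) A.toHRep)

theorem append_succ_tmul (n j N : ℕ) (h : n + (j + 1) = N + 1) (x : tpow A n) (y : tpow A j)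
    (a : A) : (append A n (j + 1) (N + 1) h).lin (x ⊗ₜ (y ⊗ₜ a))
      = (append A n j N (Nat.succ.inj h)).lin (x ⊗ₜ y) ⊗ₜ[k] a := rfl

theorem append_zero_left (n : ℕ) (h : 0 + n = n) (a : A) (x : tpow A n) :
    (append A 0 n n h).lin (a ⊗ₜ x) = (cons A n).lin (a ⊗ₜ x) := by
  induction n with
  | zero => rfl
  | succ n ih =>
    induction x using TensorProduct.induction_on with
    | zero => simp only [TensorProduct.tmul_zero, map_zero]
    | add y z hy hz => simp only [TensorProduct.tmul_add, map_add, hy, hz]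
    | tmul x b =>
      have e := append_succ_tmul A 0 n n h a x b
      rw [ih (Nat.succ.inj h)] at e
      exact e

/-- Together with `append_cons` this is the bookkeeping for one rotation step: the letter leaving
the end of the second block enters at the front of the first. -/
theorem cons_append (n j : ℕ) : ∀ N (h : n + j = N) (h' : n + 1 + j = N + 1) (a : A)
    (x : tpow A n) (y : tpow A j), (cons A (N + 1)).lin (a ⊗ₜ (append A n j N h).lin (x ⊗ₜ y))
      = (append A (n + 1) j (N + 1) h').lin ((cons A n).lin (a ⊗ₜ x) ⊗ₜ y) := by
  induction j with
  | zero =>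
    intro N h h' a x y
    have e : n = N := h
    subst e
    rfl
  | succ j ih =>
    intro N h h' a x y
    obtain _ | N := N
    · exact absurd h (Nat.succ_ne_zero (n + j))
    induction y using TensorProduct.induction_on with
    | zero => simp only [TensorProduct.tmul_zero, map_zero]
    | add y z hy hz => simp only [TensorProduct.tmul_add, map_add, hy, hz]
    | tmul y b =>
      exact congrArg (· ⊗ₜ[k] b) (ih N (Nat.succ.inj h) (Nat.succ.inj h') a x y)

theorem append_cons (j n : ℕ) : ∀ N (h : j + (n + 1) = N) (h' : j + 1 + n = N) (y : tpow A j)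
    (a : A) (x : tpow A n), (append A j (n + 1) N h).lin (y ⊗ₜ (cons A n).lin (a ⊗ₜ x))
      = (append A (j + 1) n N h').lin ((y ⊗ₜ a) ⊗ₜ x) := by
  induction n with
  | zero =>
    intro N h h' y a x
    have e : j + 1 = N := h
    subst e
    rfl
  | succ n ih =>
    intro N h h' y a x
    obtain _ | N := N
    · exact absurd h (Nat.succ_ne_zero _)
    induction x using TensorProduct.induction_on with
    | zero => simp only [TensorProduct.tmul_zero, map_zero]
    | add y z hy hz => simp only [TensorProduct.tmul_add, map_add, hy, hz]
    | tmul x b =>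
      exact congrArg (· ⊗ₜ[k] b) (ih N (Nat.succ.inj h) (Nat.succ.inj h') y a x)

theorem cycL_cons (n : ℕ) (a b : A) (x : tpow A n) :
    (cycL A (n + 1)).lin (a ⊗ₜ (cons A n).lin (b ⊗ₜ x)) = (cons A n).lin ((a * b) ⊗ₜ x) := by
  induction n with
  | zero => rfl
  | succ n ih =>
    induction x using TensorProduct.induction_on with
    | zero => simp only [TensorProduct.tmul_zero, map_zero]
    | add y z hy hz => simp only [TensorProduct.tmul_add, map_add, hy, hz]
    | tmul x c => exact congrArg (· ⊗ₜ[k] c) (ih x)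

variable {A}
variable {M : Type x} [AddCommGroup M] [Module k M] [Module Hᵐᵒᵖ M] [IsScalarTower k Hᵐᵒᵖ M]
  [LeftComodule k H M] [InvertibleAntipode k H] [IsSAYD k H M]

theorem tau_apply (n : ℕ) (t : HTens M (tpow A (n + 1))) :
    tau A M n t = HTens.map (cons A n) (HTens.swap (tpow A n) A.toHRep t) := rfl

/-- A power of the cyclic operator rotates a concatenation. -/
theorem tau_pow_append (j : ℕ) : ∀ (n N : ℕ) (h : n + j = N) (h' : j + n = N)
    (t : HTens M (tens (tpow A n) (tpow A j))),
    (tau A M N ^ (j + 1)) (HTens.map (append A n j N h) t)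
      = HTens.map (append A j n N h') (HTens.swap _ _ t) := by
  induction j with
  | zero =>
    intro n N h h' t
    have e : n = N := h
    subst e
    rw [zero_add, pow_one, tau_apply]
    refine (congrArg (fun z => HTens.map (cons A n) (HTens.swap (tpow A n) A.toHRep z))
      (HTens.map_id t)).trans ?_
    exact (HTens.map_congr
      (TensorProduct.ext' fun a x => append_zero_left A n h' a x) _).symm
  | succ j ih =>
    intro n N h h' t
    obtain _ | N := N
    · exact absurd h (Nat.succ_ne_zero _)
    have h1 : n + j = N := Nat.succ.inj h
    have h2 : n + 1 + j = N + 1 := by omega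
    have h3 : j + (n + 1) = N + 1 := by omega
    set s := HTens.map (assocInv (tpow A n) (tpow A j) A.toHRep) t with hs
    -- One application of `τ` shortens the second block by its last letter and lengthens the first.
    -- The induction hypothesis then rotates the remaining block, and `HTens.swap_swap` merges the
    -- two flips.
    have e1 : tau A M (N + 1) (HTens.map (append A n (j + 1) (N + 1) h) t)
        = HTens.map (append A (n + 1) j (N + 1) h2) (HTens.map ((cons A n).tmap (Hom.id _))
          (HTens.map (assocInv _ _ _) (HTens.swap _ A.toHRep s))) := by
      have e2 : HTens.map (append A n (j + 1) (N + 1) h) t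
          = HTens.map ((append A n j N h1).tmap (Hom.id A.toHRep)) s := HTens.map_comp _ _ _
      rw [e2, tau_apply]
      refine (congrArg _ (HTens.swap_map _ _ _)).trans ?_
      rw [← HTens.map_comp, ← HTens.map_comp, ← HTens.map_comp]
      exact HTens.map_congr (tensor_ext_right fun a x y => cons_append A n j N h1 h2 a x y) _
    rw [pow_succ, Module.End.mul_apply, e1, ih (n + 1) (N + 1) h2 h3, HTens.swap_map,
      ← HTens.swap_swap, hs, ← HTens.map_comp (assoc _ _ _)]
    have e3 : ∀ t : HTens M (tens (tpow A n) (tens (tpow A j) A.toHRep)),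
        HTens.map ((assoc (tpow A n) (tpow A j) A.toHRep).comp (assocInv _ _ _)) t = t :=
      fun t => (HTens.map_congr (g := Hom.id _)
        (LinearMap.ext fun y => (TensorProduct.assoc k _ _ _).apply_symm_apply y) t).trans
          (HTens.map_id t)
    rw [e3, ← HTens.map_comp, ← HTens.map_comp]
    exact HTens.map_congr
      (TensorProduct.ext_threefold fun y a x => append_cons A j n (N + 1) h3 h' y a x) _

/-- One `τ` is a flip of the block of length `n + 1` past a single letter. The remaining `n + 1`
applications flip that letter back past the block, and the two flips are inverse. Stability enters
only here, through `HTens.swap_swap_self`. -/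
theorem tau_pow (n : ℕ) : tau A M n ^ (n + 2) = 1 := by
  refine LinearMap.ext fun t => ?_
  have h := tau_pow_append n 0 n (zero_add n) (add_zero n) (HTens.swap (tpow A n) A.toHRep t)
  rw [HTens.swap_swap_self] at h
  rw [pow_succ, Module.End.mul_apply, tau_apply, ← HTens.map_congr (f := append A 0 n n (zero_add n))
    (TensorProduct.ext' fun a x => append_zero_left A n (zero_add n) a x)]
  exact h.trans (HTens.map_id t)

theorem face_succ_tau (n j : ℕ) (hj : j ≤ n) (t : HTens M (tpow A (n + 1 + 1))) :
    HTens.map (face A (n + 1) (j + 1)) (tau A M (n + 1) t)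
      = tau A M n (HTens.map (face A (n + 1) j) t) := by
  rw [tau_apply, tau_apply, face_of_ne A (i := j) (by omega), HTens.swap_map, ← HTens.map_comp,
    ← HTens.map_comp]
  exact HTens.map_congr (TensorProduct.ext' fun a x => face_succ_cons A n j hj a x) _

theorem face_zero_tau (n : ℕ) (t : HTens M (tpow A (n + 1))) :
    HTens.map (face A n 0) (tau A M n t) = HTens.map (cycL A n) (HTens.swap _ A.toHRep t) := by
  rw [tau_apply, ← HTens.map_comp]
  exact HTens.map_congr (TensorProduct.ext' fun a x => face_zero_cons A n a x) _

/-- With the last face written as `∂₀τ`, this is the relation `∂ᵢτ = τ∂ᵢ₋₁` for `i` the last index.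
Two successive flips bring the last two letters to the front, where they are multiplied. -/
theorem face_zero_tau_tau (n : ℕ) (t : HTens M (tpow A (n + 1 + 1))) :
    HTens.map (face A (n + 1) 0) (tau A M (n + 1) (tau A M (n + 1) t))
      = tau A M n (HTens.map (face A (n + 1) (n + 1)) t) := by
  have e1 : ∀ s : HTens M (tens A.toHRep (tpow A (n + 1))), HTens.map (cons A (n + 1)) s
      = HTens.map ((cons A n).tmap (Hom.id A.toHRep)) (HTens.map (assocInv _ _ _) s) :=
    fun s => HTens.map_comp _ _ _
  rw [face_zero_tau, tau_apply, e1, HTens.swap_map, tau_apply, face_last, HTens.map_comp,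
    HTens.swap_map]
  have e2 := HTens.swap_swap (tpow A n) A.toHRep A.toHRep t
  refine (congrArg (fun z => HTens.map (cycL A (n + 1)) (HTens.map ((Hom.id A.toHRep).tmap
    (cons A n)) z)) e2.symm).trans ?_
  rw [← HTens.map_comp, ← HTens.map_comp, ← HTens.map_comp]
  exact HTens.map_congr (TensorProduct.ext_threefold fun a b x => cycL_cons A n a b x) _

end Rotation

/-! ### Connes' operator identities, deduced abstractly from signed cyclic relations. -/

section NormOperators

variable {k : Type*} [Field k] {P Q : Type*} [AddCommGroup P] [Module k P] [AddCommGroup Q]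
  [Module k Q]

theorem sum_linearMap_comp {R : Type*} [AddCommGroup R] [Module k R] (σ : Finset ℕ)
    (f : ℕ → Q →ₗ[k] R) (g : P →ₗ[k] Q) : (∑ i ∈ σ, f i) ∘ₗ g = ∑ i ∈ σ, f i ∘ₗ g := by
  ext x
  simp only [LinearMap.comp_apply, LinearMap.sum_apply]

theorem linearMap_comp_sum {R : Type*} [AddCommGroup R] [Module k R] (σ : Finset ℕ)
    (f : ℕ → P →ₗ[k] Q) (g : Q →ₗ[k] R) : g ∘ₗ (∑ i ∈ σ, f i) = ∑ i ∈ σ, g ∘ₗ f i := by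
  ext x
  simp only [LinearMap.comp_apply, LinearMap.sum_apply, map_sum]

theorem geom_sum_mul_self {R : Type*} [Ring R] {t : R} {m : ℕ} (ht : t ^ m = 1) :
    (∑ i ∈ Finset.range m, t ^ i) * t = ∑ i ∈ Finset.range m, t ^ i := by
  have h := geom_sum_mul t m
  rw [ht, sub_self, mul_sub, mul_one, sub_eq_zero] at h
  exact h

theorem mul_self_geom_sum {R : Type*} [Ring R] {t : R} {m : ℕ} (ht : t ^ m = 1) :
    t * (∑ i ∈ Finset.range m, t ^ i) = ∑ i ∈ Finset.range m, t ^ i := by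
  have h := mul_geom_sum t m
  rw [ht, sub_self, sub_mul, one_mul, sub_eq_zero] at h
  exact h

theorem geom_sum_mul_pow {R : Type*} [Ring R] {t : R} {m : ℕ} (ht : t ^ m = 1) (j : ℕ) :
    (∑ i ∈ Finset.range m, t ^ i) * t ^ j = ∑ i ∈ Finset.range m, t ^ i := by
  induction j with
  | zero => rw [pow_zero, mul_one]
  | succ j ih => rw [pow_succ, ← mul_assoc, ih, geom_sum_mul_self ht]

theorem pow_mul_geom_sum {R : Type*} [Ring R] {t : R} {m : ℕ} (ht : t ^ m = 1) (j : ℕ) :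
    t ^ j * (∑ i ∈ Finset.range m, t ^ i) = ∑ i ∈ Finset.range m, t ^ i := by
  induction j with
  | zero => rw [pow_zero, one_mul]
  | succ j ih => rw [pow_succ', mul_assoc, ih, mul_self_geom_sum ht]

variable {n : ℕ} {e : ℕ → P →ₗ[k] Q} {t : Module.End k P} {s : Module.End k Q}

/-- `b (1 - t) = (1 - t) b'` for signed faces satisfying the cyclic relations. -/
theorem sum_faces_one_sub (h : ∀ j ≤ n, e (j + 1) ∘ₗ t = s ∘ₗ e j) (hn : e (n + 1) = e 0 ∘ₗ t) :
    (∑ j ∈ Finset.range (n + 2), e j) ∘ₗ (1 - t)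
      = (1 - s) ∘ₗ ∑ j ∈ Finset.range (n + 1), e j := by
  have h1 : (∑ j ∈ Finset.range (n + 2), e j) ∘ₗ t
      = s ∘ₗ (∑ j ∈ Finset.range (n + 1), e j) + e (n + 1) := by
    rw [Finset.sum_range_succ', LinearMap.add_comp, sum_linearMap_comp, linearMap_comp_sum, hn]
    congr 1
    exact Finset.sum_congr rfl fun j hj => h j (Nat.lt_succ_iff.1 (Finset.mem_range.1 hj))
  rw [LinearMap.comp_sub, LinearMap.sub_comp, h1, Finset.sum_range_succ _ (n + 1)]
  change _ - _ = _ - _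
  have e1 : ∀ f : P →ₗ[k] Q, f ∘ₗ (1 : Module.End k P) = f := fun f => LinearMap.comp_id f
  have e2 : ∀ f : P →ₗ[k] Q, (1 : Module.End k Q) ∘ₗ f = f := fun f => LinearMap.id_comp f
  rw [e1, e2]
  abel

/-- `N b = b' N` for signed faces satisfying the cyclic relations. -/
theorem norm_sum_faces (h : ∀ j ≤ n, e (j + 1) ∘ₗ t = s ∘ₗ e j)
    (hs : s ^ (n + 1) = 1) (ht : t ^ (n + 2) = 1) :
    (∑ i ∈ Finset.range (n + 1), s ^ i) ∘ₗ (∑ j ∈ Finset.range (n + 2), e j)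
      = (∑ j ∈ Finset.range (n + 1), e j) ∘ₗ ∑ i ∈ Finset.range (n + 2), t ^ i := by
  -- Every face is thus the conjugate `sʲ e₀ t⁻ʲ` of the first one. Since norms absorb powers, both
  -- sides of the claim collapse to `N e₀ N'`.
  have hp : ∀ j ≤ n + 1, e j ∘ₗ (t ^ j) = (s ^ j) ∘ₗ e 0 := by
    intro j
    induction j with
    | zero => exact fun _ => rfl
    | succ j ih =>
      intro hj
      rw [pow_succ', pow_succ', Module.End.mul_eq_comp, Module.End.mul_eq_comp,
        ← LinearMap.comp_assoc, h j (by omega), LinearMap.comp_assoc, ih (by omega),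
        LinearMap.comp_assoc]
  set N := ∑ i ∈ Finset.range (n + 1), s ^ i with hN
  set N' := ∑ i ∈ Finset.range (n + 2), t ^ i with hN'
  have r1 : ∀ j ∈ Finset.range (n + 1), e j ∘ₗ N' = (s ^ j) ∘ₗ (e 0 ∘ₗ N') := fun j hj => by
    have hj := Finset.mem_range.1 hj
    rw [← LinearMap.comp_assoc, ← hp j (by omega), LinearMap.comp_assoc,
      ← Module.End.mul_eq_comp, hN', pow_mul_geom_sum ht]
  -- The exponent is `n + 2 - j`, that is `t⁻ʲ`, written in the shape that
  -- `Finset.sum_range_reflect` expects.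
  have r2 : ∀ j ∈ Finset.range (n + 2), N ∘ₗ e j = (N ∘ₗ e 0) ∘ₗ (t ^ (n + 2 - 1 - j + 1)) :=
    fun j hj => by
    have hj := Finset.mem_range.1 hj
    have e1 : e j = e j ∘ₗ (t ^ j * t ^ (n + 2 - 1 - j + 1)) := by
      rw [← pow_add, show j + (n + 2 - 1 - j + 1) = n + 2 by omega, ht]
      rfl
    conv_lhs => rw [e1]
    rw [Module.End.mul_eq_comp, ← LinearMap.comp_assoc _ _ (e j), hp j (by omega),
      LinearMap.comp_assoc, ← LinearMap.comp_assoc _ _ N, ← Module.End.mul_eq_comp, hN,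
      geom_sum_mul_pow hs, LinearMap.comp_assoc]
  have a1 : (∑ j ∈ Finset.range (n + 1), e j) ∘ₗ N' = N ∘ₗ (e 0 ∘ₗ N') := by
    rw [sum_linearMap_comp, Finset.sum_congr rfl r1, hN, sum_linearMap_comp]
  have a2 : ∑ j ∈ Finset.range (n + 2), t ^ (n + 2 - 1 - j + 1) = N' := by
    rw [Finset.sum_range_reflect (fun i => t ^ (i + 1)) (n + 2), hN', ← geom_sum_mul_self ht,
      Finset.sum_mul]
    exact Finset.sum_congr rfl fun i _ => pow_succ t i
  rw [a1, linearMap_comp_sum, Finset.sum_congr rfl r2, ← linearMap_comp_sum, a2,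
    LinearMap.comp_assoc]

end NormOperators

/-! ### The mixed complex of the cyclic module. -/

section CyclicMixed

variable {k : Type u} {H : Type v} [Field k] [Ring H] [HopfAlgebra k H]
  (A : HAlg.{u, v, w} k H) (M : Type x) [AddCommGroup M] [Module k M] [Module Hᵐᵒᵖ M]
  [IsScalarTower k Hᵐᵒᵖ M] [LeftComodule k H M] [InvertibleAntipode k H] [IsSAYD k H M]

/-- The signed faces `(-1)ʲ ∂ⱼ`. -/
def sface (n j : ℕ) : HTens M (tpow A (n + 1)) →ₗ[k] HTens M (tpow A n) :=
  if j ≤ n then (-1 : k) ^ j • HTens.map (face A n j)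
  else (-1 : k) ^ (n + 1) • (HTens.map (face A n 0) ∘ₗ tau A M n)

/-- The signed cyclic operator in every degree. -/
def signedt : ∀ n, Module.End k (HTens M (tpow A n))
  | 0 => 1
  | n + 1 => cyct A M n

/-- The differential `b' = ∑ᵢ (-1)ⁱ ∂ᵢ` without the last face. -/
def cycb' (n : ℕ) : HTens M (tpow A (n + 1)) →ₗ[k] HTens M (tpow A n) :=
  ∑ i ∈ Finset.range (n + 1), sface A M n i

theorem cycN_eq (n : ℕ) :
    cycN A M n = ∑ i ∈ Finset.range (n + 1), signedt A M n ^ i := by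
  cases n with
  | zero => rw [Finset.sum_range_one, pow_zero]; rfl
  | succ n => rfl

theorem cycb_eq_sum (n : ℕ) : cycb A M n = ∑ j ∈ Finset.range (n + 2), sface A M n j := by
  rw [Finset.sum_range_succ, cycb]
  congr 1
  · exact Finset.sum_congr rfl fun j hj => by
      rw [sface, if_pos (Nat.lt_succ_iff.1 (Finset.mem_range.1 hj))]
  · rw [sface, if_neg (by omega)]

theorem signedt_pow (n : ℕ) : signedt A M n ^ (n + 1) = 1 := by
  cases n with
  | zero => exact one_pow _
  | succ n =>
    rw [signedt, cyct, smul_pow, tau_pow, ← pow_mul, Even.neg_one_pow, one_smul]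
    exact Nat.even_mul_succ_self (n + 1)

theorem sface_last (n : ℕ) : sface A M n (n + 1) = sface A M n 0 ∘ₗ signedt A M (n + 1) := by
  rw [sface, if_neg (by omega), sface, if_pos (Nat.zero_le _), pow_zero, one_smul, signedt, cyct,
    LinearMap.comp_smul]

/-- The relation `∂ⱼ₊₁τ = τ∂ⱼ` with signs. Degree `0` is separate because the cyclic operator there
is the identity; the claim then says that the square of the signed flip on `M ⊗_H A^{⊗2}` is
trivial. -/
theorem sface_succ (n j : ℕ) (hj : j ≤ n) :
    sface A M n (j + 1) ∘ₗ signedt A M (n + 1) = signedt A M n ∘ₗ sface A M n j := by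
  cases n with
  | zero =>
    obtain rfl : j = 0 := by omega
    rw [sface_last, LinearMap.comp_assoc, ← Module.End.mul_eq_comp, ← pow_two, signedt_pow]
    rfl
  | succ n =>
    rw [signedt, signedt, cyct, cyct, LinearMap.comp_smul, LinearMap.smul_comp]
    rcases Nat.lt_or_ge n j with h | h
    · obtain rfl : j = n + 1 := by omega
      rw [sface, if_neg (by omega), sface, if_pos le_rfl, LinearMap.smul_comp, LinearMap.comp_smul,
        smul_smul, smul_smul, ← pow_add, ← pow_add]
      have e : (HTens.map (face A (n + 1) 0) ∘ₗ tau A M (n + 1)) ∘ₗ tau A M (n + 1)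
          = tau A M n ∘ₗ HTens.map (face A (n + 1) (n + 1)) :=
        LinearMap.ext fun t => face_zero_tau_tau n t
      rw [e, show n + 1 + 1 + (n + 1 + 1) = n + 1 + (n + 1) + 2 by ring, pow_add _ _ 2, neg_one_sq,
        mul_one]
    · rw [sface, if_pos (by omega), sface, if_pos (by omega), LinearMap.smul_comp,
        LinearMap.comp_smul, smul_smul, smul_smul, ← pow_add, ← pow_add]
      have e : HTens.map (face A (n + 1) (j + 1)) ∘ₗ tau A M (n + 1)
          = tau A M n ∘ₗ HTens.map (face A (n + 1) j) :=
        LinearMap.ext fun t => face_succ_tau n j h t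
      rw [e, show n + 1 + 1 + (j + 1) = n + 1 + j + 2 by ring, pow_add _ _ 2, neg_one_sq, mul_one]

theorem cycb_one_sub (n : ℕ) : cycb A M n ∘ₗ (1 - signedt A M (n + 1))
    = (1 - signedt A M n) ∘ₗ cycb' A M n := by
  rw [cycb_eq_sum]
  exact sum_faces_one_sub (sface_succ A M n) (sface_last A M n)

theorem cycN_cycb (n : ℕ) : cycN A M n ∘ₗ cycb A M n = cycb' A M n ∘ₗ cycN A M (n + 1) := by
  rw [cycb_eq_sum, cycN_eq, cycN_eq]
  exact norm_sum_faces (sface_succ A M n) (signedt_pow A M n) (signedt_pow A M (n + 1))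

variable {M}

theorem cycs_apply (n : ℕ) (t : HTens M (tpow A n)) :
    cycs A M n t = HTens.map (cons A n) (HTens.map (A.oneIns (tpow A n)) t) :=
  congrArg _ (HTens.swap_insOne A (tpow A n) t)

theorem face_zero_cycs (n : ℕ) (t : HTens M (tpow A n)) :
    HTens.map (face A n 0) (cycs A M n t) = t := by
  rw [cycs_apply, ← HTens.map_comp, ← HTens.map_comp]
  refine (HTens.map_congr (g := Hom.id _) (LinearMap.ext fun y => ?_) t).trans (HTens.map_id t)
  exact (face_zero_cons A n 1 y).trans (cycL_one A n y)

theorem face_succ_cycs (n j : ℕ) (hj : j ≤ n) (t : HTens M (tpow A (n + 1))) :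
    HTens.map (face A (n + 1) (j + 1)) (cycs A M (n + 1) t)
      = cycs A M n (HTens.map (face A n j) t) := by
  rw [cycs_apply, cycs_apply, ← HTens.map_comp, ← HTens.map_comp, ← HTens.map_comp,
    ← HTens.map_comp]
  exact HTens.map_congr (LinearMap.ext fun y => face_succ_cons A n j hj 1 y) t

theorem cycb'_cycs_zero (t : HTens M (tpow A 0)) : cycb' A M 0 (cycs A M 0 t) = t := by
  rw [cycb', Finset.sum_range_one, sface, if_pos le_rfl, pow_zero, one_smul, face_zero_cycs]

/-- The extra degeneracy contracts `b'`: `∂₀s` is the identity and `∂ⱼ₊₁s = s∂ⱼ`, so all other faces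
cancel in pairs because their signs differ. -/
theorem cycb'_cycs (n : ℕ) (t : HTens M (tpow A (n + 1))) :
    cycb' A M (n + 1) (cycs A M (n + 1) t) + cycs A M n (cycb' A M n t) = t := by
  have e : ∀ j ∈ Finset.range (n + 1), sface A M (n + 1) (j + 1) (cycs A M (n + 1) t)
      = - cycs A M n (sface A M n j t) := fun j hj => by
    have hj := Finset.mem_range.1 hj
    rw [sface, if_pos (by omega), sface, if_pos (by omega), LinearMap.smul_apply,
      LinearMap.smul_apply, face_succ_cycs A n j (by omega), map_smul, pow_succ]
    module
  rw [cycb', cycb', Finset.sum_range_succ', LinearMap.add_apply, LinearMap.sum_apply,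
    LinearMap.sum_apply, map_sum, Finset.sum_congr rfl e, Finset.sum_neg_distrib, sface,
    if_pos (Nat.zero_le _), pow_zero, one_smul, face_zero_cycs]
  abel

variable (M)

theorem one_sub_signedt_cycN (n : ℕ) (t : HTens M (tpow A n)) :
    (1 - signedt A M n) (cycN A M n t) = 0 := by
  have h := mul_self_geom_sum (signedt_pow A M n)
  rw [← cycN_eq] at h
  rw [LinearMap.sub_apply, sub_eq_zero]
  exact (LinearMap.congr_fun h t).symm

theorem cycN_one_sub_signedt (n : ℕ) (t : HTens M (tpow A n)) :
    cycN A M n ((1 - signedt A M n) t) = 0 := by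
  have h := geom_sum_mul_self (signedt_pow A M n)
  rw [← cycN_eq] at h
  rw [LinearMap.sub_apply, map_sub, sub_eq_zero]
  exact (LinearMap.congr_fun h t).symm

theorem cycB_apply (n : ℕ) (t : HTens M (tpow A n)) : cycB A M n t
    = (1 - signedt A M (n + 1)) (cycs A M n (cycN A M n t)) := rfl

theorem cycB_cycB (n : ℕ) (t : HTens M (tpow A n)) : cycB A M (n + 1) (cycB A M n t) = 0 := by
  rw [cycB_apply, cycB_apply, cycN_one_sub_signedt, map_zero, map_zero]

theorem cycb_cycB_zero (t : HTens M (tpow A 0)) : cycb A M 0 (cycB A M 0 t) = 0 := by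
  rw [cycB_apply, ← LinearMap.comp_apply, cycb_one_sub, LinearMap.comp_apply, cycb'_cycs_zero,
    one_sub_signedt_cycN]

/-- Both terms are pushed to the common form `(1 - t)(b's + sb')N`. The bracket is the identity, and
`(1 - t)N = 0`. -/
theorem cycb_cycB_add (n : ℕ) (t : HTens M (tpow A (n + 1))) :
    cycb A M (n + 1) (cycB A M (n + 1) t) + cycB A M n (cycb A M n t) = 0 := by
  rw [cycB_apply, cycB_apply, ← LinearMap.comp_apply (cycb A M (n + 1)), cycb_one_sub,
    ← LinearMap.comp_apply (cycN A M n), cycN_cycb, LinearMap.comp_apply, LinearMap.comp_apply,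
    ← map_add, cycb'_cycs, one_sub_signedt_cycN]

/-- The mixed complex of the cyclic module `C_*^H(A, M)`. -/
theorem cycMixed_isMixed : (cycMixed A M).IsMixed where
  b_b n t := cycb_cycb n t
  B_B n t := cycB_cycB A M n t
  b_B_zero t := cycb_cycB_zero A M t
  b_B_add n t := cycb_cycB_add A M n t

end CyclicMixed

/-! ### Differential forms as the quotient of the cyclic module by degenerate tensors. -/

section Normalization

variable {k : Type u} {H : Type v} [Field k] [Ring H] [HopfAlgebra k H]
  (A : HAlg.{u, v, w} k H)

/-- The projection `a₀ ⊗ ⋯ ⊗ aₙ ↦ a₀ da₁ ⋯ daₙ`. -/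
def toForms : ∀ n, Hom (tpow A n) (forms A n)
  | 0 => Hom.id A.toHRep
  | n + 1 => (toForms n).tmap A.mkBar

theorem toForms_surjective (n : ℕ) : Function.Surjective (toForms A n).lin := by
  induction n with
  | zero => exact fun x => ⟨x, rfl⟩
  | succ n ih => exact TensorProduct.map_surjective ih A.mkBar_surjective

theorem toForms_cycL (n : ℕ) (a : A) (x : tpow A n) :
    (toForms A n).lin ((cycL A n).lin (a ⊗ₜ x))
      = (formsL A n).lin (a ⊗ₜ (toForms A n).lin x) := by
  induction n with
  | zero => rfl
  | succ n ih =>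
    induction x using TensorProduct.induction_on with
    | zero => simp only [TensorProduct.tmul_zero, map_zero]
    | add y z hy hz => simp only [TensorProduct.tmul_add, map_add, hy, hz]
    | tmul x b => exact congrArg (· ⊗ₜ[k] A.mkBar.lin b) (ih x)

theorem toForms_cycR (n : ℕ) (x : tpow A n) (a : A) :
    (toForms A n).lin ((cycR A n).lin (x ⊗ₜ a))
      = (formsR A n).lin ((toForms A n).lin x ⊗ₜ a) := by
  induction n generalizing a with
  | zero => rfl
  | succ n ih =>
    induction x using TensorProduct.induction_on with
    | zero => simp only [TensorProduct.zero_tmul, map_zero]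
    | add y z hy hz => simp only [TensorProduct.add_tmul, map_add, hy, hz]
    | tmul x b =>
      have e1 : (toForms A (n + 1)).lin (x ⊗ₜ b) = (toForms A n).lin x ⊗ₜ A.mkBar.lin b := rfl
      have e2 : (cycR A (n + 1)).lin ((x ⊗ₜ b) ⊗ₜ a)
        = x ⊗ₜ ((b : A) * a) - (cycR A n).lin (x ⊗ₜ b) ⊗ₜ[k] (a : A) := rfl
      rw [e1, e2, formsR_succ, map_sub, ← ih]
      rfl

theorem toForms_oneIns (n : ℕ) (x : tpow A n) :
    (toForms A (n + 1)).lin ((cons A n).lin ((A.oneIns (tpow A n)).lin x))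
      = (formsD A n).lin ((toForms A n).lin x) := by
  induction n with
  | zero => rfl
  | succ n ih =>
    induction x using TensorProduct.induction_on with
    | zero => simp only [map_zero]
    | add y z hy hz => simp only [map_add, hy, hz]
    | tmul x b => exact congrArg (· ⊗ₜ[k] A.mkBar.lin b) (ih x)

theorem formsD_formsD (n : ℕ) (ω : forms A n) :
    (formsD A (n + 1)).lin ((formsD A n).lin ω) = 0 := by
  induction n with
  | zero =>
    change (1 : A) ⊗ₜ[k] A.mkBar.lin (1 : A) ⊗ₜ[k] A.mkBar.lin ω = 0
    rw [A.mkBar_one, TensorProduct.tmul_zero, TensorProduct.zero_tmul]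
  | succ n ih =>
    induction ω using TensorProduct.induction_on with
    | zero => simp only [map_zero]
    | add y z hy hz => simp only [map_add, hy, hz, add_zero]
    | tmul x b =>
      change (formsD A (n + 1)).lin ((formsD A n).lin x) ⊗ₜ[k] b = 0
      rw [ih, TensorProduct.zero_tmul]

theorem formsL_formsD (n : ℕ) (a : A) (x : tpow A n) :
    (formsL A (n + 1)).lin (a ⊗ₜ (formsD A n).lin ((toForms A n).lin x))
      = (toForms A (n + 1)).lin ((cons A n).lin (a ⊗ₜ x)) := by
  induction n with
  | zero =>
    change ((a : A) * 1) ⊗ₜ[k] A.mkBar.lin x = a ⊗ₜ[k] A.mkBar.lin x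
    rw [mul_one]
  | succ n ih =>
    induction x using TensorProduct.induction_on with
    | zero => simp only [TensorProduct.tmul_zero, map_zero]
    | add y z hy hz => simp only [TensorProduct.tmul_add, map_add, hy, hz]
    | tmul x b => exact congrArg (· ⊗ₜ[k] A.mkBar.lin b) (ih x)

/-- A unit outside the zeroth place represents `d1 = 0`. -/
theorem toForms_cons_cons_one (n : ℕ) (a : A) (x : tpow A n) :
    (toForms A (n + 1 + 1)).lin ((cons A (n + 1)).lin (a ⊗ₜ (cons A n).lin ((1 : A) ⊗ₜ x)))
      = 0 := by
  induction n with
  | zero =>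
    change (a ⊗ₜ[k] A.mkBar.lin (1 : A)) ⊗ₜ[k] A.mkBar.lin x = 0
    rw [A.mkBar_one, TensorProduct.tmul_zero, TensorProduct.zero_tmul]
  | succ n ih =>
    induction x using TensorProduct.induction_on with
    | zero => simp only [TensorProduct.tmul_zero, map_zero]
    | add y z hy hz => simp only [TensorProduct.tmul_add, map_add, hy, hz, add_zero]
    | tmul x b =>
      refine (congrArg (· ⊗ₜ[k] A.mkBar.lin b) (ih x)).trans (TensorProduct.zero_tmul _ _)

variable {A}
variable {M : Type x} [AddCommGroup M] [Module k M] [Module Hᵐᵒᵖ M] [IsScalarTower k Hᵐᵒᵖ M]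

theorem barDesc_map {X : HRep.{u, v, w} k H} {T : Type*} [AddCommGroup T] [Module k T]
    (f : HTens M (tens X A.toHRep) →ₗ[k] T)
    (hf : ∀ m x, f (HTens.mk _ m ((A.insOne X).lin x)) = 0) (t : HTens M (tens X A.toHRep)) :
    barDesc A f hf (HTens.map ((Hom.id X).tmap A.mkBar) t) = f t := by
  refine LinearMap.congr_fun (f := barDesc A f hf ∘ₗ HTens.map ((Hom.id X).tmap A.mkBar)) (g := f)
    (HTens.hom_ext fun m y => ?_) t
  rw [LinearMap.comp_apply, HTens.map_mk]
  induction y using TensorProduct.induction_on with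
  | zero => simp only [map_zero]
  | add y z hy hz => simp only [map_add, hy, hz]
  | tmul x a => exact barDesc_mk A f hf m x a

variable [LeftComodule k H M] [InvertibleAntipode k H] [IsSAYD k H M]

theorem formsb_map (n : ℕ) (t : HTens M (tens (forms A n) A.toHRep)) :
    formsb A M n (HTens.map ((Hom.id (forms A n)).tmap A.mkBar) t)
      = (-1 : k) ^ n • commutator A M (formsL A n) (formsR A n) t :=
  congrArg ((-1 : k) ^ n • ·) (barDesc_map (commutator A M (formsL A n) (formsR A n)) _ t)

theorem map_toForms_succ (n : ℕ) (t : HTens M (tpow A (n + 1))) :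
    HTens.map (toForms A (n + 1)) t = HTens.map ((Hom.id (forms A n)).tmap A.mkBar)
      (HTens.map ((toForms A n).tmap (Hom.id A.toHRep)) t) := by
  rw [← HTens.map_comp]
  refine HTens.map_congr (f := toForms A (n + 1)) ?_ t
  exact TensorProduct.ext' fun x a => rfl

theorem toForms_cycb (n : ℕ) (t : HTens M (tpow A (n + 1))) :
    HTens.map (toForms A n) (cycb A M n t) = formsb A M n (HTens.map (toForms A (n + 1)) t) := by
  rw [cycb_apply, map_toForms_succ, formsb_map, map_smul]
  congr 1
  exact map_commutator _ (toForms_cycL A n) (toForms_cycR A n) t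

theorem toForms_cycs (n : ℕ) (t : HTens M (tpow A n)) :
    HTens.map (toForms A (n + 1)) (cycs A M n t)
      = HTens.map (formsD A n) (HTens.map (toForms A n) t) := by
  rw [cycs_apply, ← HTens.map_comp, ← HTens.map_comp, ← HTens.map_comp]
  exact HTens.map_congr (LinearMap.ext fun x => toForms_oneIns A n x) t

/-- Rotating `1 ⊗ a₀ ⊗ ⋯` moves the unit out of the zeroth place, so the summand `tsN` of `B`
disappears on forms and only `sN` survives. In degree `0` the rotated element is `a ⊗ 1`. -/
theorem toForms_tau_cycs (n : ℕ) (t : HTens M (tpow A n)) :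
    HTens.map (toForms A (n + 1)) (tau A M n (cycs A M n t)) = 0 := by
  cases n with
  | zero =>
    have e : cycs A M 0 t = HTens.map (A.oneIns (tpow A 0)) t :=
      (cycs_apply A 0 t).trans (HTens.map_id _)
    have e2 : tau A M 0 (cycs A M 0 t) = HTens.map (A.insOne (tpow A 0)) t := by
      rw [e, tau_apply, ← HTens.swap_insOne]
      exact (HTens.map_id _).trans (HTens.swap_swap_self _ _ _)
    rw [e2, ← HTens.map_comp]
    refine LinearMap.congr_fun (f := HTens.map _) (g := 0) (HTens.hom_ext fun m a => ?_) t
    rw [HTens.map_mk]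
    change HTens.mk (forms A 1) m ((a : A) ⊗ₜ[k] A.mkBar.lin (1 : A)) = 0
    rw [A.mkBar_one, TensorProduct.tmul_zero, map_zero]
  | succ n =>
    have e : cycs A M (n + 1) t = HTens.map (((cons A n).comp (A.oneIns (tpow A n))).tmap
        (Hom.id A.toHRep)) t := by
      rw [cycs_apply, ← HTens.map_comp]
      refine HTens.map_congr (f := (cons A (n + 1)).comp (A.oneIns (tpow A (n + 1)))) ?_ t
      exact TensorProduct.ext' fun x a => rfl
    rw [e, tau_apply, HTens.swap_map, ← HTens.map_comp, ← HTens.map_comp]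
    generalize HTens.swap (tpow A n) A.toHRep t = s
    refine LinearMap.congr_fun (f := HTens.map _) (g := 0) (HTens.hom_ext fun m y => ?_) s
    rw [HTens.map_mk]
    induction y using TensorProduct.induction_on with
    | zero => simp only [map_zero]
    | add y z hy hz => rw [map_add, map_add, hy, hz]; simp only [LinearMap.zero_apply, add_zero]
    | tmul a x =>
      exact (congrArg _ (toForms_cons_cons_one A n a x)).trans (map_zero _)

theorem karoubi_map (n : ℕ) (t : HTens M (tens (forms A n) A.toHRep)) :
    karoubi A M (n + 1) (HTens.map ((Hom.id (forms A n)).tmap A.mkBar) t)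
      = (-1 : k) ^ n • HTens.map (formsDL A n) (HTens.swap (forms A n) A.toHRep t) :=
  congrArg ((-1 : k) ^ n • ·)
    (barDesc_map (HTens.map (formsDL A n) ∘ₗ HTens.swap (forms A n) A.toHRep) _ t)

/-- On exact forms the Karoubi operator is the cyclic operator: `d(a dω) - a d(dω)` reduces to `da
dω`. Without the preceding `s`, which becomes `d`, the correction term would not vanish. -/
theorem toForms_cycs_cyct (n : ℕ) (t : HTens M (tpow A (n + 1))) :
    HTens.map (toForms A (n + 1 + 1)) (cycs A M (n + 1) (cyct A M n t))
      = karoubi A M (n + 1 + 1) (HTens.map (toForms A (n + 1 + 1)) (cycs A M (n + 1) t)) := by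
  have e : HTens.map (formsD A (n + 1)) (HTens.map (toForms A (n + 1)) t)
      = HTens.map ((Hom.id (forms A (n + 1))).tmap A.mkBar)
        (HTens.map (((formsD A n).comp (toForms A n)).tmap (Hom.id A.toHRep)) t) := by
    rw [← HTens.map_comp, ← HTens.map_comp]
    refine HTens.map_congr (f := (formsD A (n + 1)).comp (toForms A (n + 1))) ?_ t
    exact TensorProduct.ext' fun x a => rfl
  rw [toForms_cycs, toForms_cycs, e, karoubi_map, cyct, LinearMap.smul_apply, map_smul, map_smul,
    tau_apply, HTens.swap_map, ← HTens.map_comp, ← HTens.map_comp, ← HTens.map_comp]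
  congr 1
  refine HTens.map_congr (TensorProduct.ext' fun a x => ?_) _
  have e2 : (formsDL A (n + 1)).lin (a ⊗ₜ (formsD A n).lin ((toForms A n).lin x))
      = (formsD A (n + 1)).lin ((formsL A (n + 1)).lin (a ⊗ₜ (formsD A n).lin
          ((toForms A n).lin x)))
        - (formsL A (n + 1 + 1)).lin (a ⊗ₜ (formsD A (n + 1)).lin ((formsD A n).lin
          ((toForms A n).lin x))) := rfl
  rw [formsD_formsD, TensorProduct.tmul_zero, map_zero, sub_zero, formsL_formsD] at e2
  exact e2.symm

theorem toForms_cycs_signedt_pow (n i : ℕ) (t : HTens M (tpow A n)) (hi : i ≤ n) :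
    HTens.map (toForms A (n + 1)) (cycs A M n ((signedt A M n ^ i) t))
      = (karoubi A M (n + 1) ^ i) (HTens.map (formsD A n) (HTens.map (toForms A n) t)) := by
  cases n with
  | zero =>
    obtain rfl : i = 0 := by omega
    exact toForms_cycs 0 t
  | succ n =>
    clear hi
    induction i with
    | zero => exact toForms_cycs (n + 1) t
    | succ i ih =>
      rw [pow_succ', pow_succ', Module.End.mul_apply, Module.End.mul_apply, signedt,
        toForms_cycs_cyct]
      exact congrArg _ ih

theorem toForms_cycB (n : ℕ) (t : HTens M (tpow A n)) :
    HTens.map (toForms A (n + 1)) (cycB A M n t) = formsB A M n (HTens.map (toForms A n) t) := by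
  have e1 : cycB A M n t = cycs A M n (cycN A M n t)
      - (-1 : k) ^ (n + 1) • tau A M n (cycs A M n (cycN A M n t)) := rfl
  rw [e1, map_sub, map_smul, toForms_tau_cycs, smul_zero, sub_zero, cycN_eq, LinearMap.sum_apply,
    map_sum, map_sum, formsB, LinearMap.comp_apply, LinearMap.sum_apply]
  exact Finset.sum_congr rfl fun i hi => toForms_cycs_signedt_pow n i t
    (Nat.lt_succ_iff.1 (Finset.mem_range.1 hi))

variable (A M)

theorem map_toForms_surjective (n : ℕ) :
    Function.Surjective (HTens.map (M := M) (toForms A n)) :=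
  HTens.map_surjective (toForms_surjective A n)

/-- The mixed complex of noncommutative differential forms. -/
theorem formsMixed_isMixed : (formsMixed A M).IsMixed where
  b_b n t := by
    -- Every form lifts to the cyclic module and the projection commutes with `b` and `B`, so all
    -- the axioms descend.
    obtain ⟨t, rfl⟩ := map_toForms_surjective A M _ t
    change formsb A M n (formsb A M (n + 1) _) = 0
    rw [← toForms_cycb, ← toForms_cycb, cycb_cycb, map_zero]
  B_B n t := by
    obtain ⟨t, rfl⟩ := map_toForms_surjective A M _ t
    change formsB A M (n + 1) (formsB A M n _) = 0
    rw [← toForms_cycB, ← toForms_cycB, cycB_cycB, map_zero]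
  b_B_zero t := by
    obtain ⟨t, rfl⟩ := map_toForms_surjective A M _ t
    change formsb A M 0 (formsB A M 0 _) = 0
    rw [← toForms_cycB, ← toForms_cycb, cycb_cycB_zero, map_zero]
  b_B_add n t := by
    obtain ⟨t, rfl⟩ := map_toForms_surjective A M _ t
    change formsb A M (n + 1) (formsB A M (n + 1) _) + formsB A M n (formsb A M n _) = 0
    rw [← toForms_cycB, ← toForms_cycb, ← toForms_cycb, ← toForms_cycB, ← map_add,
      cycb_cycB_add, map_zero]

end Normalization

/-! ### Connections and the homotopies they provide in degrees at least two. -/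

section Connections

variable {k : Type u} {H : Type v} [Field k] [Ring H] [HopfAlgebra k H]
  {A : HAlg.{u, v, w} k H}

/-- The rule `(x ⊗ πa)b = x ⊗ π(ab) - xa ⊗ πb` for the right multiplications on `X` and
`X ⊗ B`. -/
def IsTwistedRight {X B : HRep.{u, v, w} k H} (π : Hom A.toHRep B) (r : Hom (tens X A.toHRep) X)
    (r' : Hom (tens (tens X B) A.toHRep) (tens X B)) : Prop :=
  ∀ (x : X) (a b : A), r'.lin ((x ⊗ₜ π.lin a) ⊗ₜ b)
    = x ⊗ₜ[k] π.lin (a * b) - r.lin (x ⊗ₜ a) ⊗ₜ[k] π.lin b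

/-- A left linear map `∇ : X → X ⊗ B` with `∇(xa) = ∇(x)a + e x ⊗ πa`. -/
structure IsConn {X B : HRep.{u, v, w} k H} (π : Hom A.toHRep B) (l : Hom (tens A.toHRep X) X)
    (r : Hom (tens X A.toHRep) X) (r' : Hom (tens (tens X B) A.toHRep) (tens X B)) (e : k)
    (D : Hom X (tens X B)) : Prop where
  left (a : A) (x : X) : D.lin (l.lin (a ⊗ₜ x)) = (tensL A l B).lin (a ⊗ₜ D.lin x)
  right (x : X) (a : A) :
    D.lin (r.lin (x ⊗ₜ a)) = r'.lin (D.lin x ⊗ₜ a) + e • (x ⊗ₜ[k] π.lin a)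

/-- The sign changes because in `(x ⊗ πa)b` the factor `xa` carries a minus sign: the deviation `e x
⊗ πa` of `∇(xa)` reappears as `-e x ⊗ πa ⊗ πb`. -/
theorem IsConn.tens {X B : HRep.{u, v, w} k H} {π : Hom A.toHRep B}
    (hπ : Function.Surjective π.lin) {l : Hom (tens A.toHRep X) X} {r : Hom (tens X A.toHRep) X}
    {r' : Hom (tens (tens X B) A.toHRep) (tens X B)}
    {r'' : Hom (tens (tens (tens X B) B) A.toHRep) (tens (tens X B) B)} {e : k}
    {D : Hom X (tens X B)} (hD : IsConn π l r r' e D) (hr : IsTwistedRight π r r')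
    (hr' : IsTwistedRight π r' r'') :
    IsConn π (tensL A l B) r' r'' (-e) (D.tmap (Hom.id B)) where
  left a x := by
    induction x using TensorProduct.induction_on with
    | zero => simp only [TensorProduct.tmul_zero, map_zero]
    | add y z hy hz => simp only [TensorProduct.tmul_add, map_add, hy, hz]
    | tmul x b => exact congrArg (· ⊗ₜ[k] b) (hD.left a x)
  right x b := by
    induction x using TensorProduct.induction_on with
    | zero => simp only [TensorProduct.zero_tmul, map_zero, smul_zero, add_zero]
    | add y z hy hz =>
      simp only [TensorProduct.add_tmul, map_add, hy, hz, smul_add]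
      abel
    | tmul x a =>
      obtain ⟨a, rfl⟩ := hπ a
      have e1 : ∀ (x : X) (c : B), (D.tmap (Hom.id B)).lin (x ⊗ₜ c) = D.lin x ⊗ₜ[k] c :=
        fun _ _ => rfl
      rw [hr, map_sub, e1, e1, e1, hr', hD.right, TensorProduct.add_tmul, ← TensorProduct.smul_tmul',
        neg_smul]
      abel

variable {M : Type x} [AddCommGroup M] [Module k M] [Module Hᵐᵒᵖ M] [IsScalarTower k Hᵐᵒᵖ M]
  [LeftComodule k H M] [InvertibleAntipode k H] [IsSAYD k H M]

/-- A connection is a contracting homotopy for the twisted commutators. -/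
theorem IsConn.homotopy {X B : HRep.{u, v, w} k H} {π : Hom A.toHRep B}
    {l : Hom (HRep.tens A.toHRep X) X} {r : Hom (HRep.tens X A.toHRep) X}
    {r' : Hom (HRep.tens (HRep.tens X B) A.toHRep) (HRep.tens X B)} {e : k}
    {D : Hom X (HRep.tens X B)} (hD : IsConn π l r r' e D)
    (s : HTens M (HRep.tens X A.toHRep)) :
    commutator A M (tensL A l B) r' (HTens.map (D.tmap (Hom.id A.toHRep)) s)
      - HTens.map D (commutator A M l r s) = -(e • HTens.map ((Hom.id X).tmap π) s) := by
  have e1 : HTens.map D (HTens.map r s)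
      = HTens.map r' (HTens.map (D.tmap (Hom.id A.toHRep)) s)
        + e • HTens.map ((Hom.id X).tmap π) s := by
    rw [← HTens.map_comp, ← HTens.map_comp]
    exact HTens.map_eq_add_smul (f := D.comp r) (g := r'.comp (D.tmap (Hom.id A.toHRep)))
      (h := (Hom.id X).tmap π) e (TensorProduct.ext' fun x a => hD.right x a) s
  have e2 : ∀ s, HTens.map D (HTens.map l s)
      = HTens.map (tensL A l B) (HTens.map (M := M) ((Hom.id A.toHRep).tmap D) s) := by
    intro s
    rw [← HTens.map_comp, ← HTens.map_comp]
    exact HTens.map_congr (TensorProduct.ext' fun a x => hD.left a x) s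
  rw [commutator_apply, commutator_apply, map_sub, e1, e2, HTens.swap_map]
  abel

variable (A)

theorem cyc_isTwistedRight (n : ℕ) :
    IsTwistedRight (A := A) (Hom.id A.toHRep) (cycR A n) (cycR A (n + 1)) := fun _ _ _ => rfl

theorem forms_isTwistedRight (n : ℕ) :
    IsTwistedRight (A := A) A.mkBar (formsR A n) (formsR A (n + 1)) := fun _ _ _ => rfl

variable {A}

/-- The extension of a connection on `A ⊗ A` to `A^{⊗(n+2)}`. -/
def cycConn (D : Hom (tpow A 1) (tpow A 2)) : ∀ n, Hom (tpow A (n + 1)) (tpow A (n + 2))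
  | 0 => D
  | n + 1 => (cycConn D n).tmap (Hom.id A.toHRep)

/-- The extension of a connection on one-forms to `(n+1)`-forms. -/
def formsConn (D : Hom (forms A 1) (forms A 2)) : ∀ n, Hom (forms A (n + 1)) (forms A (n + 2))
  | 0 => D
  | n + 1 => (formsConn D n).tmap (Hom.id A.bar)

theorem cycConn_isConn {D : Hom (tpow A 1) (tpow A 2)}
    (hD : IsConn (A := A) (Hom.id A.toHRep) (cycL A 1) (cycR A 1) (cycR A 2) 1 D) (n : ℕ) :
    IsConn (A := A) (Hom.id A.toHRep) (cycL A (n + 1)) (cycR A (n + 1)) (cycR A (n + 2))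
      ((-1) ^ n) (cycConn D n) := by
  induction n with
  | zero => rw [pow_zero]; exact hD
  | succ n ih =>
    rw [pow_succ, mul_neg_one]
    exact ih.tens Function.surjective_id (cyc_isTwistedRight A (n + 1))
      (cyc_isTwistedRight A (n + 2))

theorem formsConn_isConn {D : Hom (forms A 1) (forms A 2)}
    (hD : IsConn (A := A) A.mkBar (formsL A 1) (formsR A 1) (formsR A 2) 1 D) (n : ℕ) :
    IsConn (A := A) A.mkBar (formsL A (n + 1)) (formsR A (n + 1)) (formsR A (n + 2))
      ((-1) ^ n) (formsConn D n) := by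
  induction n with
  | zero => rw [pow_zero]; exact hD
  | succ n ih =>
    rw [pow_succ, mul_neg_one]
    exact ih.tens A.mkBar_surjective (forms_isTwistedRight A (n + 1))
      (forms_isTwistedRight A (n + 2))

/-- The sign `(-1)ⁿ` of the extended connection cancels the sign relating `b` to the commutator,
which leaves `-1` in every degree. This is a contraction of `(C, b)` in degrees at least `2`. -/
theorem cycConn_homotopy {D : Hom (tpow A 1) (tpow A 2)}
    (hD : IsConn (A := A) (Hom.id A.toHRep) (cycL A 1) (cycR A 1) (cycR A 2) 1 D) (n : ℕ)
    (t : HTens M (tpow A (n + 2))) :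
    cycb A M (n + 2) (HTens.map (cycConn D (n + 1)) t)
      + HTens.map (cycConn D n) (cycb A M (n + 1) t) = -t := by
  have h := (cycConn_isConn hD n).homotopy (M := M) t
  have e : HTens.map ((Hom.id (tpow A (n + 1))).tmap (Hom.id A.toHRep)) t = t := by
    refine (HTens.map_congr (g := Hom.id _) ?_ t).trans (HTens.map_id t)
    exact TensorProduct.ext' fun _ _ => rfl
  rw [e] at h
  rw [cycb_apply, cycb_apply, map_smul]
  change (-1 : k) ^ (n + 2) • commutator A M (tensL A (cycL A (n + 1)) A.toHRep) (cycR A (n + 2))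
    (HTens.map ((cycConn D n).tmap (Hom.id A.toHRep)) t) + _ = _
  rw [sub_eq_iff_eq_add.1 h, smul_add, smul_neg, smul_smul, ← pow_add,
    show n + 2 + n = 2 * (n + 1) by ring, pow_mul, neg_one_sq, one_pow, pow_succ _ (n + 1)]
  module

/-- The same computation, performed on a lift of the last factor from `A/k1` to `A`. -/
theorem formsConn_homotopy {D : Hom (forms A 1) (forms A 2)}
    (hD : IsConn (A := A) A.mkBar (formsL A 1) (formsR A 1) (formsR A 2) 1 D) (n : ℕ)
    (t : HTens M (forms A (n + 2))) :
    formsb A M (n + 2) (HTens.map (formsConn D (n + 1)) t)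
      + HTens.map (formsConn D n) (formsb A M (n + 1) t) = -t := by
  obtain ⟨s, rfl⟩ := HTens.map_surjective (M := M) (f := (Hom.id (forms A (n + 1))).tmap A.mkBar)
    (TensorProduct.map_surjective Function.surjective_id A.mkBar_surjective) t
  have h := (formsConn_isConn hD n).homotopy (M := M) s
  have e : HTens.map (formsConn D (n + 1)) (HTens.map ((Hom.id (forms A (n + 1))).tmap A.mkBar) s)
      = HTens.map ((Hom.id (forms A (n + 2))).tmap A.mkBar)
        (HTens.map ((formsConn D n).tmap (Hom.id A.toHRep)) s) := by
    rw [← HTens.map_comp, ← HTens.map_comp]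
    refine HTens.map_congr
      (f := (formsConn D (n + 1)).comp ((Hom.id (forms A (n + 1))).tmap A.mkBar)) ?_ s
    exact TensorProduct.ext' fun _ _ => rfl
  rw [e, formsb_map, formsb_map, map_smul]
  change (-1 : k) ^ (n + 2) • commutator A M (tensL A (formsL A (n + 1)) A.bar) (formsR A (n + 2))
    (HTens.map ((formsConn D n).tmap (Hom.id A.toHRep)) s) + _ = _
  rw [sub_eq_iff_eq_add.1 h, smul_add, smul_neg, smul_smul, ← pow_add,
    show n + 2 + n = 2 * (n + 1) by ring, pow_mul, neg_one_sq, one_pow, pow_succ _ (n + 1)]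
  module

/-- A map `φ` on `A` with `φ(ab) = aφ(b) + φ(a)b + 1 ⊗ a ⊗ b`. -/
def IsCochain (φ : Hom A.toHRep (tpow A 2)) : Prop :=
  ∀ a b : A, φ.lin (a * b) = (cycL A 2).lin (a ⊗ₜ φ.lin b) + (cycR A 2).lin (φ.lin a ⊗ₜ b)
    + ((1 : A) ⊗ₜ[k] a) ⊗ₜ[k] b

/-- The connection `x ⊗ b ↦ xφ(b)`. -/
def cycConnOf (φ : Hom A.toHRep (tpow A 2)) : Hom (tpow A 1) (tpow A 2) :=
  (cycL A 2).comp ((Hom.id A.toHRep).tmap φ)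

/-- The term `1 ⊗ a ⊗ b` in the cochain identity becomes `x ⊗ a ⊗ b` after multiplication by `x`,
the deviation required of a connection. The other two terms express associativity of the bimodule
`A^{⊗3}`. -/
theorem cycConnOf_isConn {φ : Hom A.toHRep (tpow A 2)} (hφ : IsCochain φ) :
    IsConn (A := A) (Hom.id A.toHRep) (cycL A 1) (cycR A 1) (cycR A 2) 1 (cycConnOf φ) where
  left a x := by
    induction x using TensorProduct.induction_on with
    | zero => simp only [TensorProduct.tmul_zero, map_zero]
    | add y z hy hz => simp only [TensorProduct.tmul_add, map_add, hy, hz]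
    | tmul x b => exact ((cyc_isBimod A 2).left a x (φ.lin b)).symm
  right x b := by
    induction x using TensorProduct.induction_on with
    | zero => simp only [TensorProduct.zero_tmul, map_zero, smul_zero, add_zero]
    | add y z hy hz =>
      simp only [TensorProduct.add_tmul, map_add, hy, hz, smul_add]
      abel
    | tmul x a =>
      have e1 : (cycConnOf φ).lin ((cycR A 1).lin ((x ⊗ₜ a) ⊗ₜ b))
        = (cycL A 2).lin (x ⊗ₜ φ.lin ((a : A) * b))
          - (cycL A 2).lin (((x : A) * a) ⊗ₜ φ.lin b) := by
        change (cycConnOf φ).lin ((x : A) ⊗ₜ[k] ((a : A) * b) - ((x : A) * a) ⊗ₜ[k] b) = _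
        rw [map_sub]
        rfl
      have e2 : (cycConnOf φ).lin (x ⊗ₜ a) = (cycL A 2).lin (x ⊗ₜ φ.lin a) := rfl
      have e3 : (cycL A 2).lin (x ⊗ₜ (((1 : A) ⊗ₜ[k] a) ⊗ₜ[k] b))
          = ((x : A) ⊗ₜ[k] a) ⊗ₜ[k] b := by
        change (((x : A) * 1) ⊗ₜ[k] a) ⊗ₜ[k] b = _
        rw [mul_one]
      rw [e1, e2, hφ, TensorProduct.tmul_add, TensorProduct.tmul_add, map_add, map_add, e3,
        (cyc_isBimod A 2).left, (cyc_isBimod A 2).mid, one_smul]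
      change _ + (((x : A) ⊗ₜ[k] a) ⊗ₜ[k] b) - _ = _ + (((x : A) ⊗ₜ[k] a) ⊗ₜ[k] b)
      abel

/-- The connection `x da ↦ xφ(a)` on one-forms, for `φ(1)` degenerate. -/
def formsConnOf (φ : Hom A.toHRep (tpow A 2)) (h1 : (toForms A 2).lin (φ.lin (1 : A)) = 0) :
    Hom (forms A 1) (forms A 2) :=
  barLiftHom A ((toForms A 2).comp (cycConnOf φ)) (fun x => by
    change (toForms A 2).lin ((cycL A 2).lin (x ⊗ₜ φ.lin (1 : A))) = 0
    rw [toForms_cycL, h1, TensorProduct.tmul_zero, map_zero])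

theorem formsConnOf_toForms (φ : Hom A.toHRep (tpow A 2))
    (h1 : (toForms A 2).lin (φ.lin (1 : A)) = 0) (x : tpow A 1) :
    (formsConnOf φ h1).lin ((toForms A 1).lin x) = (toForms A 2).lin ((cycConnOf φ).lin x) := by
  induction x using TensorProduct.induction_on with
  | zero => simp only [map_zero]
  | add y z hy hz => simp only [map_add, hy, hz]
  | tmul x a => rfl

/-- The connection on forms is the image of the one on tensors, so both rules are transported along
the surjection `toForms`. -/
theorem formsConnOf_isConn {φ : Hom A.toHRep (tpow A 2)} (hφ : IsCochain φ)
    (h1 : (toForms A 2).lin (φ.lin (1 : A)) = 0) :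
    IsConn (A := A) A.mkBar (formsL A 1) (formsR A 1) (formsR A 2) 1 (formsConnOf φ h1) where
  left a x := by
    obtain ⟨x, rfl⟩ := toForms_surjective A 1 x
    rw [← toForms_cycL, formsConnOf_toForms, formsConnOf_toForms]
    refine (congrArg _ ((cycConnOf_isConn hφ).left a x)).trans ?_
    exact toForms_cycL A 2 a _
  right x a := by
    obtain ⟨x, rfl⟩ := toForms_surjective A 1 x
    rw [← toForms_cycR, formsConnOf_toForms, formsConnOf_toForms]
    refine (congrArg _ ((cycConnOf_isConn hφ).right x a)).trans ?_
    rw [map_add, map_smul]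
    exact congrArg (· + _) (toForms_cycR A 2 _ a)

end Connections

/-! ### Equivariant recursion on words in the tensor algebra. -/

section FreeRecursion

variable {k : Type u} {H : Type v} [Field k] [Ring H] [HopfAlgebra k H] {V : HRep.{u, v, w} k H}

/-- Induction on words, adding letters on the left. -/
theorem word_induction {p : TensorAlgebra k V → Prop} (h1 : p 1)
    (hsmul : ∀ (c : k) a, p a → p (c • a)) (hadd : ∀ a b, p a → p b → p (a + b))
    (hmul : ∀ v a, p a → p (TensorAlgebra.ι k v * a)) (a : TensorAlgebra k V) : p a := by
  -- Quantifying over the right factor makes multiplicative induction on `a` possible: a product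
  -- acts as two successive prefixes.
  have key : ∀ a b, p b → p (a * b) := by
    intro a
    induction a using TensorAlgebra.induction with
    | algebraMap c => exact fun b hb => by rw [← Algebra.smul_def]; exact hsmul c b hb
    | ι v => exact fun b hb => hmul v b hb
    | add a b ha hb => exact fun c hc => by rw [add_mul]; exact hadd _ _ (ha c hc) (hb c hc)
    | mul a b ha hb => exact fun c hc => by rw [mul_assoc]; exact ha _ (hb c hc)
  have h := key a 1 h1
  rwa [mul_one] at h

variable {E : HRep.{u, v, max u w} k H}
  (L : Hom (tens (freeAlg V).toHRep E) E)
  (G : Hom (tens (freeAlg V).toHRep (freeAlg V).toHRep) E) (e : E)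

/-- The action of words on `T(V) × E` underlying recursion on words. -/
def freeRecAux : TensorAlgebra k V →ₐ[k] Module.End k (TensorAlgebra k V × E) :=
  TensorAlgebra.lift k (LinearMap.mk₂ k (fun (v : V) (y : TensorAlgebra k V × E) =>
    ((TensorAlgebra.ι k v * y.1, L.lin (TensorAlgebra.ι k v ⊗ₜ y.2)
        + G.lin (TensorAlgebra.ι k v ⊗ₜ y.1)) : TensorAlgebra k V × E))
    (fun v v' y => by
      ext
      · simp only [map_add, add_mul, Prod.fst_add]
      · simp only [map_add, TensorProduct.add_tmul, Prod.snd_add]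
        abel)
    (fun c v y => by
      ext
      · simp only [map_smul, smul_mul_assoc, Prod.smul_fst]
      · simp only [map_smul, ← TensorProduct.smul_tmul', Prod.smul_snd, smul_add])
    (fun v y y' => by
      ext
      · simp only [mul_add, Prod.fst_add]
      · simp only [TensorProduct.tmul_add, map_add, Prod.snd_add, Prod.fst_add]
        abel)
    (fun c v y => by
      ext
      · simp only [mul_smul_comm, Prod.smul_fst]
      · simp only [TensorProduct.tmul_smul, map_smul, Prod.smul_snd, Prod.smul_fst, smul_add]))

/-- The linear map `f` on `T(V)` with `f(1) = e` and `f(va) = L(v ⊗ f(a)) + G(v ⊗ a)`. -/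
def freeRecLin : TensorAlgebra k V →ₗ[k] E :=
  LinearMap.snd k _ _ ∘ₗ (LinearMap.applyₗ ((1 : TensorAlgebra k V), e)) ∘ₗ
    (freeRecAux L G).toLinearMap

theorem freeRecLin_one : freeRecLin L G e 1 = e := by
  change (freeRecAux L G 1 ((1 : TensorAlgebra k V), e)).2 = e
  rw [map_one]
  rfl

theorem freeRecAux_ι (v : V) (y : TensorAlgebra k V × E) :
    freeRecAux L G (TensorAlgebra.ι k v) y = (TensorAlgebra.ι k v * y.1,
      L.lin (TensorAlgebra.ι k v ⊗ₜ y.2) + G.lin (TensorAlgebra.ι k v ⊗ₜ y.1)) := by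
  rw [freeRecAux, TensorAlgebra.lift_ι_apply]
  rfl

/-- The recursive rule involves the remaining word itself and not only the value already computed.
The first component of the pair remembers that word. -/
theorem freeRecAux_fst (a : TensorAlgebra k V) :
    (freeRecAux L G a ((1 : TensorAlgebra k V), e)).1 = a := by
  induction a using word_induction with
  | h1 => rw [map_one]; rfl
  | hsmul c a h => rw [map_smul, LinearMap.smul_apply, Prod.smul_fst, h]
  | hadd a b ha hb => rw [map_add, LinearMap.add_apply, Prod.fst_add, ha, hb]
  | hmul v a h => rw [map_mul, Module.End.mul_apply, freeRecAux_ι, h]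

theorem freeRecLin_mul (v : V) (a : TensorAlgebra k V) :
    freeRecLin L G e (TensorAlgebra.ι k v * a)
      = L.lin (TensorAlgebra.ι k v ⊗ₜ freeRecLin L G e a)
        + G.lin (TensorAlgebra.ι k v ⊗ₜ a) := by
  change (freeRecAux L G (TensorAlgebra.ι k v * a) ((1 : TensorAlgebra k V), e)).2 = _
  rw [map_mul, Module.End.mul_apply, freeRecAux_ι, freeRecAux_fst]
  rfl

/-- Recursion on words: the `H`-linear map `f` on `T(V)` with `f(1) = e` and
`f(va) = L(v ⊗ f(a)) + G(v ⊗ a)`, for an invariant element `e`. -/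
def freeRec (he : ∀ h, E.act h e = Coalgebra.counit (R := k) h • e) :
    Hom (freeAlg V).toHRep E where
  lin := freeRecLin L G e
  comm h a := by
    -- The action on `va` is diagonal, so the induction hypothesis is needed at the component
    -- `h⁽²⁾`.
    induction a using word_induction generalizing h with
    | h1 =>
      refine (congrArg _ ((freeAlg V).act_one h)).trans ?_
      rw [map_smul, freeRecLin_one, he]
    | hsmul c a ih => rw [map_smul, map_smul, ih, map_smul, map_smul]
    | hadd a b ha hb => rw [map_add, map_add, ha, hb, map_add, map_add]
    | hmul v a ih =>
      rw [freeRecLin_mul, map_add, ← L.comm, ← G.comm, tens_act, tens_act]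
      refine (congrArg _ ((freeAlg V).act_mul h (TensorAlgebra.ι k v) a)).trans ?_
      induction Coalgebra.comul (R := k) h with
      | zero => simp only [map_zero, add_zero]
      | add p q hp hq =>
        simp only [map_add, hp, hq]
        abel
      | tmul p q =>
        have e1 : (freeAlg V).act.toLinearMap.flip (TensorAlgebra.ι k v) p
          = TensorAlgebra.ι k (V.act p v) := freeAct_ι V p v
        simp only [TensorProduct.map_tmul]
        rw [e1, LinearMap.mul'_apply, freeRecLin_mul]
        exact congrArg (fun z => L.lin (TensorAlgebra.ι k (V.act p v) ⊗ₜ z) + _) (ih q)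

end FreeRecursion

/-! ### Exactness above degree one from a quasi-free cochain. -/

namespace MixedData

/-- The homology of `b` vanishes above degree `1`. -/
def ExactAbove {k : Type u} [Field k] (X : MixedData.{u, w} k) : Prop :=
  ∀ n t, X.b (n + 1) t = 0 → t ∈ LinearMap.range (X.b (n + 2))

end MixedData

section ConnectionExact

variable {k : Type u} {H : Type v} [Field k] [Ring H] [HopfAlgebra k H]
  {A : HAlg.{u, v, w} k H} {φ : Hom A.toHRep (tpow A 2)}

theorem toForms_cochain_one (h1 : φ.lin (1 : A) = -ones A 2) :
    (toForms A 2).lin (φ.lin (1 : A)) = 0 := by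
  rw [h1, map_neg, neg_eq_zero]
  change ((1 : A) ⊗ₜ[k] A.mkBar.lin (1 : A)) ⊗ₜ[k] A.mkBar.lin (1 : A) = 0
  rw [A.mkBar_one, TensorProduct.tmul_zero]

/-- The normalisation `φ(1) = -1 ⊗ 1 ⊗ 1` makes the connection preserve the scalar subcomplex, as
the reduced complex requires. -/
theorem cycConn_ones (h1 : φ.lin (1 : A) = -ones A 2) (n : ℕ) :
    (cycConn (cycConnOf φ) n).lin (ones A (n + 1))
    = -ones A (n + 2) := by
  induction n with
  | zero =>
    change (cycL A 2).lin ((1 : A) ⊗ₜ φ.lin (1 : A)) = _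
    rw [h1]
    exact cycL_one A 2 _
  | succ n ih =>
    change (cycConn (cycConnOf φ) n).lin (ones A (n + 1)) ⊗ₜ[k] (1 : A) = _
    rw [ih, TensorProduct.neg_tmul]
    rfl

variable (M : Type x) [AddCommGroup M] [Module k M] [Module Hᵐᵒᵖ M] [IsScalarTower k Hᵐᵒᵖ M]
  [LeftComodule k H M] [InvertibleAntipode k H] [IsSAYD k H M]

theorem cycMixed_exactAbove (hφ : IsCochain φ) : (cycMixed A M).ExactAbove := by
  intro n t ht
  change cycb A M (n + 1) t = 0 at ht
  have h := cycConn_homotopy (cycConnOf_isConn hφ) n t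
  rw [ht, map_zero, add_zero] at h
  exact ⟨-HTens.map (cycConn (cycConnOf φ) (n + 1)) t, by
    change cycb A M (n + 2) _ = t
    rw [map_neg, h, neg_neg]⟩

theorem formsMixed_exactAbove (hφ : IsCochain φ) (h1 : φ.lin (1 : A) = -ones A 2) :
    (formsMixed A M).ExactAbove := by
  intro n t ht
  change formsb A M (n + 1) t = 0 at ht
  have h := formsConn_homotopy (formsConnOf_isConn hφ (toForms_cochain_one h1)) n t
  rw [ht, map_zero, add_zero] at h
  exact ⟨-HTens.map (formsConn (formsConnOf φ (toForms_cochain_one h1)) (n + 1)) t, by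
    change formsb A M (n + 2) _ = t
    rw [map_neg, h, neg_neg]⟩

/-- A reduced cycle lifts to `t` with `bt` scalar only. The homotopy then gives `b(-∇t) - t =
∇(bt)`, and this is scalar because `∇` sends units to units up to sign. -/
theorem redCycMixed_exactAbove (hφ : IsCochain φ) (h1 : φ.lin (1 : A) = -ones A 2) :
    (redCycMixed A M).ExactAbove := by
  intro n t ht
  obtain ⟨t, rfl⟩ := Submodule.mkQ_surjective _ t
  have ht : cycb A M (n + 1) t ∈ scalarPart A M (n + 1) := (Submodule.Quotient.mk_eq_zero _).1 ht
  have h := cycConn_homotopy (cycConnOf_isConn hφ) n t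
  refine ⟨Submodule.Quotient.mk (-HTens.map (cycConn (cycConnOf φ) (n + 1)) t),
    (Submodule.Quotient.eq _).2 ?_⟩
  have e : cycb A M (n + 2) (-HTens.map (cycConn (cycConnOf φ) (n + 1)) t) - t
      = HTens.map (cycConn (cycConnOf φ) n) (cycb A M (n + 1) t) := by
    rw [← neg_eq_iff_eq_neg] at h
    rw [map_neg]
    nth_rewrite 2 [← h]
    abel
  change cycb A M (n + 2) (-HTens.map (cycConn (cycConnOf φ) (n + 1)) t) - t ∈ _
  rw [e]
  obtain ⟨m, hm⟩ := ht
  rw [← hm, LinearMap.flip_apply, HTens.map_mk, cycConn_ones h1, map_neg]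
  exact Submodule.neg_mem _ (mk_ones_mem _ _ m)

end ConnectionExact

/-! ### Quasi-freeness of the tensor algebra. -/

section FreeCochain

variable {k : Type u} {H : Type v} [Field k] [Ring H] [HopfAlgebra k H]

theorem ones_invariant (A : HAlg.{u, v, w} k H) (n : ℕ) (h : H) :
    (tpow A n).act h (ones A n) = Coalgebra.counit (R := k) h • ones A n := by
  induction n with
  | zero => exact A.act_one h
  | succ n ih =>
    refine ((A.insOne (tpow A n)).comm h (ones A n)).symm.trans ?_
    rw [ih, map_smul]
    rfl

variable (V : HRep.{u, v, w} k H)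

/-- The map `φ` on `T(V)` with `φ(1) = -1 ⊗ 1 ⊗ 1` and
`φ(va) = vφ(a) + v ⊗ 1 ⊗ a + 1 ⊗ v ⊗ a`. -/
def freeCochain : Hom (freeAlg V).toHRep (tpow (freeAlg V) 2) :=
  freeRec (cycL (freeAlg V) 2)
    ((((freeAlg V).insOne (freeAlg V).toHRep).tmap (Hom.id _)).add
      (((freeAlg V).oneIns (freeAlg V).toHRep).tmap (Hom.id _)))
    (-ones (freeAlg V) 2) (fun h => by rw [map_neg, ones_invariant, smul_neg])

theorem freeCochain_one : (freeCochain V).lin (1 : TensorAlgebra k V) = -ones (freeAlg V) 2 :=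
  freeRecLin_one _ _ _

/-- This is the cochain identity for a letter times a word. The recursion gives `φ(v) = 1 ⊗ v ⊗ 1`,
and in the signed right multiplication `φ(v)a = v ⊗ 1 ⊗ a`. On forms the corresponding connection
satisfies `∇(dv) = 0`. -/
theorem freeCochain_mul (v : V) (a : TensorAlgebra k V) :
    (freeCochain V).lin (TensorAlgebra.ι k v * a)
      = (cycL (freeAlg V) 2).lin ((TensorAlgebra.ι k v) ⊗ₜ (freeCochain V).lin a)
        + ((TensorAlgebra.ι k v ⊗ₜ[k] (1 : TensorAlgebra k V)) ⊗ₜ[k] a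
          + ((1 : TensorAlgebra k V) ⊗ₜ[k] TensorAlgebra.ι k v) ⊗ₜ[k] a) :=
  freeRecLin_mul _ _ _ v a

theorem cycR_two (A : HAlg.{u, v, w} k H) (a b c d : A) :
    (cycR A 2).lin (((a ⊗ₜ[k] b) ⊗ₜ[k] c) ⊗ₜ[k] d)
      = (a ⊗ₜ[k] b) ⊗ₜ[k] (c * d) - (a ⊗ₜ[k] (b * c)) ⊗ₜ[k] d + ((a * b) ⊗ₜ[k] c) ⊗ₜ[k] d := by
  change (a ⊗ₜ[k] b) ⊗ₜ[k] (c * d) - (a ⊗ₜ[k] (b * c) - (a * b) ⊗ₜ[k] c) ⊗ₜ[k] d = _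
  rw [TensorProduct.sub_tmul]
  abel

/-- Induction on the left word `a`. For `a = 1` the value `φ(1) = -1 ⊗ 1 ⊗ 1` cancels the term `1 ⊗
1 ⊗ b`. For a longer word the extra terms of the two expansions agree after expanding the right
multiplication by `cycR_two`. -/
theorem freeCochain_isCochain : IsCochain (A := freeAlg V) (freeCochain V) := by
  intro a b
  have hL := (cyc_isBimod (freeAlg V) 2).left
  have hM := (cyc_isBimod (freeAlg V) 2).mid
  induction a using word_induction with
  | h1 =>
    have e1 : (cycL (freeAlg V) 2).lin ((1 : TensorAlgebra k V) ⊗ₜ (freeCochain V).lin b)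
      = (freeCochain V).lin b := cycL_one (freeAlg V) 2 _
    have e2 := cycR_two (freeAlg V) 1 1 1 b
    rw [freeCochain_one, TensorProduct.neg_tmul, map_neg, e1]
    change _ = _ + -(cycR (freeAlg V) 2).lin (((1 ⊗ₜ[k] 1) ⊗ₜ[k] 1) ⊗ₜ[k] b) + _
    rw [e2, one_mul, one_mul]
    abel
  | hsmul c a h =>
    rw [smul_mul_assoc, map_smul, map_smul, h, ← TensorProduct.smul_tmul',
      ← TensorProduct.smul_tmul', TensorProduct.tmul_smul, ← TensorProduct.smul_tmul', map_smul,
      map_smul, smul_add, smul_add]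
  | hadd a a' h h' =>
    rw [add_mul, map_add, map_add, h, h', TensorProduct.add_tmul, TensorProduct.add_tmul,
      TensorProduct.tmul_add, TensorProduct.add_tmul, map_add, map_add]
    abel
  | hmul v a h =>
    rw [mul_assoc, freeCochain_mul, freeCochain_mul, h, TensorProduct.tmul_add,
      TensorProduct.tmul_add, map_add, map_add, hL, TensorProduct.add_tmul, map_add, hM,
      TensorProduct.add_tmul, map_add]
    have e1 := cycR_two (freeAlg V) (TensorAlgebra.ι k v) 1 a b
    have e2 := cycR_two (freeAlg V) 1 (TensorAlgebra.ι k v) a b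
    have e3 : (cycL (freeAlg V) 2).lin (TensorAlgebra.ι k v ⊗ₜ
        (((1 : TensorAlgebra k V) ⊗ₜ[k] a) ⊗ₜ[k] b))
        = ((TensorAlgebra.ι k v * 1) ⊗ₜ[k] a) ⊗ₜ[k] b := rfl
    rw [e1, e2, e3, one_mul, one_mul, mul_one]
    abel

end FreeCochain

/-! ### Invertibility of operators spanned by eigenvectors. -/

section Eigenvectors

/-- An endomorphism preserving `K` which has only eigenvectors of nonzero eigenvalue modulo `K` is
bijective modulo `K`. -/
theorem bijective_modulo {k P : Type*} [Field k] [AddCommGroup P] [Module k P] (T : Module.End k P)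
    (K : Submodule k P) (hK : ∀ y ∈ K, T y ∈ K)
    (hs : ⊤ ≤ Submodule.span k {y | y ∈ K ∨ ∃ c : k, c ≠ 0 ∧ T y = c • y}) :
    (∀ y, T y ∈ K → y ∈ K) ∧ ∀ y, ∃ z, y - T z ∈ K := by
  let T' : Module.End k (P ⧸ K) := K.mapQ K T hK
  have htop : ⨆ c ∈ {c : k | c ≠ 0}, Module.End.eigenspace T' c = ⊤ := by
    rw [eq_top_iff]
    rintro y -
    obtain ⟨y, rfl⟩ := Submodule.mkQ_surjective _ y
    induction hs (Submodule.mem_top : y ∈ ⊤) using Submodule.span_induction with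
    | mem y hy =>
      rcases hy with hy | ⟨c, hc, hy⟩
      · rw [show K.mkQ y = 0 from (Submodule.Quotient.mk_eq_zero K).2 hy]
        exact Submodule.zero_mem _
      · refine Submodule.mem_iSup_of_mem c (Submodule.mem_iSup_of_mem hc ?_)
        rw [Module.End.mem_eigenspace_iff]
        exact congrArg K.mkQ hy
    | zero => rw [map_zero]; exact Submodule.zero_mem _
    | add y z _ _ hy hz => rw [map_add]; exact Submodule.add_mem _ hy hz
    | smul c y _ hy => rw [map_smul]; exact Submodule.smul_mem _ _ hy
  constructor
  · intro y hy
    have h0 : K.mkQ y ∈ Module.End.eigenspace T' 0 := by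
      rw [Module.End.mem_eigenspace_iff, zero_smul]
      exact (Submodule.Quotient.mk_eq_zero K).2 hy
    -- Independence of eigenspaces: the kernel meets the sum of the nonzero eigenspaces trivially,
    -- and that sum is the whole quotient.
    have hd := (Module.End.eigenspaces_iSupIndep T').disjoint_biSup
      (x := (0 : k)) (y := {c : k | c ≠ 0}) (fun h => h rfl)
    rw [htop, disjoint_top] at hd
    rw [hd, Submodule.mem_bot] at h0
    exact (Submodule.Quotient.mk_eq_zero K).1 h0
  · intro y
    induction hs (Submodule.mem_top : y ∈ ⊤) using Submodule.span_induction with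
    | mem y hy =>
      rcases hy with hy | ⟨c, hc, hy⟩
      · exact ⟨0, by rwa [map_zero, sub_zero]⟩
      · refine ⟨c⁻¹ • y, ?_⟩
        rw [map_smul, hy, inv_smul_smul₀ hc, sub_self]
        exact K.zero_mem
    | zero => exact ⟨0, by rw [map_zero, sub_zero]; exact K.zero_mem⟩
    | add y z _ _ hy hz =>
      obtain ⟨y', hy⟩ := hy
      obtain ⟨z', hz⟩ := hz
      refine ⟨y' + z', ?_⟩
      rw [map_add, add_sub_add_comm]
      exact K.add_mem hy hz
    | smul c y _ hy =>
      obtain ⟨y', hy⟩ := hy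
      exact ⟨c • y', by rw [map_smul, ← smul_sub]; exact K.smul_mem c hy⟩

end Eigenvectors

/-! ### Double derivations and a Cartan homotopy formula in degrees zero and one. -/

section DoubleDerivations

variable {k : Type u} {H : Type v} [Field k] [Ring H] [HopfAlgebra k H]
  {A : HAlg.{u, v, w} k H}

variable (A) in
/-- The multiplication `(a ⊗ b) ⊗ c ↦ a ⊗ bc`. -/
def mulRight : Hom (tens (tens A.toHRep A.toHRep) A.toHRep) (tens A.toHRep A.toHRep) :=
  ((Hom.id A.toHRep).tmap A.mul).comp (assoc A.toHRep A.toHRep A.toHRep)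

variable (A) in
/-- The multiplication `a ⊗ (b ⊗ c) ↦ ab ⊗ c`. -/
def mulLeft : Hom (tens A.toHRep (tens A.toHRep A.toHRep)) (tens A.toHRep A.toHRep) :=
  tensL A A.mul A.toHRep

theorem mulRight_tmul (a b c : A) : (mulRight A).lin ((a ⊗ₜ[k] b) ⊗ₜ[k] c) = a ⊗ₜ[k] (b * c) := rfl

theorem mulLeft_tmul (a b c : A) : (mulLeft A).lin (a ⊗ₜ[k] (b ⊗ₜ[k] c)) = (a * b) ⊗ₜ[k] c := rfl

/-- A double derivation `δ : A → A ⊗ A`, `δ(ab) = δ(a)b + aδ(b)`. -/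
def IsDoubleDer (δ : Hom A.toHRep (tens A.toHRep A.toHRep)) : Prop :=
  ∀ a b : A, δ.lin (a * b) = (mulRight A).lin (δ.lin a ⊗ₜ b) + (mulLeft A).lin (a ⊗ₜ δ.lin b)

/-- The derivation `a ↦ δ(a)′δ(a)″`. -/
def contract (δ : Hom A.toHRep (tens A.toHRep A.toHRep)) : Hom A.toHRep A.toHRep := A.mul.comp δ

theorem contract_mul {δ : Hom A.toHRep (tens A.toHRep A.toHRep)} (hδ : IsDoubleDer δ) (a b : A) :
    (contract δ).lin (a * b) = (contract δ).lin a * b + a * (contract δ).lin b := by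
  have e1 : ∀ y : A ⊗[k] A, A.mul.lin ((mulRight A).lin (y ⊗ₜ b)) = A.mul.lin y * b := by
    intro y
    induction y using TensorProduct.induction_on with
    | zero => simp only [TensorProduct.zero_tmul, map_zero, zero_mul]
    | add y z hy hz => simp only [TensorProduct.add_tmul, map_add, hy, hz, add_mul]
    | tmul c d => exact (mul_assoc (c : A) d b).symm
  have e2 : ∀ y : A ⊗[k] A, A.mul.lin ((mulLeft A).lin (a ⊗ₜ y)) = a * A.mul.lin y := by
    intro y
    induction y using TensorProduct.induction_on with
    | zero => simp only [TensorProduct.tmul_zero, map_zero, mul_zero]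
    | add y z hy hz => simp only [TensorProduct.tmul_add, map_add, hy, hz, mul_add]
    | tmul c d => exact mul_assoc (a : A) c d
  change A.mul.lin (δ.lin (a * b)) = _
  rw [hδ, map_add, e1, e2]
  rfl

theorem doubleDer_one {δ : Hom A.toHRep (tens A.toHRep A.toHRep)} (hδ : IsDoubleDer δ) :
    δ.lin (1 : A) = 0 := by
  have h := hδ 1 1
  have e1 : ∀ y : A ⊗[k] A, (mulRight A).lin (y ⊗ₜ (1 : A)) = y := by
    intro y
    induction y using TensorProduct.induction_on with
    | zero => simp only [TensorProduct.zero_tmul, map_zero]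
    | add y z hy hz => simp only [TensorProduct.add_tmul, map_add, hy, hz]
    | tmul c d => rw [mulRight_tmul, mul_one]
  have e2 : ∀ y : A ⊗[k] A, (mulLeft A).lin ((1 : A) ⊗ₜ y) = y := by
    intro y
    induction y using TensorProduct.induction_on with
    | zero => simp only [TensorProduct.tmul_zero, map_zero]
    | add y z hy hz => simp only [TensorProduct.tmul_add, map_add, hy, hz]
    | tmul c d => rw [mulLeft_tmul, one_mul]
  rw [e1, e2, mul_one] at h
  exact left_eq_add.1 h

theorem contract_one {δ : Hom A.toHRep (tens A.toHRep A.toHRep)} (hδ : IsDoubleDer δ) :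
    (contract δ).lin (1 : A) = 0 :=
  (congrArg A.mul.lin (doubleDer_one hδ)).trans (map_zero _)

variable (A) (M : Type x) [AddCommGroup M] [Module k M] [Module Hᵐᵒᵖ M] [IsScalarTower k Hᵐᵒᵖ M]
  [LeftComodule k H M] [InvertibleAntipode k H] [IsSAYD k H M]

/-- The twisted commutators `M ⊗_H A^{⊗2} → M ⊗_H A`. -/
abbrev comm₀ : HTens M (tens A.toHRep A.toHRep) →ₗ[k] HTens M A.toHRep :=
  commutator A M A.mul A.mul

/-- The map `m ⊗ a ⊗ b ⊗ c ↦ m ⊗ a ⊗ bc - m ⊗ ab ⊗ c - m⁽⁰⁾ ⊗ S⁻¹(m⁽⁻¹⁾)(c)a ⊗ b`. -/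
abbrev comm₁ : HTens M (tens (tens A.toHRep A.toHRep) A.toHRep) →ₗ[k]
    HTens M (tens A.toHRep A.toHRep) :=
  commutator A M (mulLeft A) (tensR A A.mul)

variable {A M}

theorem comm₁_apply (t : HTens M (tens (tens A.toHRep A.toHRep) A.toHRep)) :
    comm₁ A M t = HTens.map (mulRight A) t - HTens.map (A.mul.tmap (Hom.id A.toHRep)) t
      - HTens.map (mulLeft A) (HTens.swap _ A.toHRep t) := by
  rw [comm₁, commutator_apply, tensR, HTens.map_sub_hom]
  rfl

theorem comm₀_comm₁ (t : HTens M (tens (tens A.toHRep A.toHRep) A.toHRep)) :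
    comm₀ A M (comm₁ A M t) = 0 := (mul_isBimod A).commutator_commutator t

variable {δ : Hom A.toHRep (tens A.toHRep A.toHRep)}

/-- The Leibniz rule for `δ` yields a right and a left product. Those of `δ(a)` in the commutator
are the two outer terms of `comm₁`, whose middle term contributes `D(a) ⊗ b`. The products involving
`δ(b)` give the same expression for the flipped tensor. -/
theorem doubleDer_comm₀ (hδ : IsDoubleDer δ) (t : HTens M (tens A.toHRep A.toHRep)) :
    HTens.map δ (comm₀ A M t) = HTens.map ((contract δ).tmap (Hom.id A.toHRep)) t
      - HTens.map ((contract δ).tmap (Hom.id A.toHRep)) (HTens.swap _ _ t)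
      + comm₁ A M (HTens.map (δ.tmap (Hom.id A.toHRep)) (t - HTens.swap _ _ t)) := by
  have e1 : ∀ s : HTens M (tens A.toHRep A.toHRep), HTens.map δ (HTens.map A.mul s)
      = HTens.map (mulRight A) (HTens.map (δ.tmap (Hom.id A.toHRep)) s)
        + HTens.map (mulLeft A) (HTens.map ((Hom.id A.toHRep).tmap δ) s) := by
    intro s
    rw [← HTens.map_comp, ← HTens.map_comp, ← HTens.map_comp, ← HTens.map_add_hom]
    exact HTens.map_congr (TensorProduct.ext' fun a b => hδ a b) s
  have e2 : ∀ s : HTens M (tens A.toHRep A.toHRep),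
      HTens.map (A.mul.tmap (Hom.id A.toHRep)) (HTens.map (δ.tmap (Hom.id A.toHRep)) s)
      = HTens.map ((contract δ).tmap (Hom.id A.toHRep)) s := by
    intro s
    rw [← HTens.map_comp]
    exact HTens.map_congr (by exact TensorProduct.ext' fun a b => rfl) s
  rw [commutator_apply, map_sub, map_sub, map_sub, e1, e1, comm₁_apply, comm₁_apply, e2, e2,
    HTens.swap_map, HTens.swap_map, HTens.swap_swap_self]
  abel

/-- The Leibniz rule `d(ab) = a db + (da)b` modulo commutators, where `(da)b` is the flip of `a ⊗
b`. -/
theorem oneIns_mul (t : HTens M (tens A.toHRep A.toHRep)) :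
    HTens.map (A.oneIns A.toHRep) (HTens.map A.mul t) = t + HTens.swap _ _ t
      + comm₁ A M (HTens.map ((A.oneIns A.toHRep).tmap (Hom.id A.toHRep)) t) := by
  have e1 : HTens.map (mulRight A) (HTens.map ((A.oneIns A.toHRep).tmap (Hom.id A.toHRep)) t)
      = HTens.map (A.oneIns A.toHRep) (HTens.map A.mul t) := by
    rw [← HTens.map_comp, ← HTens.map_comp]
    exact HTens.map_congr (by exact TensorProduct.ext' fun a b => rfl) t
  have e2 : HTens.map (A.mul.tmap (Hom.id A.toHRep))
      (HTens.map ((A.oneIns A.toHRep).tmap (Hom.id A.toHRep)) t) = t := by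
    rw [← HTens.map_comp]
    refine (HTens.map_congr (g := Hom.id _) (TensorProduct.ext' fun a b => ?_) t).trans
      (HTens.map_id t)
    change ((1 : A) * a) ⊗ₜ[k] b = a ⊗ₜ[k] b
    rw [one_mul]
  have e3 : ∀ s : HTens M (tens A.toHRep A.toHRep),
      HTens.map (mulLeft A) (HTens.map ((Hom.id A.toHRep).tmap (A.oneIns A.toHRep)) s) = s := by
    intro s
    rw [← HTens.map_comp]
    refine (HTens.map_congr (g := Hom.id _) (TensorProduct.ext' fun a b => ?_) s).trans
      (HTens.map_id s)
    change ((a : A) * 1) ⊗ₜ[k] b = a ⊗ₜ[k] b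
    rw [mul_one]
  rw [comm₁_apply, e1, e2, HTens.swap_map, e3]
  abel

/-- `a d1 = 0` holds already in homology: `a ⊗ 1` is minus the boundary of `a ⊗ 1 ⊗ 1`, all three
terms of which are equal. -/
theorem insOne_mem (t : HTens M A.toHRep) :
    HTens.map (A.insOne A.toHRep) t ∈ LinearMap.range (comm₁ A M) := by
  let t' := HTens.map (A.insOne (tens A.toHRep A.toHRep)) (HTens.map (A.insOne A.toHRep) t)
  refine ⟨-t', ?_⟩
  have e1 : HTens.map (mulRight A) t' = HTens.map (A.insOne A.toHRep) t := by
    rw [← HTens.map_comp, ← HTens.map_comp]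
    refine HTens.map_congr (LinearMap.ext fun a => ?_) t
    change (a : A) ⊗ₜ[k] ((1 : A) * 1) = a ⊗ₜ[k] (1 : A)
    rw [one_mul]
  have e2 : HTens.map (A.mul.tmap (Hom.id A.toHRep)) t' = HTens.map (A.insOne A.toHRep) t := by
    rw [← HTens.map_comp, ← HTens.map_comp]
    refine HTens.map_congr (LinearMap.ext fun a => ?_) t
    change ((a : A) * 1) ⊗ₜ[k] (1 : A) = a ⊗ₜ[k] (1 : A)
    rw [mul_one]
  have e3 : HTens.map (mulLeft A) (HTens.swap _ A.toHRep t') = HTens.map (A.insOne A.toHRep) t := by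
    rw [HTens.swap_insOne, ← HTens.map_comp, ← HTens.map_comp]
    refine HTens.map_congr (LinearMap.ext fun a => ?_) t
    change ((1 : A) * a) ⊗ₜ[k] (1 : A) = a ⊗ₜ[k] (1 : A)
    rw [one_mul]
  rw [map_neg, comm₁_apply, e1, e2, e3]
  abel

variable (M) in
/-- The derivation induced by `δ` on `M ⊗_H A^{⊗2}`. -/
def lieTwo (δ : Hom A.toHRep (tens A.toHRep A.toHRep)) :
    Module.End k (HTens M (tens A.toHRep A.toHRep)) :=
  HTens.map ((contract δ).tmap (Hom.id A.toHRep)) + HTens.map ((Hom.id A.toHRep).tmap (contract δ))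

/-- `m ⊗ a ⊗ b ↦ m ⊗ aD(b)`. -/
def inner (δ : Hom A.toHRep (tens A.toHRep A.toHRep)) : Hom (tens A.toHRep A.toHRep) A.toHRep :=
  A.mul.comp ((Hom.id A.toHRep).tmap (contract δ))

theorem lieTwo_apply (t : HTens M (tens A.toHRep A.toHRep)) : lieTwo M δ t
    = HTens.map ((contract δ).tmap (Hom.id A.toHRep)) t
      + HTens.map ((Hom.id A.toHRep).tmap (contract δ)) t := rfl

/-- The homotopy formula for the action of the derivation on `M ⊗_H A^{⊗2}` modulo boundaries. -/
theorem lieTwo_homotopy (hδ : IsDoubleDer δ) (t : HTens M (tens A.toHRep A.toHRep)) :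
    lieTwo M δ t - HTens.map (A.oneIns A.toHRep) (HTens.map (inner δ) t)
      - HTens.map δ (comm₀ A M t) ∈ LinearMap.range (comm₁ A M) := by
  -- The Leibniz rule gives `d(aD(b)) ≡ a ⊗ D(b)` plus its flip. The flipped term cancels the
  -- negative term of `δ` applied to the commutator, and `D ⊗ 1 + 1 ⊗ D` remains.
  rw [inner, HTens.map_comp, oneIns_mul, doubleDer_comm₀ hδ, HTens.swap_map, lieTwo_apply]
  refine ⟨-(HTens.map ((A.oneIns A.toHRep).tmap (Hom.id A.toHRep))
    (HTens.map ((Hom.id A.toHRep).tmap (contract δ)) t))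
    - HTens.map (δ.tmap (Hom.id A.toHRep)) (t - HTens.swap _ _ t), ?_⟩
  rw [map_sub, map_neg]
  abel

/-- Contraction of one-forms with `D` is well defined modulo commutators, because `D` is a
derivation. -/
theorem inner_comm₁ (hδ : IsDoubleDer δ) (t : HTens M (tens (tens A.toHRep A.toHRep) A.toHRep)) :
    HTens.map (inner δ) (comm₁ A M t)
      = comm₀ A M (HTens.map ((inner δ).tmap (Hom.id A.toHRep)) t) := by
  have e1 : HTens.map (inner δ) (HTens.map (mulRight A) t)
      = HTens.map (inner δ) (HTens.map (A.mul.tmap (Hom.id A.toHRep)) t)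
        + HTens.map A.mul (HTens.map ((inner δ).tmap (Hom.id A.toHRep)) t) := by
    rw [← HTens.map_comp, ← HTens.map_comp, ← HTens.map_comp, ← HTens.map_add_hom]
    refine HTens.map_congr (TensorProduct.ext_threefold fun a b c => ?_) t
    change (a : A) * (contract δ).lin ((b : A) * c)
      = ((a : A) * b) * (contract δ).lin c + (a * (contract δ).lin b) * c
    rw [contract_mul hδ, mul_add, mul_assoc, mul_assoc, add_comm]
  have e2 : ∀ s : HTens M (tens A.toHRep (tens A.toHRep A.toHRep)),
      HTens.map (inner δ) (HTens.map (mulLeft A) s)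
      = HTens.map A.mul (HTens.map ((Hom.id A.toHRep).tmap (inner δ)) s) := by
    intro s
    rw [← HTens.map_comp, ← HTens.map_comp]
    exact HTens.map_congr (tensor_ext_right fun a b c => mul_assoc (a : A) b _) s
  rw [comm₁_apply, map_sub, map_sub, e1, e2, commutator_apply, HTens.swap_map]
  abel

theorem comm₀_lieTwo (hδ : IsDoubleDer δ) (t : HTens M (tens A.toHRep A.toHRep)) :
    comm₀ A M (lieTwo M δ t) = HTens.map (contract δ) (comm₀ A M t) := by
  have e1 : ∀ s : HTens M (tens A.toHRep A.toHRep),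
      HTens.map (contract δ) (HTens.map A.mul s)
      = HTens.map A.mul (HTens.map ((contract δ).tmap (Hom.id A.toHRep)) s)
        + HTens.map A.mul (HTens.map ((Hom.id A.toHRep).tmap (contract δ)) s) := by
    intro s
    rw [← HTens.map_comp, ← HTens.map_comp, ← HTens.map_comp, ← HTens.map_add_hom]
    exact HTens.map_congr (TensorProduct.ext' fun a b => contract_mul hδ a b) s
  rw [lieTwo_apply, map_add, commutator_apply, commutator_apply, commutator_apply, map_sub, e1, e1,
    HTens.swap_map, HTens.swap_map]
  abel

theorem inner_oneIns (t : HTens M A.toHRep) :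
    HTens.map (inner δ) (HTens.map (A.oneIns A.toHRep) t) = HTens.map (contract δ) t := by
  rw [← HTens.map_comp]
  exact HTens.map_congr (LinearMap.ext fun a => one_mul ((contract δ).lin a : A)) t

end DoubleDerivations

/-! ### Solving `(b + B)z = x` degree by degree in a mixed complex. -/

namespace MixedData

variable {k : Type u} [Field k] {X Y : MixedData.{u, w} k}

theorem D_zero (x : ∀ n, X.obj n) : X.D x 0 = X.b 0 (x 1) := rfl

theorem D_succ (x : ∀ n, X.obj n) (n : ℕ) :
    X.D x (n + 1) = X.b (n + 1) (x (n + 2)) + X.B n (x n) := rfl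

theorem IsMixed.B_D (hX : X.IsMixed) (x : ∀ n, X.obj n) (n : ℕ) :
    X.B n (X.D x n) = X.B n (X.b n (x (n + 1))) := by
  cases n with
  | zero => rfl
  | succ n => rw [D_succ, map_add, hX.B_B, add_zero]

theorem IsMixed.D_D (hX : X.IsMixed) (x : ∀ n, X.obj n) : X.D (X.D x) = 0 := by
  funext n
  cases n with
  | zero =>
    rw [D_zero, D_succ, map_add, hX.b_b, hX.b_B_zero, add_zero]
    rfl
  | succ n =>
    rw [D_succ, D_succ, hX.B_D, map_add, hX.b_b, zero_add, hX.b_B_add]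
    rfl

open Classical in
/-- A preimage under `b`, if there is one. -/
def preim (n : ℕ) (y : X.obj n) : X.obj (n + 1) :=
  if h : y ∈ LinearMap.range (X.b n) ∧ y ≠ 0 then h.1.choose else 0

/-- A preimage of zero is chosen to be zero so that the recursive solution stays in one parity. -/
theorem preim_zero (n : ℕ) : preim n (0 : X.obj n) = 0 := dif_neg fun h => h.2 rfl

theorem b_preim {n : ℕ} {y : X.obj n} (h : y ∈ LinearMap.range (X.b n)) :
    X.b n (preim n y) = y := by
  by_cases h0 : y = 0
  · rw [h0, preim_zero, map_zero]
  · rw [preim, dif_pos ⟨h, h0⟩]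
    exact (⟨h, h0⟩ : _ ∧ _).1.choose_spec

/-- The recursive solution of `(b + B)z = x` with prescribed components of degrees `0` and `1`. -/
def solution (x : ∀ n, X.obj n) (z₀ : X.obj 0) (z₁ : X.obj 1) : ∀ n, X.obj n
  | 0 => z₀
  | 1 => z₁
  | n + 2 => preim (n + 1) (x (n + 1) - X.B n (solution x z₀ z₁ n))

theorem solution_parity {x : ∀ n, X.obj n} {z₀ : X.obj 0} {z₁ : X.obj 1} {ν : ℕ}
    (hx : x ∈ X.parity ν) (h₀ : 0 % 2 ≠ (ν + 1) % 2 → z₀ = 0)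
    (h₁ : 1 % 2 ≠ (ν + 1) % 2 → z₁ = 0) : solution x z₀ z₁ ∈ X.parity (ν + 1) := by
  have key : ∀ i, (i % 2 ≠ (ν + 1) % 2 → solution x z₀ z₁ i = 0) := by
    intro i
    induction i using Nat.twoStepInduction with
    | zero => exact h₀
    | one => exact h₁
    | more i ih _ =>
      intro h
      rw [solution, ih (by omega), hx (i + 1) (by omega), map_zero, sub_zero, preim_zero]
  exact key

/-- The obstruction in degree `i + 2` is a `b`-cycle: `(b + B)x = 0` and `bB = -Bb` show that `b`
kills `x - Bz` there, and exactness supplies the next component. The bound `n` lets the same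
statement serve truncated total complexes and full products. -/
theorem D_solution (hX : X.IsMixed) (hE : X.ExactAbove) {x : ∀ n, X.obj n} {z₀ : X.obj 0}
    {z₁ : X.obj 1} (h₀ : X.b 0 z₁ = x 0) (h₁ : x 1 - X.B 0 z₀ ∈ LinearMap.range (X.b 1)) (n : ℕ)
    (hx : ∀ i < n, X.D x i = 0) : ∀ i ≤ n, X.D (solution x z₀ z₁) i = x i := by
  intro i
  induction i using Nat.twoStepInduction with
  | zero => exact fun _ => h₀
  | one =>
    intro _
    rw [D_succ]
    change X.b 1 (preim 1 (x 1 - X.B 0 z₀)) + X.B 0 z₀ = x 1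
    rw [b_preim h₁, sub_add_cancel]
  | more i ih _ =>
    intro hi
    have e : x (i + 2) - X.B (i + 1) (solution x z₀ z₁ (i + 1)) ∈ LinearMap.range (X.b (i + 2)) := by
      refine hE i _ ?_
      have h2 := hx (i + 1) (by omega)
      rw [D_succ, ← ih (by omega), hX.B_D] at h2
      rw [map_sub, eq_neg_of_add_eq_zero_left (hX.b_B_add i _), sub_neg_eq_add, h2]
    rw [D_succ, solution, b_preim e, sub_add_cancel]

/-- Vanishing of cyclic homology in positive degrees, for `B` inducing an isomorphism from the
homology of `b` in degree `0` onto that in degree `1`. -/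
theorem HC_subsingleton (hX : X.IsMixed) (hE : X.ExactAbove)
    (h₁ : ∀ t, X.b 0 t = 0 → ∃ y, t - X.B 0 y ∈ LinearMap.range (X.b 1))
    (h₀ : ∀ t, X.B 0 t ∈ LinearMap.range (X.b 1) → t ∈ LinearMap.range (X.b 0))
    (n : ℕ) (hn : 1 ≤ n) : Subsingleton (X.HC n) := by
  refine Submodule.Quotient.subsingleton_iff.2 (eq_top_iff.2 ?_)
  rintro ⟨x, hx, hxD⟩ -
  have hxD : ∀ i < n, X.D x i = 0 := fun i hi => by
    have e := congrFun (LinearMap.mem_ker.1 hxD) i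
    simpa [totD, hi] using e
  have hxn : x ∈ X.parity n := fun i hi => hx i fun h => hi h.2
  obtain ⟨z₀, z₁, hz₀, hz₁, e₀, e₁⟩ : ∃ (z₀ : X.obj 0) (z₁ : X.obj 1),
      (0 % 2 ≠ (n + 1) % 2 → z₀ = 0) ∧ (1 % 2 ≠ (n + 1) % 2 → z₁ = 0) ∧ X.b 0 z₁ = x 0 ∧
        x 1 - X.B 0 z₀ ∈ LinearMap.range (X.b 1) := by
    -- The exactness hypothesis does not cover the two lowest degrees. For `n` even, `Bx₀ = -bx₂`,
    -- so `x₀` bounds by `h₀`. For `n` odd, `x₁` is a `b`-cycle and `h₁` provides the component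
    -- `z₀`.
    rcases Nat.mod_two_eq_zero_or_one n with h | h
    · have e : x 0 ∈ LinearMap.range (X.b 0) := by
        refine h₀ _ ⟨-x 2, ?_⟩
        have e := hxD 1 (by omega)
        rw [D_succ] at e
        rw [map_neg, neg_eq_of_add_eq_zero_right e]
      obtain ⟨z₁, hz₁⟩ := e
      refine ⟨0, z₁, fun _ => rfl, fun h => by omega, hz₁, ?_⟩
      rw [hxn 1 (by omega), map_zero, sub_zero]
      exact Submodule.zero_mem _
    · obtain ⟨y, hy⟩ := h₁ (x 1) (hxD 0 (by omega))
      refine ⟨y, 0, fun h => by omega, fun _ => rfl, ?_, hy⟩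
      rw [map_zero, hxn 0 (by omega)]
  have hz := solution_parity hxn hz₀ hz₁
  have hD := D_solution hX hE e₀ e₁ n hxD
  -- Components of `(b + B)z` up to degree `n` involve `z` only up to degree `n + 1`, so truncation
  -- there does no harm.
  let z : ∀ n, X.obj n := fun i => if i ≤ n + 1 then solution x z₀ z₁ i else 0
  refine ⟨z, fun i hi => ?_, ?_⟩
  · change (if i ≤ n + 1 then solution x z₀ z₁ i else 0) = 0
    split_ifs with h
    · exact hz i fun h2 => hi ⟨h, h2⟩
    · rfl
  · have hzi : ∀ i ≤ n + 1, z i = solution x z₀ z₁ i := fun i hi => if_pos hi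
    funext i
    change X.totD (n + 1) z i = x i
    by_cases hi : i < n + 1
    · have e1 : X.totD (n + 1) z i = X.D z i := by simp [totD, Nat.le_of_lt_succ hi]
      rw [e1, ← hD i (by omega)]
      cases i with
      | zero => rw [D_zero, D_zero, hzi 1 (by omega)]
      | succ i => rw [D_succ, D_succ, hzi (i + 2) (by omega), hzi i (by omega)]
    · have e1 : X.totD (n + 1) z i = 0 := by simp [totD, Nat.lt_succ_iff.not.1 hi]
      rw [e1, hx i (by omega)]

/-- The kernel of a morphism of mixed complexes. -/
def kernel (f : ∀ n, X.obj n →ₗ[k] Y.obj n) (hb : ∀ n x, f n (X.b n x) = Y.b n (f (n + 1) x))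
    (hB : ∀ n x, f (n + 1) (X.B n x) = Y.B n (f n x)) : MixedData.{u, w} k where
  obj n := LinearMap.ker (f n)
  b n := (X.b n).restrict fun y hy => by
    rw [LinearMap.mem_ker, hb, LinearMap.mem_ker.1 hy, map_zero]
  B n := (X.B n).restrict fun y hy => by
    rw [LinearMap.mem_ker, hB, LinearMap.mem_ker.1 hy, map_zero]

/-- Acyclicity of the kernel. A primitive `t` of `y` has image a cycle, which comes from a cycle
`t'` up to a boundary; subtracting `t'` and a lift of that boundary moves `t` into the kernel
without changing `bt`. -/
theorem IsQuasiIso.kernel_exact {f : ∀ n, X.obj n →ₗ[k] Y.obj n} (hf : IsQuasiIso f)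
    (hs : ∀ n, Function.Surjective (f n)) (n : ℕ) (y : X.obj n) (hy : f n y = 0)
    (hc : y ∈ X.cycles n) : ∃ z, f (n + 1) z = 0 ∧ X.b n z = y := by
  obtain ⟨t, rfl⟩ := hf.injective n y hc (by rw [hy]; exact Submodule.zero_mem _)
  have ht : f (n + 1) t ∈ Y.cycles (n + 1) := by
    change Y.b n _ = 0
    rw [← hf.comm_b, hy]
  obtain ⟨t', ht', s, hs'⟩ := hf.surjective (n + 1) _ ht
  obtain ⟨s, rfl⟩ := hs _ s
  refine ⟨t - t' - X.b (n + 1) s, ?_, ?_⟩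
  · rw [map_sub, map_sub, hf.comm_b, hs', sub_self]
  · rw [map_sub, map_sub, hf.source.b_b, sub_zero, show X.b n t' = 0 from ht', sub_zero]

/-- A surjective quasi-isomorphism of mixed complexes induces isomorphisms on the homology of the
products with the differential `b + B`. -/
theorem IsQuasiIso.isSuperQuasiIso {f : ∀ n, X.obj n →ₗ[k] Y.obj n} (hf : IsQuasiIso f)
    (hs : ∀ n, Function.Surjective (f n)) : IsSuperQuasiIso f := by
  have hfD : ∀ x : ∀ n, X.obj n, (fun n => f n (X.D x n)) = Y.D fun n => f n (x n) := by
    intro x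
    funext n
    cases n with
    | zero => exact hf.comm_b 0 _
    | succ n => rw [D_succ, D_succ, map_add, hf.comm_b, hf.comm_B]
  have hlift : ∀ ν, ∀ y ∈ Y.parity ν, ∃ x ∈ X.parity ν, (fun n => f n (x n)) = y := by
    intro ν y hy
    -- Zero components are lifted by zero in order to preserve parity.
    have h : ∀ n, ∃ x : X.obj n, f n x = y n ∧ (y n = 0 → x = 0) := by
      intro n
      by_cases h0 : y n = 0
      · exact ⟨0, by rw [map_zero, h0], fun _ => rfl⟩
      · obtain ⟨x, hx⟩ := hs n (y n)
        exact ⟨x, hx, fun h => absurd h h0⟩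
    choose x hx hx0 using h
    exact ⟨x, fun i hi => hx0 i (hy i hi), funext hx⟩
  have hparD : ∀ {Z : MixedData.{u, w} k} ν, ∀ y ∈ Z.parity (ν + 1), Z.D y ∈ Z.parity ν := by
    intro Z ν y hy i hi
    cases i with
    | zero => rw [D_zero, hy 1 (by omega), map_zero]
    | succ i => rw [D_succ, hy (i + 2) (by omega), hy i (by omega), map_zero, map_zero, add_zero]
  let K := kernel f hf.comm_b hf.comm_B
  have hK : K.IsMixed :=
    { b_b := fun n x => Subtype.ext (hf.source.b_b n x.1)
      B_B := fun n x => Subtype.ext (hf.source.B_B n x.1)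
      b_B_zero := fun x => Subtype.ext (hf.source.b_B_zero x.1)
      b_B_add := fun n x => Subtype.ext (hf.source.b_B_add n x.1) }
  have hKr : ∀ n (y : K.obj n), y.1 ∈ X.cycles n → y ∈ LinearMap.range (K.b n) := by
    intro n y hy
    obtain ⟨z, hz, e⟩ := hf.kernel_exact hs n y.1 y.2 hy
    exact ⟨⟨z, hz⟩, Subtype.ext e⟩
  -- The kernel is `b`-acyclic in every degree, so the recursion can start from `z₀ = 0` and a
  -- primitive `z₁` of `x₀`. Infinitely many components are allowed because the complex is a
  -- product.
  have key : ∀ ν, ∀ x ∈ X.parity ν, X.D x = 0 → (∀ n, f n (x n) = 0) →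
      ∃ z ∈ X.parity (ν + 1), X.D z = x ∧ ∀ n, f n (z n) = 0 := by
    intro ν x hx hD hfx
    let x' : ∀ n, K.obj n := fun n => ⟨x n, hfx n⟩
    have hx' : x' ∈ K.parity ν := fun i hi => Subtype.ext (hx i hi)
    have hD' : ∀ i, K.D x' i = 0 := by
      intro i
      refine Subtype.ext ?_
      cases i with
      | zero => exact congrFun hD 0
      | succ i => exact congrFun hD (i + 1)
    have hE : K.ExactAbove := fun n t ht => hKr (n + 2) t (congrArg Subtype.val ht)
    have h0 : x' 0 ∈ LinearMap.range (K.b 0) := hKr 0 _ Submodule.mem_top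
    have h1 : x' 1 - K.B 0 0 ∈ LinearMap.range (K.b 1) := by
      rw [map_zero, sub_zero]
      exact hKr 1 _ (congrFun hD 0)
    have hz := solution_parity (z₀ := 0) (z₁ := preim 0 (x' 0)) hx' (fun _ => rfl)
      (fun h => by rw [hx' 0 (by omega), preim_zero])
    have hzD := fun i => D_solution hK hE (z₀ := 0) (b_preim h0) h1 i (fun j _ => hD' j) i le_rfl
    refine ⟨fun n => (solution x' 0 (preim 0 (x' 0)) n).1, fun i hi => ?_, ?_, fun n => ?_⟩
    · exact congrArg Subtype.val (hz i hi)
    · funext i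
      have e := congrArg Subtype.val (hzD i)
      cases i with
      | zero => exact e
      | succ i => exact e
    · exact (solution x' 0 (preim 0 (x' 0)) n).2
  constructor
  · rintro ν x hx hxD ⟨y, hy, hyD⟩
    obtain ⟨y, hy', rfl⟩ := hlift _ y hy
    obtain ⟨z, hz, hzD, -⟩ := key ν (x - X.D y) (Submodule.sub_mem _ hx (hparD ν y hy'))
      (by rw [map_sub, hxD, hf.source.D_D, sub_zero]) (fun n => by
        have e1 := congrFun ((hfD y).trans hyD) n
        rw [Pi.sub_apply, map_sub]
        exact sub_eq_zero.2 e1.symm)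
    exact ⟨z + y, Submodule.add_mem _ hz hy', by rw [map_add, hzD, sub_add_cancel]⟩
  · intro ν y hy hyD
    -- An arbitrary lift `x` need not be a cycle, but `(b + B)x` is a cycle in the kernel, hence
    -- equals `(b + B)z` with `z` in the kernel; `x - z` is then a cycle with the same image.
    obtain ⟨x, hx, rfl⟩ := hlift ν y hy
    have hx2 : x ∈ X.parity (ν + 1 + 1) := fun i hi => hx i (by omega)
    obtain ⟨z, hz, hzD, hfz⟩ := key (ν + 1) (X.D x) (hparD (ν + 1) x hx2) (hf.source.D_D x)
      (fun n => congrFun ((hfD x).trans hyD) n)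
    have hz2 : z ∈ X.parity ν := fun i hi => hz i (by omega)
    refine ⟨x - z, Submodule.sub_mem _ hx hz2, by rw [map_sub, hzD, sub_self], 0,
      Submodule.zero_mem _, ?_⟩
    rw [map_zero]
    funext n
    change 0 = f n (x n) - f n (x n - z n)
    rw [map_sub, hfz, sub_zero, sub_self]

theorem IsMixed.quotient (hX : X.IsMixed) (K : ∀ n, Submodule k (X.obj n))
    (hb : ∀ n, K (n + 1) ≤ (K n).comap (X.b n)) (hB : ∀ n, K n ≤ (K (n + 1)).comap (X.B n)) :
    (X.quotient K hb hB).IsMixed where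
  b_b n t := by
    obtain ⟨t, rfl⟩ := Submodule.mkQ_surjective _ t
    exact (congrArg (K n).mkQ (hX.b_b n t)).trans (map_zero _)
  B_B n t := by
    obtain ⟨t, rfl⟩ := Submodule.mkQ_surjective _ t
    exact (congrArg (K (n + 2)).mkQ (hX.B_B n t)).trans (map_zero _)
  b_B_zero t := by
    obtain ⟨t, rfl⟩ := Submodule.mkQ_surjective _ t
    exact (congrArg (K 0).mkQ (hX.b_B_zero t)).trans (map_zero _)
  b_B_add n t := by
    obtain ⟨t, rfl⟩ := Submodule.mkQ_surjective _ t
    exact (congrArg (K (n + 1)).mkQ (hX.b_B_add n t)).trans (map_zero _)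

end MixedData

namespace MixedData

variable {k : Type u} [Field k] {X : MixedData.{u, w} k} {K : ∀ n, Submodule k (X.obj n)}
  {hb : ∀ n, K (n + 1) ≤ (K n).comap (X.b n)} {hB : ∀ n, K n ≤ (K (n + 1)).comap (X.B n)}

theorem mkQ_mem_range_b (n : ℕ) (x : X.obj n) :
    (K n).mkQ x ∈ LinearMap.range ((X.quotient K hb hB).b n)
      ↔ x ∈ LinearMap.range (X.b n) ⊔ K n := by
  constructor
  · rintro ⟨y, hy⟩
    obtain ⟨y, rfl⟩ := Submodule.mkQ_surjective _ y
    have h : x - X.b n y ∈ K n := (Submodule.Quotient.eq (K n)).1 hy.symm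
    rw [← add_sub_cancel (X.b n y) x]
    exact Submodule.add_mem_sup ⟨y, rfl⟩ h
  · intro hx
    obtain ⟨_, ⟨y, rfl⟩, s, hs, rfl⟩ := Submodule.mem_sup.1 hx
    refine ⟨(K (n + 1)).mkQ y, ?_⟩
    rw [map_add, show (K n).mkQ s = 0 from (Submodule.Quotient.mk_eq_zero (K n)).2 hs, add_zero]
    rfl

end MixedData

/-! ### An Euler double derivation makes `B` bijective in reduced degrees zero and one. -/

section EulerDerivation

variable {k : Type u} {H : Type v} [Field k] [Ring H] [HopfAlgebra k H]
  {A : HAlg.{u, v, w} k H}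
  {M : Type x} [AddCommGroup M] [Module k M] [Module Hᵐᵒᵖ M] [IsScalarTower k Hᵐᵒᵖ M]
  {δ : Hom A.toHRep (tens A.toHRep A.toHRep)}

theorem HTens.mem_of_span {X : HRep.{u, v, w} k H} {s : Set X} (hs : ⊤ ≤ Submodule.span k s)
    (P : Submodule k (HTens M X)) (h : ∀ m, ∀ y ∈ s, HTens.mk X m y ∈ P) (t : HTens M X) :
    t ∈ P := by
  induction t using HTens.ind with
  | h0 => exact P.zero_mem
  | ha s t hs ht => exact P.add_mem hs ht
  | hm m y =>
    have h2 : Submodule.span k s ≤ P.comap (HTens.mk X m) := Submodule.span_le.2 (h m)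
    exact h2 (hs Submodule.mem_top)

/-- The eigenvectors of `D = δ′δ″` with eigenvalue in `ℕ`, scalar if the eigenvalue is `0`. -/
def homogeneous (δ : Hom A.toHRep (tens A.toHRep A.toHRep)) : Set A :=
  {a | ∃ n : ℕ, (contract δ).lin a = (n : k) • a ∧ (n = 0 → a ∈ Submodule.span k {(1 : A)})}

/-- A double derivation whose contraction is the degree derivation of a connected grading. -/
structure IsEuler (δ : Hom A.toHRep (tens A.toHRep A.toHRep)) : Prop where
  doubleDer : IsDoubleDer δ
  span : ⊤ ≤ Submodule.span k (homogeneous δ)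

theorem IsEuler.span_tensor (hδ : IsEuler δ) : (⊤ : Submodule k (A ⊗[k] A)) ≤
    Submodule.span k (Set.image2 (fun a b => a ⊗ₜ[k] b) (homogeneous δ) (homogeneous δ)) := by
  refine le_of_eq_of_le ?_ (Submodule.map₂_span_span k (TensorProduct.mk k A A) _ _).le
  rw [top_le_iff.1 hδ.span, TensorProduct.map₂_mk_top_top_eq_top]

variable [LeftComodule k H M] [InvertibleAntipode k H] [IsSAYD k H M]

theorem mk_mem_scalarPart_zero (m : M) {a : A} (ha : a ∈ Submodule.span k {(1 : A)}) :
    HTens.mk A.toHRep m a ∈ scalarPart A M 0 := by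
  obtain ⟨c, rfl⟩ := Submodule.mem_span_singleton.1 ha
  rw [map_smul]
  exact Submodule.smul_mem _ c (mk_ones_mem A 0 m)

theorem mk_mem_scalarPart_one (m : M) {a b : A} (ha : a ∈ Submodule.span k {(1 : A)})
    (hb : b ∈ Submodule.span k {(1 : A)}) :
    HTens.mk (tens A.toHRep A.toHRep) m (a ⊗ₜ b) ∈ scalarPart A M 1 := by
  obtain ⟨c, rfl⟩ := Submodule.mem_span_singleton.1 ha
  obtain ⟨d, rfl⟩ := Submodule.mem_span_singleton.1 hb
  rw [TensorProduct.tmul_smul, map_smul, ← TensorProduct.smul_tmul', map_smul]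
  exact Submodule.smul_mem _ d (Submodule.smul_mem _ c (mk_ones_mem A 1 m))

theorem contract_scalarPart (hδ : IsDoubleDer δ) {t : HTens M A.toHRep}
    (ht : t ∈ scalarPart A M 0) : HTens.map (contract δ) t = 0 := by
  obtain ⟨m, rfl⟩ := ht
  refine (HTens.map_mk (contract δ) m (1 : A)).trans ?_
  rw [contract_one hδ, map_zero]

theorem map_doubleDer_scalarPart (hδ : IsDoubleDer δ) {t : HTens M A.toHRep}
    (ht : t ∈ scalarPart A M 0) : HTens.map δ t = 0 := by
  obtain ⟨m, rfl⟩ := ht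
  refine (HTens.map_mk δ m (1 : A)).trans ?_
  rw [doubleDer_one hδ, map_zero]

theorem inner_scalarPart (hδ : IsDoubleDer δ) {t : HTens M (tens A.toHRep A.toHRep)}
    (ht : t ∈ scalarPart A M 1) : HTens.map (inner δ) t = 0 := by
  obtain ⟨m, rfl⟩ := ht
  refine (HTens.map_mk (inner δ) m ((1 : A) ⊗ₜ[k] (1 : A))).trans ?_
  have e : (inner δ).lin ((1 : A) ⊗ₜ[k] (1 : A)) = (1 : A) * (contract δ).lin (1 : A) := rfl
  rw [e, contract_one hδ, mul_zero, map_zero]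

theorem lieTwo_scalarPart (hδ : IsDoubleDer δ) {t : HTens M (tens A.toHRep A.toHRep)}
    (ht : t ∈ scalarPart A M 1) : lieTwo M δ t = 0 := by
  obtain ⟨m, rfl⟩ := ht
  have e1 : ((contract δ).tmap (Hom.id A.toHRep)).lin (ones A 1)
      = (contract δ).lin (1 : A) ⊗ₜ[k] (1 : A) := rfl
  have e2 : ((Hom.id A.toHRep).tmap (contract δ)).lin (ones A 1)
      = (1 : A) ⊗ₜ[k] (contract δ).lin (1 : A) := rfl
  rw [lieTwo_apply, LinearMap.flip_apply, HTens.map_mk, HTens.map_mk, e1, e2, contract_one hδ,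
    TensorProduct.zero_tmul, TensorProduct.tmul_zero, map_zero, add_zero]

/-- No grading on `M ⊗_H A` is needed: classes `m ⊗ a` with `a` homogeneous span it. Each is scalar
or an eigenvector of positive integer eigenvalue, which is nonzero in characteristic zero. -/
theorem IsEuler.contract_modulo [CharZero k] (hδ : IsEuler δ) (K : Submodule k (HTens M A.toHRep))
    (hS : scalarPart A M 0 ≤ K) (hK : ∀ y ∈ K, HTens.map (contract δ) y ∈ K) (y : HTens M A.toHRep)
    (hy : HTens.map (contract δ) y ∈ K) : y ∈ K := by
  refine (bijective_modulo (HTens.map (contract δ)) K hK ?_).1 y hy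
  rintro t -
  refine HTens.mem_of_span hδ.span _ ?_ t
  rintro m a ⟨n, hn, h0⟩
  refine Submodule.subset_span ?_
  rcases Nat.eq_zero_or_pos n with h | h
  · exact Or.inl (hS (mk_mem_scalarPart_zero m (h0 h)))
  · refine Or.inr ⟨n, Nat.cast_ne_zero.2 h.ne', ?_⟩
    rw [HTens.map_mk, hn, map_smul]

/-- On `m ⊗ a ⊗ b` the eigenvalue is the sum of the two degrees; it vanishes only when both letters
are scalars. -/
theorem IsEuler.lieTwo_modulo [CharZero k] (hδ : IsEuler δ)
    (K : Submodule k (HTens M (tens A.toHRep A.toHRep)))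
    (hS : scalarPart A M 1 ≤ K) (hK : ∀ y ∈ K, lieTwo M δ y ∈ K)
    (y : HTens M (tens A.toHRep A.toHRep)) : ∃ z, y - lieTwo M δ z ∈ K := by
  refine (bijective_modulo (lieTwo M δ) K hK ?_).2 y
  rintro t -
  refine HTens.mem_of_span hδ.span_tensor _ ?_ t
  rintro m _ ⟨a, ⟨p, hp, hp0⟩, b, ⟨q, hq, hq0⟩, rfl⟩
  refine Submodule.subset_span ?_
  rcases Nat.eq_zero_or_pos (p + q) with h | h
  · exact Or.inl (hS (mk_mem_scalarPart_one m (hp0 (by omega)) (hq0 (by omega))))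
  · refine Or.inr ⟨((p + q : ℕ) : k), Nat.cast_ne_zero.2 h.ne', ?_⟩
    have e1 : ((contract δ).tmap (Hom.id A.toHRep)).lin (a ⊗ₜ[k] b)
        = (contract δ).lin a ⊗ₜ[k] b := rfl
    have e2 : ((Hom.id A.toHRep).tmap (contract δ)).lin (a ⊗ₜ[k] b)
        = a ⊗ₜ[k] (contract δ).lin b := rfl
    rw [lieTwo_apply, HTens.map_mk, HTens.map_mk, e1, e2, hp, hq, ← TensorProduct.smul_tmul',
      TensorProduct.tmul_smul, map_smul, map_smul, ← add_smul, Nat.cast_add]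

theorem cycb_zero_eq : cycb A M 0 = comm₀ A M := by
  refine LinearMap.ext fun t => (cycb_apply 0 t).trans ?_
  rw [pow_zero, one_smul]
  rfl

theorem cycb_one_apply (t : HTens M (tens (tens A.toHRep A.toHRep) A.toHRep)) :
    cycb A M 1 t = -comm₁ A M t := by
  refine (cycb_apply 1 t).trans ?_
  rw [pow_one, neg_one_smul]
  rfl

theorem range_cycb_one : LinearMap.range (cycb A M 1) = LinearMap.range (comm₁ A M) := by
  refine le_antisymm ?_ ?_
  · rintro _ ⟨t, rfl⟩
    exact ⟨-t, by rw [map_neg]; exact (cycb_one_apply t).symm⟩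
  · rintro _ ⟨t, rfl⟩
    exact ⟨-t, by rw [map_neg, cycb_one_apply, neg_neg]⟩

theorem cycB_zero_apply (t : HTens M A.toHRep) : cycB A M 0 t
    = HTens.map (A.oneIns A.toHRep) t + HTens.map (A.insOne A.toHRep) t := by
  have e1 : cycs A M 0 t = HTens.map (A.oneIns A.toHRep) t :=
    (cycs_apply A 0 t).trans (HTens.map_id _)
  have e2 : tau A M 0 (HTens.map (A.oneIns A.toHRep) t) = HTens.map (A.insOne A.toHRep) t := by
    refine (HTens.map_id _).trans ?_
    rw [← HTens.swap_insOne, HTens.swap_swap_self]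
  have e3 : cycB A M 0 t = cycs A M 0 t - (-1 : k) ^ 1 • tau A M 0 (cycs A M 0 t) := rfl
  rw [e3, e1, e2, pow_one, neg_one_smul, sub_neg_eq_add]

/-- Modulo boundaries `B` is `a ↦ 1 ⊗ a`, since its other summand `a ⊗ 1` bounds. -/
theorem cycB_zero_sub_mem (t : HTens M A.toHRep) :
    cycB A M 0 t - HTens.map (A.oneIns A.toHRep) t ∈ LinearMap.range (comm₁ A M) := by
  rw [cycB_zero_apply, add_sub_cancel_left]
  exact insOne_mem t

/-- Modulo boundaries `1 ⊗ ab` is the sum of `a ⊗ b` and its flip, an expression invariant under the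
flip, so the two halves of a commutator have the same image. -/
theorem oneIns_comm₀_mem (t : HTens M (tens A.toHRep A.toHRep)) :
    HTens.map (A.oneIns A.toHRep) (comm₀ A M t) ∈ LinearMap.range (comm₁ A M) := by
  rw [commutator_apply, map_sub, oneIns_mul, oneIns_mul, HTens.swap_swap_self,
    add_comm (HTens.swap _ _ t) t, add_sub_add_left_eq_sub, ← map_sub]
  exact ⟨_, rfl⟩

/-- Obtained from the homotopy formula applied to a boundary, which avoids extending the Lie
derivative to degree two. -/
theorem lieTwo_comm₁_mem (hδ : IsDoubleDer δ)
    (t : HTens M (tens (tens A.toHRep A.toHRep) A.toHRep)) :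
    lieTwo M δ (comm₁ A M t) ∈ LinearMap.range (comm₁ A M) := by
  have h := lieTwo_homotopy hδ (comm₁ A M t)
  rw [comm₀_comm₁, map_zero, sub_zero, inner_comm₁ hδ] at h
  exact (Submodule.sub_mem_iff_left _ (oneIns_comm₀_mem _)).1 h

/-- Injectivity of `B` in reduced homology. Contracting `1 ⊗ t` with `D` gives `Dt`, so if `Bt`
bounds then `Dt` is a commutator up to scalars, and `D` is invertible modulo those. -/
theorem IsEuler.mem_of_cycB_mem [CharZero k] (hδ : IsEuler δ) (t : HTens M A.toHRep)
    (ht : cycB A M 0 t ∈ LinearMap.range (comm₁ A M) ⊔ scalarPart A M 1) :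
    t ∈ LinearMap.range (comm₀ A M) ⊔ scalarPart A M 0 := by
  refine hδ.contract_modulo _ le_sup_right ?_ t ?_
  · intro y hy
    obtain ⟨_, ⟨y, rfl⟩, s, hs, rfl⟩ := Submodule.mem_sup.1 hy
    rw [map_add, contract_scalarPart hδ.doubleDer hs, add_zero, ← comm₀_lieTwo hδ.doubleDer]
    exact Submodule.mem_sup_left ⟨_, rfl⟩
  · have h : HTens.map (A.oneIns A.toHRep) t
        ∈ LinearMap.range (comm₁ A M) ⊔ scalarPart A M 1 :=
      (Submodule.sub_mem_iff_right _ ht).1 (Submodule.mem_sup_left (cycB_zero_sub_mem t))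
    obtain ⟨_, ⟨y, rfl⟩, s, hs, e⟩ := Submodule.mem_sup.1 h
    rw [← inner_oneIns, ← e, map_add, inner_scalarPart hδ.doubleDer hs, add_zero,
      inner_comm₁ hδ.doubleDer]
    exact Submodule.mem_sup_left ⟨_, rfl⟩

/-- Surjectivity of `B`. Up to boundaries and scalars `t = L_D z`. The operator `D` carries the
commutator of `z` to that of `L_D z`, so the former is scalar and `δ` kills it. The Cartan formula
then reads `L_D z ≡ d ι_D z`, and `y = ι_D z` works. -/
theorem IsEuler.exists_cycB [CharZero k] (hδ : IsEuler δ) (t : HTens M (tens A.toHRep A.toHRep))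
    (ht : comm₀ A M t ∈ scalarPart A M 0) :
    ∃ y, t - cycB A M 0 y ∈ LinearMap.range (comm₁ A M) ⊔ scalarPart A M 1 := by
  obtain ⟨z, hz⟩ := hδ.lieTwo_modulo (LinearMap.range (comm₁ A M) ⊔ scalarPart A M 1) le_sup_right
    (by
      intro y hy
      obtain ⟨_, ⟨y, rfl⟩, s, hs, rfl⟩ := Submodule.mem_sup.1 hy
      rw [map_add, lieTwo_scalarPart hδ.doubleDer hs, add_zero]
      exact Submodule.mem_sup_left (lieTwo_comm₁_mem hδ.doubleDer y)) t
  have hS : ∀ s ∈ scalarPart A M 1, comm₀ A M s ∈ scalarPart A M 0 := fun s hs => by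
    rw [← cycb_zero_eq]
    exact scalarPart_b A 0 hs
  have h0 : comm₀ A M (lieTwo M δ z) ∈ scalarPart A M 0 := by
    obtain ⟨_, ⟨y, rfl⟩, s, hs, e⟩ := Submodule.mem_sup.1 hz
    have e2 : comm₀ A M (lieTwo M δ z) = comm₀ A M t - comm₀ A M s := by
      rw [← sub_sub_cancel t (lieTwo M δ z), ← e, map_sub, map_add, comm₀_comm₁, zero_add]
    rw [e2]
    exact Submodule.sub_mem _ ht (hS s hs)
  rw [comm₀_lieTwo hδ.doubleDer] at h0
  have h1 : comm₀ A M z ∈ scalarPart A M 0 :=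
    hδ.contract_modulo _ le_rfl (fun y hy => by
      rw [contract_scalarPart hδ.doubleDer hy]; exact Submodule.zero_mem _) _ h0
  have h2 := lieTwo_homotopy hδ.doubleDer z
  rw [map_doubleDer_scalarPart hδ.doubleDer h1, sub_zero] at h2
  refine ⟨HTens.map (inner δ) z, ?_⟩
  have h3 := cycB_zero_sub_mem (HTens.map (inner δ) z)
  have e : t - cycB A M 0 (HTens.map (inner δ) z) = (t - lieTwo M δ z)
      + ((lieTwo M δ z - HTens.map (A.oneIns A.toHRep) (HTens.map (inner δ) z))
        - (cycB A M 0 (HTens.map (inner δ) z)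
          - HTens.map (A.oneIns A.toHRep) (HTens.map (inner δ) z))) := by abel
  rw [e]
  exact Submodule.add_mem _ hz (Submodule.mem_sup_left (Submodule.sub_mem _ h2 h3))

/-- The reduced cyclic homology vanishes in positive degrees in the presence of an Euler double
derivation. -/
theorem IsEuler.HC_subsingleton [CharZero k] (hδ : IsEuler δ) (hE : (redCycMixed A M).ExactAbove)
    (n : ℕ) (hn : 1 ≤ n) : Subsingleton ((redCycMixed A M).HC n) := by
  refine MixedData.HC_subsingleton
    ((cycMixed_isMixed A M).quotient (scalarPart A M) (scalarPart_b A) (scalarPart_B A)) hE ?_ ?_ n hn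
  · intro t ht
    obtain ⟨t, rfl⟩ := Submodule.mkQ_surjective _ t
    have ht : cycb A M 0 t ∈ scalarPart A M 0 := (Submodule.Quotient.mk_eq_zero _).1 ht
    rw [cycb_zero_eq] at ht
    obtain ⟨y, hy⟩ := hδ.exists_cycB t ht
    refine ⟨(scalarPart A M 0).mkQ y, ?_⟩
    rw [← range_cycb_one] at hy
    exact (MixedData.mkQ_mem_range_b (X := cycMixed A M) 1 _).2 hy
  · intro t ht
    obtain ⟨t, rfl⟩ := Submodule.mkQ_surjective _ t
    have ht := (MixedData.mkQ_mem_range_b (X := cycMixed A M) 1 _).1 ht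
    refine (MixedData.mkQ_mem_range_b (X := cycMixed A M) 0 _).2 ?_
    change cycB A M 0 t ∈ LinearMap.range (cycb A M 1) ⊔ _ at ht
    rw [range_cycb_one] at ht
    have := hδ.mem_of_cycB_mem t ht
    rw [← cycb_zero_eq] at this
    exact this

end EulerDerivation

/-! ### The word-cutting double derivation of the tensor algebra. -/

section FreeEuler

variable {k : Type u} {H : Type v} [Field k] [Ring H] [HopfAlgebra k H]

variable (V : HRep.{u, v, w} k H)

/-- The double derivation of the free algebra with `v ↦ v ⊗ 1`, that is,
`v₁ ⋯ vₙ ↦ ∑ᵢ v₁ ⋯ vᵢ ⊗ vᵢ₊₁ ⋯ vₙ`. -/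
def cut : Hom (freeAlg V).toHRep (tens (freeAlg V).toHRep (freeAlg V).toHRep) :=
  freeRec (mulLeft (freeAlg V)) (Hom.id _) 0 (fun h => by rw [map_zero, smul_zero])

theorem cut_one : (cut V).lin (1 : TensorAlgebra k V) = 0 := freeRecLin_one _ _ _

theorem cut_mul (v : V) (a : TensorAlgebra k V) : (cut V).lin (TensorAlgebra.ι k v * a)
    = (mulLeft (freeAlg V)).lin (TensorAlgebra.ι k v ⊗ₜ (cut V).lin a)
      + TensorAlgebra.ι k v ⊗ₜ[k] a := freeRecLin_mul _ _ _ v a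

theorem mulLeft_mulLeft {A : HAlg.{u, v, w} k H} (a b : A) (y : A ⊗[k] A) :
    (mulLeft A).lin ((a * b) ⊗ₜ[k] y)
      = (mulLeft A).lin (a ⊗ₜ[k] (mulLeft A).lin (b ⊗ₜ[k] y)) := by
  induction y using TensorProduct.induction_on with
  | zero => simp only [TensorProduct.tmul_zero, map_zero]
  | add y z hy hz => simp only [TensorProduct.tmul_add, map_add, hy, hz]
  | tmul c d => rw [mulLeft_tmul, mulLeft_tmul, mulLeft_tmul, mul_assoc]

theorem mulLeft_mulRight {A : HAlg.{u, v, w} k H} (a b : A) (y : A ⊗[k] A) :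
    (mulRight A).lin ((mulLeft A).lin (a ⊗ₜ[k] y) ⊗ₜ[k] b)
      = (mulLeft A).lin (a ⊗ₜ[k] (mulRight A).lin (y ⊗ₜ[k] b)) := by
  induction y using TensorProduct.induction_on with
  | zero => simp only [TensorProduct.tmul_zero, TensorProduct.zero_tmul, map_zero]
  | add y z hy hz => simp only [TensorProduct.tmul_add, TensorProduct.add_tmul, map_add, hy, hz]
  | tmul c d => rw [mulLeft_tmul, mulRight_tmul, mulRight_tmul, mulLeft_tmul]

theorem mulLeft_one {A : HAlg.{u, v, w} k H} (y : A ⊗[k] A) :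
    (mulLeft A).lin ((1 : A) ⊗ₜ[k] y) = y := by
  induction y using TensorProduct.induction_on with
  | zero => simp only [TensorProduct.tmul_zero, map_zero]
  | add y z hy hz => simp only [TensorProduct.tmul_add, map_add, hy, hz]
  | tmul c d => rw [mulLeft_tmul, one_mul]

theorem cut_isDoubleDer : IsDoubleDer (A := freeAlg V) (cut V) := by
  intro a b
  change (cut V).lin ((a : TensorAlgebra k V) * b) = _
  induction a using word_induction with
  | h1 => rw [one_mul, cut_one, TensorProduct.zero_tmul, map_zero, zero_add]
          exact (mulLeft_one (A := freeAlg V) _).symm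
  | hsmul c a h =>
    rw [smul_mul_assoc, map_smul, h, map_smul, ← TensorProduct.smul_tmul',
      ← TensorProduct.smul_tmul', map_smul, map_smul, smul_add]
  | hadd a a' ha ha' =>
    rw [add_mul, map_add, ha, ha', map_add, TensorProduct.add_tmul, TensorProduct.add_tmul,
      map_add, map_add]
    abel
  | hmul v a h =>
    have e1 := mulLeft_mulLeft (A := freeAlg V) (TensorAlgebra.ι k v) a ((cut V).lin b)
    have e2 := mulLeft_mulRight (A := freeAlg V) (TensorAlgebra.ι k v) b ((cut V).lin a)
    have e3 := mulRight_tmul (A := freeAlg V) (TensorAlgebra.ι k v) a b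
    rw [mul_assoc, cut_mul, h, cut_mul, TensorProduct.add_tmul, map_add]
    refine Eq.trans ?_ (congrArg₂ (· + ·) (congrArg₂ (· + ·) e2.symm e3.symm) e1.symm)
    rw [TensorProduct.tmul_add, map_add]
    abel

theorem contract_cut_ι_mul (v : V) (a : TensorAlgebra k V) :
    (contract (cut V)).lin (TensorAlgebra.ι k v * a)
      = TensorAlgebra.ι k v * (contract (cut V)).lin a + TensorAlgebra.ι k v * a := by
  have h := contract_mul (cut_isDoubleDer V) (TensorAlgebra.ι k v) a
  have e : (contract (cut V)).lin (TensorAlgebra.ι k v) = TensorAlgebra.ι k v := by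
    change (freeAlg V).mul.lin ((cut V).lin (TensorAlgebra.ι k v)) = _
    rw [← mul_one (TensorAlgebra.ι k v), cut_mul, cut_one, TensorProduct.tmul_zero, map_zero,
      zero_add]
    rfl
  rw [e] at h
  exact h.trans (add_comm _ _)

/-- Each letter prefixed raises the eigenvalue of the contraction by one, so words have their length
as eigenvalue; eigenvalue zero then occurs only for the generator `1` of the spanning set produced
here. -/
theorem cut_isEuler : IsEuler (A := freeAlg V) (cut V) where
  doubleDer := cut_isDoubleDer V
  span := by
    rintro a -
    induction a using word_induction with
    | h1 =>
      refine Submodule.subset_span ⟨0, ?_, fun _ => Submodule.mem_span_singleton_self _⟩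
      rw [Nat.cast_zero, zero_smul]
      exact contract_one (cut_isDoubleDer V)
    | hsmul c a h => exact Submodule.smul_mem _ c h
    | hadd a b ha hb => exact Submodule.add_mem _ ha hb
    | hmul v a h =>
      let P := Submodule.span k (homogeneous (A := freeAlg V) (cut V))
      have hle : P ≤ P.comap (LinearMap.mulLeft k (TensorAlgebra.ι k v)) := by
        refine Submodule.span_le.2 ?_
        rintro a ⟨n, hn, -⟩
        refine Submodule.subset_span ⟨n + 1, ?_, fun h => absurd h n.succ_ne_zero⟩
        refine (contract_cut_ι_mul V v a).trans ?_
        rw [hn]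
        change TensorAlgebra.ι k v * ((n : k) • (a : TensorAlgebra k V)) + TensorAlgebra.ι k v * a
          = ((n + 1 : ℕ) : k) • (TensorAlgebra.ι k v * a)
        rw [mul_smul_comm, Nat.cast_add, Nat.cast_one, add_smul, one_smul]
      exact hle h

end FreeEuler

open MixedData

/-! ### Projections onto the `X`-complex. -/

section QuasiIso

variable {k : Type u} {H : Type v} [Field k] [Ring H] [HopfAlgebra k H]

variable {A : HAlg.{u, v, w} k H} {M : Type x} [AddCommGroup M] [Module k M] [Module Hᵐᵒᵖ M]
  [IsScalarTower k Hᵐᵒᵖ M] [LeftComodule k H M] [InvertibleAntipode k H] [IsSAYD k H M]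

variable (A M) in
-- Hence the quotient `♮` in degree `1` is the cokernel of `b` on two-forms, so the projection to
-- the `X`-complex is automatically an isomorphism on the homology of `b` in degrees `0` and `1`.
theorem range_formsb (n : ℕ) : LinearMap.range (formsb A M n)
    = LinearMap.range (commutator A M (formsL A n) (formsR A n)) := by
  have hs : Function.Surjective (HTens.map (M := M) ((Hom.id (forms A n)).tmap A.mkBar)) :=
    HTens.map_surjective (TensorProduct.map_surjective Function.surjective_id A.mkBar_surjective)
  refine le_antisymm ?_ ?_
  · rintro _ ⟨t, rfl⟩
    obtain ⟨t, rfl⟩ := hs t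
    rw [formsb_map]
    exact Submodule.smul_mem _ _ ⟨t, rfl⟩
  · rintro _ ⟨t, rfl⟩
    refine ⟨(-1 : k) ^ n • HTens.map ((Hom.id (forms A n)).tmap A.mkBar) t, ?_⟩
    rw [map_smul, formsb_map, smul_smul, ← mul_pow, neg_one_mul, neg_neg, one_pow, one_smul]

variable (A M) in
theorem formsToX_surjective (n : ℕ) : Function.Surjective (formsToX A M n) :=
  match n with
  | 0 => Function.surjective_id
  | 1 => Submodule.mkQ_surjective _
  | _ + 2 => fun _ => ⟨0, rfl⟩

theorem formsToX_comm_b (n : ℕ) (t : HTens M (forms A (n + 1))) :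
    formsToX A M n (formsb A M n t) = (xMixed A M).b n (formsToX A M (n + 1) t) :=
  match n, t with
  | 0, _ => rfl
  | 1, t => (Submodule.Quotient.mk_eq_zero _).2 (by rw [← range_formsb A M 1]; exact ⟨t, rfl⟩)
  | _ + 2, _ => rfl

theorem formsB_zero : formsB A M 0 = HTens.map (formsD A 0) := by
  rw [formsB, Finset.sum_range_one, pow_zero]
  rfl

theorem formsToX_comm_B (n : ℕ) (t : HTens M (forms A n)) :
    formsToX A M (n + 1) (formsB A M n t) = (xMixed A M).B n (formsToX A M n t) :=
  match n, t with
  | 0, t => congrArg (Submodule.mkQ _) (LinearMap.congr_fun formsB_zero t)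
  | 1, _ => rfl
  | _ + 2, _ => rfl

variable (A M) in
-- The nontrivial axioms are inherited from the forms along the surjective projection.
theorem xMixed_isMixed : (xMixed A M).IsMixed where
  b_b
    | 0, _ => map_zero (xb A M)
    | _ + 1, _ => rfl
  B_B
    | 0, _ => rfl
    | _ + 1, _ => rfl
  b_B_zero t := by
    have h := (formsMixed_isMixed A M).b_B_zero t
    have h1 := formsToX_comm_b 0 (formsB A M 0 t)
    rw [formsToX_comm_B] at h1
    exact h1.symm.trans h
  b_B_add
    | 0, t => by
      obtain ⟨t, rfl⟩ := formsToX_surjective A M 1 t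
      have h := congrArg (formsToX A M 1) ((formsMixed_isMixed A M).b_B_add 0 t)
      rw [map_add, map_zero] at h
      have h1 := formsToX_comm_b 1 (formsB A M 1 t)
      have h2 := formsToX_comm_B 0 (formsb A M 0 t)
      have h3 := formsToX_comm_B 1 t
      have h4 := formsToX_comm_b 0 t
      rw [← h4, ← h2, ← h3, ← h1]
      exact h
    | 1, _ => rfl
    | _ + 2, _ => rfl

/-- If the Hochschild homology vanishes above degree `1`, the projection onto the `X`-complex is a
quasi-isomorphism. -/
theorem formsToX_isQuasiIso (hE : (formsMixed A M).ExactAbove) : IsQuasiIso (formsToX A M) where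
  source := formsMixed_isMixed A M
  target := xMixed_isMixed A M
  comm_b := formsToX_comm_b
  comm_B := formsToX_comm_B
  injective
    | 0, t, _, ⟨s, hs⟩ => by
      obtain ⟨s, rfl⟩ := formsToX_surjective A M 1 s
      exact ⟨s, hs⟩
    | 1, t, _, ⟨s, hs⟩ => by
      have h : Submodule.Quotient.mk (p := LinearMap.range
        (commutator A M (formsL A 1) (formsR A 1))) t = 0 := hs.symm
      have h2 := (Submodule.Quotient.mk_eq_zero _).1 h
      rw [← range_formsb A M 1] at h2
      exact h2
    | n + 2, t, ht, _ => hE n t ht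
  surjective
    | 0, y, _ => ⟨y, Submodule.mem_top, 0, by rw [map_zero]; exact (sub_self y).symm⟩
    | 1, y, hy => by
      obtain ⟨t, rfl⟩ := formsToX_surjective A M 1 y
      exact ⟨t, hy, 0, by rw [map_zero, sub_self]⟩
    | n + 2, y, _ => ⟨0, Submodule.zero_mem _, 0, rfl⟩

variable (A M) in
-- Factoring through the forms reduces compatibility with `b` and `B` to facts already known.
theorem cycToX_eq (n : ℕ) (t : HTens M (tpow A n)) :
    cycToX A M n t = formsToX A M n (HTens.map (toForms A n) t) :=
  match n, t with
  | 0, t => (HTens.map_id t).symm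
  | 1, _ => rfl
  | _ + 2, _ => rfl

variable (A M) in
theorem cycToX_surjective (n : ℕ) : Function.Surjective (cycToX A M n) := by
  intro y
  obtain ⟨t, rfl⟩ := formsToX_surjective A M n y
  obtain ⟨t, rfl⟩ := map_toForms_surjective A M n t
  exact ⟨t, cycToX_eq A M n t⟩

/-- The kernel of `M ⊗_H A^{⊗2} → Ω_H^1(A, M)` consists of boundaries. -/
theorem ker_map_toForms_one (t : HTens M (tens A.toHRep A.toHRep))
    (ht : HTens.map ((Hom.id A.toHRep).tmap A.mkBar) t = 0) : t ∈ LinearMap.range (comm₁ A M) := by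
  have h := barDesc_map (LinearMap.range (comm₁ A M)).mkQ (fun m a => by
    rw [← HTens.map_mk]
    exact (Submodule.Quotient.mk_eq_zero _).2 (insOne_mem _)) t
  rw [ht, map_zero] at h
  exact (Submodule.Quotient.mk_eq_zero _).1 h.symm

/-- The degree `1` cokernels of the normalised and unnormalised complexes agree: a relation on forms
lifts to a boundary, with an error in the degenerate part, which itself bounds. -/
theorem mem_range_comm₁ (t : HTens M (tens A.toHRep A.toHRep))
    (ht : HTens.map (toForms A 1) t ∈ LinearMap.range (commutator A M (formsL A 1) (formsR A 1))) :
    t ∈ LinearMap.range (comm₁ A M) := by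
  obtain ⟨s, hs⟩ := ht
  obtain ⟨s, rfl⟩ := HTens.map_surjective (M := M) (f := (toForms A 1).tmap (Hom.id A.toHRep))
    (TensorProduct.map_surjective (toForms_surjective A 1) Function.surjective_id) s
  have h := map_commutator (M := M) (l := cycL A 1) (r := cycR A 1) _ (toForms_cycL A 1)
    (toForms_cycR A 1) s
  have h2 : t - commutator A M (cycL A 1) (cycR A 1) s ∈ LinearMap.range (comm₁ A M) := by
    refine ker_map_toForms_one _ ?_
    change HTens.map (toForms A 1) _ = 0
    rw [map_sub, h, hs, sub_self]
  have h3 : commutator A M (cycL A 1) (cycR A 1) s ∈ LinearMap.range (comm₁ A M) := ⟨s, rfl⟩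
  exact (Submodule.sub_mem_iff_left _ h3).1 h2

/-- If the Hochschild homology vanishes above degree `1`, the map from the cyclic module to the
`X`-complex is a quasi-isomorphism. -/
theorem cycToX_isQuasiIso (hE : (cycMixed A M).ExactAbove) : IsQuasiIso (cycToX A M) where
  source := cycMixed_isMixed A M
  target := xMixed_isMixed A M
  comm_b n t := by
    rw [cycToX_eq, cycToX_eq, ← formsToX_comm_b]
    exact congrArg _ (toForms_cycb n t)
  comm_B n t := by
    rw [cycToX_eq, cycToX_eq, ← formsToX_comm_B]
    exact congrArg _ (toForms_cycB n t)
  injective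
    | 0, t, _, ⟨s, hs⟩ => by
      obtain ⟨s, rfl⟩ := cycToX_surjective A M 1 s
      refine ⟨s, ?_⟩
      have h := toForms_cycb 0 s
      have h2 : cycb A M 0 s = formsb A M 0 (HTens.map (toForms A 1) s) :=
        (HTens.map_id _).symm.trans h
      exact h2.trans hs
    | 1, t, _, ⟨s, hs⟩ => by
      have h : Submodule.Quotient.mk (p := LinearMap.range
        (commutator A M (formsL A 1) (formsR A 1))) (HTens.map (toForms A 1) t) = 0 := hs.symm
      have h2 := mem_range_comm₁ t ((Submodule.Quotient.mk_eq_zero _).1 h)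
      rw [← range_cycb_one] at h2
      exact h2
    | n + 2, t, ht, _ => hE n t ht
  surjective
    | 0, y, _ => ⟨y, Submodule.mem_top, 0, by rw [map_zero]; exact (sub_self y).symm⟩
    | 1, y, hy => by
      obtain ⟨t, rfl⟩ := cycToX_surjective A M 1 y
      refine ⟨t, ?_, 0, by rw [map_zero, sub_self]⟩
      have h := toForms_cycb 0 t
      have h2 : cycb A M 0 t = formsb A M 0 (HTens.map (toForms A 1) t) :=
        (HTens.map_id _).symm.trans h
      exact h2.trans hy
    | n + 2, y, _ => ⟨0, Submodule.zero_mem _, 0, rfl⟩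

theorem MixedData.ExactAbove.subsingleton_HH {X : MixedData.{u, w} k} (hE : X.ExactAbove) (n : ℕ)
    (hn : 2 ≤ n) : Subsingleton (X.HH n) := by
  obtain ⟨n, rfl⟩ := Nat.exists_eq_add_of_le' hn
  refine Submodule.Quotient.subsingleton_iff.2 (eq_top_iff.2 ?_)
  rintro ⟨t, ht⟩ -
  exact hE n t ht

end QuasiIso

/-! ### Cyclic homology in degree zero as a cokernel. -/

namespace MixedData

variable {k : Type u} [Field k] {X : MixedData.{u, w} k}

theorem zeroClass_surjective : Function.Surjective X.zeroClass := by
  intro y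
  obtain ⟨⟨x, hx⟩, rfl⟩ := Submodule.mkQ_surjective _ y
  refine ⟨x 0, congrArg (Submodule.mkQ _) (Subtype.ext (funext fun i => ?_))⟩
  change (Pi.single 0 (x 0) : ∀ n, X.obj n) i = x i
  by_cases h : i = 0
  · subst h
    rw [Pi.single_eq_same]
  · rw [Pi.single_eq_of_ne h, hx.1 i (fun h2 => h (by omega))]

theorem zeroClass_eq_zero (t : X.obj 0) :
    X.zeroClass t = 0 ↔ t ∈ LinearMap.range (X.b 0) := by
  refine (Submodule.Quotient.mk_eq_zero _).trans ?_
  constructor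
  · rintro ⟨y, -, hy⟩
    refine ⟨y 1, ?_⟩
    have h : X.totD 1 y 0 = (Pi.single 0 t : ∀ n, X.obj n) 0 := congrFun hy 0
    simpa [totD, D] using h
  · rintro ⟨s, rfl⟩
    refine ⟨Pi.single 1 s, fun i hi => Pi.single_eq_of_ne (fun h => hi (by omega)) _, ?_⟩
    funext i
    change X.totD 1 (Pi.single 1 s) i = (Pi.single 0 (X.b 0 s) : ∀ n, X.obj n) i
    rcases Nat.eq_zero_or_pos i with rfl | h
    · simp [totD, D]
    · simp [totD, h.ne']

end MixedData

/-! ### Reduced cyclic homology of the tensor algebra in degree zero. -/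

section ReducedDegreeZero

variable {k : Type u} {H : Type v} [Field k] [Ring H] [HopfAlgebra k H]

variable (V : HRep.{u, v, w} k H)

/-- The projection `f ↦ f - ε(f)1` of `T(V)` onto its augmentation ideal. -/
def freeBarProj : Hom (freeAlg V).toHRep (freeBar V) where
  lin := (LinearMap.id - (Algebra.linearMap k (TensorAlgebra k V)) ∘ₗ
      (TensorAlgebra.algebraMapInv (R := k) (M := V)).toLinearMap).codRestrict _ (fun f => by
    change TensorAlgebra.algebraMapInv (f - algebraMap k _ (TensorAlgebra.algebraMapInv f)) = 0
    rw [map_sub, AlgHom.commutes]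
    exact sub_self _)
  comm h f := Subtype.ext (by
    change freeAct V h f - algebraMap k _ (TensorAlgebra.algebraMapInv (freeAct V h f))
      = freeAct V h (f - algebraMap k _ (TensorAlgebra.algebraMapInv f))
    have e : freeAct V h 1 = Coalgebra.counit (R := k) h • (1 : TensorAlgebra k V) :=
      (freeAlg V).act_one h
    rw [algebraMapInv_freeAct, map_sub, Algebra.algebraMap_eq_smul_one,
      Algebra.algebraMap_eq_smul_one, map_smul, e, smul_smul, mul_comm])

theorem freeBarProj_apply (f : TensorAlgebra k V) : (freeBarIncl V).lin ((freeBarProj V).lin f)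
    = f - TensorAlgebra.algebraMapInv f • (1 : TensorAlgebra k V) := by
  rw [← Algebra.algebraMap_eq_smul_one]
  rfl

theorem freeBarProj_one : (freeBarProj V).lin (1 : TensorAlgebra k V) = 0 := by
  refine Subtype.ext ((freeBarProj_apply V 1).trans ?_)
  rw [map_one, one_smul, sub_self]
  rfl

theorem freeBarProj_incl (f : freeBar V) : (freeBarProj V).lin ((freeBarIncl V).lin f) = f := by
  have e : TensorAlgebra.algebraMapInv f.1 = 0 := f.2
  refine Subtype.ext ((freeBarProj_apply V f.1).trans ?_)
  rw [e, zero_smul, sub_zero]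

variable {V} {M : Type x} [AddCommGroup M] [Module k M] [Module Hᵐᵒᵖ M] [IsScalarTower k Hᵐᵒᵖ M]

theorem map_freeBarProj_incl (t : HTens M (freeBar V)) :
    HTens.map (freeBarProj V) (HTens.map (freeBarIncl V) t) = t := by
  rw [← HTens.map_comp]
  exact (HTens.map_congr (g := Hom.id _) (LinearMap.ext (freeBarProj_incl V)) t).trans
    (HTens.map_id t)

variable [LeftComodule k H M] [InvertibleAntipode k H] [IsSAYD k H M]

theorem map_freeBarProj_scalarPart {t : HTens M (freeAlg V).toHRep}
    (ht : t ∈ scalarPart (freeAlg V) M 0) : HTens.map (freeBarProj V) t = 0 := by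
  obtain ⟨m, rfl⟩ := ht
  refine (HTens.map_mk (freeBarProj V) m (1 : TensorAlgebra k V)).trans ?_
  rw [freeBarProj_one, map_zero]

theorem sub_map_freeBarProj_mem (t : HTens M (freeAlg V).toHRep) :
    t - HTens.map (freeBarIncl V) (HTens.map (freeBarProj V) t) ∈ scalarPart (freeAlg V) M 0 := by
  induction t using HTens.ind with
  | h0 => rw [map_zero, map_zero, sub_zero]; exact Submodule.zero_mem _
  | ha s t hs ht =>
    rw [map_add, map_add, add_sub_add_comm]
    exact Submodule.add_mem _ hs ht
  | hm m f =>
    rw [HTens.map_mk, HTens.map_mk, freeBarProj_apply, ← map_sub, sub_sub_cancel, map_smul]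
    exact Submodule.smul_mem _ _ (mk_ones_mem (freeAlg V) 0 m)

/-- Scalars commute with everything, even in the twisted sense: the flip of `1 ⊗ a` is `a ⊗ 1`, and
both multiply to `a`. -/
theorem comm₀_oneIns {A : HAlg.{u, v, w} k H} (t : HTens M A.toHRep) :
    comm₀ A M (HTens.map (A.oneIns A.toHRep) t) = 0 := by
  rw [commutator_apply, ← HTens.swap_insOne, HTens.swap_swap_self, HTens.swap_insOne,
    ← HTens.map_comp, ← HTens.map_comp, sub_eq_zero]
  exact HTens.map_congr (LinearMap.ext fun a => (one_mul (a : A)).trans (mul_one (a : A)).symm) t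

theorem comm₀_freeBarIncl (t : HTens M (tens (freeBar V) (freeAlg V).toHRep)) :
    comm₀ (freeAlg V) M (HTens.map ((freeBarIncl V).tmap (Hom.id _)) t)
      = HTens.map (freeBarIncl V) (commutator (freeAlg V) M (freeBarL V) (freeBarR V) t) :=
  (map_commutator (freeBarIncl V) (fun _ _ => rfl) (fun _ _ => rfl) t).symm

/-- From `F = F̄ ⊕ k`. Commutators of `F` with `F` thus come from `F̄` with `F`. -/
theorem sup_freeBarIncl_oneIns (t : HTens M (tens (freeAlg V).toHRep (freeAlg V).toHRep)) :
    t ∈ LinearMap.range (HTens.map (M := M) ((freeBarIncl V).tmap (Hom.id (freeAlg V).toHRep)))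
      ⊔ LinearMap.range (HTens.map (M := M) ((freeAlg V).oneIns (freeAlg V).toHRep)) := by
  induction t using HTens.ind with
  | h0 => exact Submodule.zero_mem _
  | ha s t hs ht => exact Submodule.add_mem _ hs ht
  | hm m y =>
    induction y using TensorProduct.induction_on with
    | zero => rw [map_zero]; exact Submodule.zero_mem _
    | add a b ha hb => rw [map_add]; exact Submodule.add_mem _ ha hb
    | tmul a b =>
      have e : (a : TensorAlgebra k V) = (freeBarIncl V).lin ((freeBarProj V).lin a)
          + TensorAlgebra.algebraMapInv a • (1 : TensorAlgebra k V) := by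
        rw [freeBarProj_apply, sub_add_cancel]
      rw [e, TensorProduct.add_tmul, map_add, ← TensorProduct.smul_tmul', map_smul]
      refine Submodule.add_mem_sup ⟨HTens.mk _ m ((freeBarProj V).lin a ⊗ₜ b), ?_⟩
        (Submodule.smul_mem _ _ ⟨HTens.mk _ m b, ?_⟩)
      · exact HTens.map_mk _ _ _
      · exact HTens.map_mk _ _ _

/-- A commutator plus a scalar is first rewritten as a commutator in `F̄` plus a scalar; the
equivariant projection onto `F̄` then removes the scalar and fixes the rest. -/
theorem map_freeBarIncl_mem (t : HTens M (freeBar V)) : HTens.map (freeBarIncl V) t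
      ∈ LinearMap.range (comm₀ (freeAlg V) M) ⊔ scalarPart (freeAlg V) M 0
    ↔ t ∈ LinearMap.range (commutator (freeAlg V) M (freeBarL V) (freeBarR V)) := by
  constructor
  · intro ht
    obtain ⟨_, ⟨y, rfl⟩, s, hs, e⟩ := Submodule.mem_sup.1 ht
    obtain ⟨_, ⟨y, rfl⟩, _, ⟨z, rfl⟩, rfl⟩ := Submodule.mem_sup.1 (sup_freeBarIncl_oneIns y)
    rw [map_add, comm₀_oneIns, add_zero, comm₀_freeBarIncl] at e
    have h := congrArg (HTens.map (freeBarProj V)) e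
    rw [map_add, map_freeBarProj_scalarPart hs, add_zero, map_freeBarProj_incl,
      map_freeBarProj_incl] at h
    exact ⟨y, h⟩
  · rintro ⟨y, rfl⟩
    exact Submodule.mem_sup_left ⟨_, comm₀_freeBarIncl y⟩

variable (V M) in
/-- The map `M ⊗_H F̄ → HC̄₀(F, M)` induced by the inclusion `F̄ ⊆ F`. -/
def freeBarClass : HTens M (freeBar V) →ₗ[k] (redCycMixed (freeAlg V) M).HC 0 :=
  (redCycMixed (freeAlg V) M).zeroClass ∘ₗ (scalarPart (freeAlg V) M 0).mkQ ∘ₗ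
    HTens.map (freeBarIncl V)

variable (V M) in
theorem freeBarClass_surjective : Function.Surjective (freeBarClass V M) := by
  intro y
  obtain ⟨y, rfl⟩ := MixedData.zeroClass_surjective y
  obtain ⟨t, rfl⟩ := Submodule.mkQ_surjective _ y
  refine ⟨HTens.map (freeBarProj V) t, congrArg (redCycMixed (freeAlg V) M).zeroClass ?_⟩
  exact ((Submodule.Quotient.eq _).2 (sub_map_freeBarProj_mem t)).symm

variable (V M) in
theorem ker_freeBarClass : LinearMap.range (commutator (freeAlg V) M (freeBarL V) (freeBarR V))
    = LinearMap.ker (freeBarClass V M) := by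
  ext t
  rw [← map_freeBarIncl_mem, ← cycb_zero_eq]
  exact ((MixedData.zeroClass_eq_zero _).trans
    (MixedData.mkQ_mem_range_b (X := cycMixed (freeAlg V) M) 0 _)).symm

variable (V M) in
/-- The isomorphism `(M ⊗_H F̄)_♮ ≅ HC̄₀(F, M)`. -/
def freeBarEquiv : Natural (freeAlg V) M (freeBarL V) (freeBarR V)
    ≃ₗ[k] (redCycMixed (freeAlg V) M).HC 0 :=
  (Submodule.quotEquivOfEq _ _ (ker_freeBarClass V M)).trans
    ((freeBarClass V M).quotKerEquivOfSurjective (freeBarClass_surjective V M))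

theorem freeBarEquiv_mk (m : M) (f : freeBar V) :
    freeBarEquiv V M (Submodule.Quotient.mk (HTens.mk (freeBar V) m f))
      = (redCycMixed (freeAlg V) M).zeroClass
        (Submodule.Quotient.mk (HTens.mk (freeAlg V).toHRep m f.1)) :=
  congrArg (fun t => (redCycMixed (freeAlg V) M).zeroClass ((scalarPart (freeAlg V) M 0).mkQ t))
    (HTens.map_mk (freeBarIncl V) m f)

end ReducedDegreeZero

end HopfCyc

end

theorem mainTheorem6 {k : Type u} {H : Type v} {V : Type w} {M : Type x}
    [Field k] [CharZero k] [Ring H] [HopfAlgebra k H] [InvertibleAntipode k H]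
    [AddCommGroup M] [Module k M] [Module Hᵐᵒᵖ M] [IsScalarTower k Hᵐᵒᵖ M]
    [LeftComodule k H M] [IsSAYD k H M]
    [AddCommGroup V] [Module k V] [Module H V] [IsScalarTower k H V] :
    (∀ n, 2 ≤ n → Subsingleton ((cycMixed (freeAlg (HRep.of k H V)) M).HH n)) ∧
    (MixedData.IsQuasiIso (formsToX (freeAlg (HRep.of k H V)) M) ∧
      MixedData.IsSuperQuasiIso (formsToX (freeAlg (HRep.of k H V)) M)) ∧
    (MixedData.IsQuasiIso (cycToX (freeAlg (HRep.of k H V)) M) ∧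
      MixedData.IsSuperQuasiIso (cycToX (freeAlg (HRep.of k H V)) M)) ∧
    (∃ e : Natural (freeAlg (HRep.of k H V)) M (freeBarL (HRep.of k H V))
          (freeBarR (HRep.of k H V)) ≃ₗ[k] (redCycMixed (freeAlg (HRep.of k H V)) M).HC 0,
      ∀ (m : M) (f : freeBar (HRep.of k H V)),
        e (Submodule.Quotient.mk (HTens.mk (freeBar (HRep.of k H V)) m f))
          = (redCycMixed (freeAlg (HRep.of k H V)) M).zeroClass
              (Submodule.Quotient.mk (HTens.mk (freeAlg (HRep.of k H V)).toHRep m f.1))) ∧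
    (∀ n, 1 ≤ n → Subsingleton ((redCycMixed (freeAlg (HRep.of k H V)) M).HC n)) := by
  have hφ := freeCochain_isCochain (HRep.of k H V)
  have h1 := freeCochain_one (HRep.of k H V)
  have hc := cycMixed_exactAbove M hφ
  have hf := formsToX_isQuasiIso (formsMixed_exactAbove M hφ h1)
  have hx := cycToX_isQuasiIso hc
  exact ⟨hc.subsingleton_HH, ⟨hf, hf.isSuperQuasiIso (formsToX_surjective _ M)⟩,
    ⟨hx, hx.isSuperQuasiIso (cycToX_surjective _ M)⟩,
    ⟨freeBarEquiv (HRep.of k H V) M, freeBarEquiv_mk⟩,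
    (cut_isEuler (HRep.of k H V)).HC_subsingleton (redCycMixed_exactAbove M hφ h1)⟩
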